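/- All graphs are finite, simple and undirected. A graph is tetravalent if every vertex has exactly four neighbors. A distance magic labeling of a tetravalent graph $\Gamma$ of order $n$ is a bijection $\ell\colon V(\Gamma)\to\{1-n,3-n,\dots,n-1\}$ (the arithmetic progression with common difference $2$) such that for each vertex $v$ the labels of the neighbors of $v$ sum to $0$. For a vertex $v$ let $v^\ell$ be the unique vertex with $\ell(v)+\ell(v^\ell)=0$. The labeling $\ell$ is self-reverse if for all vertices $u,v$ we have $u\sim v$ if and only if $u^\ell\sim v^\ell$. It is degenerate if there are vertices $u,v$ with $u\ne u^\ell$ and $v\ne v^\ell$ such that $u$ is adjacent to both $v$ and $v^\ell$; otherwise it is non-degenerate. For $m\ge 3$ the wreath graph $W(m)$ is the graph with vertices $x_i,y_i$ ($i\in\mathbb{Z}_m$) in which each of $x_i,y_i$ is adjacent to each of $x_{i-1},y_{i-1},x_{i+1},y_{i+1}$ (subscripts modulo $m$); a graph is a wreath graph if it is isomorphic to $W(m)$ for some $m\ge 3$. Theorem 6.1. Let $n\ge 5$ be an integer. Then the following all hold. (i) There exists a connected tetravalent graph of order $n$ admitting a self-reverse distance magic labeling if and only if either $n$ is even with $n\ge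 6$, or $n$ is odd with $n\ge 21$. (ii) There exists a connected tetravalent graph of order $n$ admitting a non-degenerate self-reverse distance magic labeling if and only if either $n\ge 23$ or $n\in\{8,16,18,20,21\}$. (iii) There exists a connected tetravalent graph of order $n$ which is not a wreath graph but admits a self-reverse distance magic labeling if and only if $n\ge 18$ and $n\notin\{19,22\}$. -/

import Mathlib

/-- The label set `{1 - n, 3 - n, …, n - 1}`: the `n` terms of the arithmetic progression
with first term `1 - n` and common difference `2`. -/
def labelSet (n : ℕ) : Set ℤ := {k | ∃ i : ℕ, i < n ∧ k = 1 - (n : ℤ) + 2 * (i : ℤ)}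

open Classical in
/-- `G` is tetravalent: every vertex has exactly four neighbors. -/
def IsTetravalent {V : Type*} [Fintype V] (G : SimpleGraph V) : Prop :=
  G.IsRegularOfDegree 4

open Classical in
/-- A distance magic labeling of a (regular) graph `G` of order `n`: a bijection from the vertices
onto `{1 - n, 3 - n, …, n - 1}` such that the labels of the neighbors of each vertex sum to `0`. -/
structure IsDistanceMagicLabeling {V : Type*} [Fintype V] (G : SimpleGraph V) (l : V → ℤ) :
    Prop where
  bijOn : Set.BijOn l Set.univ (labelSet (Fintype.card V))
  sum_neighbors : ∀ v : V, ∑ u ∈ G.neighborFinset v, l u = 0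

/-- `v'` is the vertex paired with `v` by `l`, that is, the labels of `v` and `v'` sum to `0`
(for a distance magic labeling there is exactly one such `v'`, see `existsUnique_isPaired`). -/
def IsPaired {V : Type*} (l : V → ℤ) (v v' : V) : Prop := l v + l v' = 0

theorem existsUnique_isPaired {V : Type*} [Fintype V] {G : SimpleGraph V} {l : V → ℤ}
    (h : IsDistanceMagicLabeling G l) (v : V) : ∃! v', IsPaired l v v' := by
  obtain ⟨i, hi, hv⟩ := h.bijOn.mapsTo (Set.mem_univ v)
  have hm : -l v ∈ labelSet (Fintype.card V) := ⟨Fintype.card V - 1 - i, by omega, by omega⟩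
  obtain ⟨w, -, hw⟩ := h.bijOn.surjOn hm
  refine ⟨w, by simp [IsPaired, hw], fun y hy => ?_⟩
  apply h.bijOn.injOn (Set.mem_univ y) (Set.mem_univ w)
  unfold IsPaired at hy
  omega

/-- The labeling `l` is self-reverse: vertices `u` and `v` are adjacent if and only if the vertices
paired with them are adjacent. -/
def IsSelfReverse {V : Type*} (G : SimpleGraph V) (l : V → ℤ) : Prop :=
  ∀ u v u' v' : V, IsPaired l u u' → IsPaired l v v' → (G.Adj u v ↔ G.Adj u' v')

/-- The labeling `l` is degenerate: there are vertices `u` and `v`, each different from the vertex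
paired with it, such that `u` is adjacent both to `v` and to the vertex paired with `v`. -/
def IsDegenerateLabeling {V : Type*} (G : SimpleGraph V) (l : V → ℤ) : Prop :=
  ∃ u u' v v' : V, IsPaired l u u' ∧ IsPaired l v v' ∧ u ≠ u' ∧ v ≠ v' ∧ G.Adj u v ∧ G.Adj u v'

/-- The wreath graph `W(m)`, of interest for `m ≥ 3`: the vertices are `x_i = (i, false)` and
`y_i = (i, true)` for `i` in `ℤ/m`, and each of `x_i`, `y_i` is adjacent to each of `x_{i-1}`,
`y_{i-1}`, `x_{i+1}`, `y_{i+1}`. The clause `p.1 ≠ q.1`, automatic for `m ≥ 3`, excludes loops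
when `m = 1`. -/
def wreathGraph (m : ℕ) : SimpleGraph (ZMod m × Bool) where
  Adj p q := p.1 ≠ q.1 ∧ (q.1 = p.1 - 1 ∨ q.1 = p.1 + 1)
  symm := ⟨fun p q h => ⟨h.1.symm, h.2.elim (fun e => Or.inr (by rw [e]; ring))
    (fun e => Or.inl (by rw [e]; ring))⟩⟩
  loopless := ⟨fun _ h => h.1 rfl⟩

/-- `G` is (isomorphic to) a wreath graph `W(m)` with `m ≥ 3`. -/
def IsWreathGraph {V : Type*} (G : SimpleGraph V) : Prop :=
  ∃ m : ℕ, 3 ≤ m ∧ Nonempty (G ≃g wreathGraph m)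

/-!
A self-reverse distance magic labeling turns the graph into a graph on the labels themselves, its
*code* (`IsCode`): the neighborhoods have four elements with sum zero, and negation of labels is an
automorphism. Everything takes place there, through `isCode_labelCode` and `codeGraph`.

*Degenerate codes.* If a label is adjacent to `b` and `-b`, then its other two neighbors are
opposite as well, since the sum is zero. This spreads along the edges, so in a connected degenerate
code all neighborhoods are closed under negation (`IsCode.neg_mem_of_degenerate`). Hence `0` is not
a label, the order is even, and opposite labels have equal neighborhoods. A connected tetravalent
graph whose vertices fall into pairs of such twins is a cycle of pairs, which is a wreath graph
(`IsTwinning.isWreathGraph`).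

*Nondegenerate codes.* Index rows and columns by the nonnegative labels, with the entry `1` if `a`
and `b` are adjacent, `-1` if `a` and `-b` are adjacent, and `0` otherwise (`quotientMatrix`).
Nondegeneracy leaves no ambiguity for nonzero labels. The matrix is symmetric, has four nonzero
entries in a row (for the label `0`, two ones), and each row is orthogonal to the vector of labels.
For a given order there are finitely many candidates for each row, and an exhaustive search through
the symmetric matrices finds none if the order is odd and less than `21`, or one of `6`, `10`, `12`,
`14`, `22`. For the orders `8` and `16` it finds that the rows coincide in pairs up to sign, so that
the graph is again a wreath graph (`IsCode.exists_twins`). The search is written so that the kernel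
can evaluate it: the candidates that are still possible are the binary digits of one natural number,
and arithmetic on such numbers tests all candidates for a row at once (`SymSearch.node`).

*Existence.* Suppose that a nondegenerate code has labels `X`, `Y` with `X + Y = 2`, both adjacent
to both of `-X`, `-Y`. Replacing these four edges by a chain of new labels gives a code whose order
is larger by eight, again with such a pair (`IsGluable.step`). A label that has no twin and is not
in the pair keeps its neighborhood, so no wreath graph arises (`IsCode.not_isWreathGraph`). Tables
for the orders `18`, `20`, `21`, `23`, `24`, `25`, `27`, `30` therefore yield all orders from `23`
on, and `18`, `20`, `21`. For the other even orders, wreath graphs with opposite labels on twins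
suffice, and two more tables give nondegenerate labelings of orders `8` and `16`.
-/

/-! ### The exhaustive search on bit sets -/

/-! The definitions below are evaluated by the kernel. They are therefore written with recursors,
and in continuation-passing style: a value reaches its continuation in normal form. -/

namespace SymSearch

/-- A row of a matrix, from the last column to the first. -/
abbrev Row := List SignType

/-- The value `k n`, for which `n` is evaluated to a numeral first. -/
noncomputable def force (n : ℕ) (k : ℕ → Bool) : Bool := Nat.rec false (fun p _ => k p) (Nat.succ n)

/-- The conjunction of `b` and `c`, where `c` is not evaluated if `b` is false. -/
noncomputable def guard (b c : Bool) : Bool := Bool.rec false c b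

/-- The number with the digit one in the lowest place of each of `n` lanes of width `W`. -/
noncomputable def ones (W n : ℕ) : ℕ :=
  Nat.rec 0 (fun _ ih => Nat.add 1 (Nat.mul (Nat.pow 2 W) ih)) n

/-- For `l = 2 ^ i` the digits of the `i`-th lane of `T` that `lo` selects. -/
noncomputable def lane (W lo T l : ℕ) : ℕ :=
  Nat.div (Nat.land T (Nat.mul lo (Nat.pow l W))) (Nat.pow l W)

/-- The value of `go` at the state `x` after the choice with mask `f l`. -/
noncomputable def visit (f : ℕ → ℕ) (go : ℕ → Bool) (x l : ℕ) : Bool := force (Nat.land x (f l)) go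

/-- Whether `v` is true at all powers of two in the binary expansion of a positive number. -/
noncomputable def each (v : ℕ → Bool) (fuel : ℕ) : ℕ → Bool :=
  Nat.rec (fun _ => false) (fun _ ih p =>
    Bool.rec false (Bool.rec (ih (Nat.land p (Nat.sub p 1))) true
        (Nat.beq (Nat.land p (Nat.sub p 1)) 0))
      (force (Nat.sub p (Nat.land p (Nat.sub p 1))) v)) fuel

/-- The data for the choice of one row: the lane width `W`, the table `T` of the masks of the
candidates, and constants derived from the layout of the lanes. -/
inductive Level
  | mk (W lo md rep T C H K top fuel : ℕ)

/-- One step of the search. The state `x` has a block of digits for each row that is not chosen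
yet, with a one for each candidate that is still alive. The candidate in lane `i`, whose mask is
`M i`, is possible if `x &&& M i` has no empty block. All lanes are tested at once: adding `C`
carries into the top digit of each nonempty block, adding `K` carries into the top digit of each
lane in which all these digits are ones, and reduction modulo `md = 2 ^ (W - 1) - 1` gathers the
top digits of the lanes. The value is true if `go` is true after each possible choice. -/
noncomputable def node (W lo md rep T C H K top fuel : ℕ) (go : ℕ → Bool) (x : ℕ) : Bool :=
  force (Nat.mod
      (Nat.land (Nat.add (Nat.land (Nat.add (Nat.land (Nat.mul x rep) T) C) H) K) top) md)
    fun p => Bool.rec (each (visit (lane W lo T) go x) fuel p) true (Nat.beq p 0)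

/-- Whether no sequence of choices at the given levels is possible. -/
noncomputable def run (ls : List Level) : ℕ → Bool :=
  List.rec (fun _ => false) (fun lv _ ih => Level.rec (fun W lo md rep T C H K top fuel =>
    node W lo md rep T C H K top fuel ih) lv) ls

/-! #### Tables -/

/-- The sets of the candidates for a row with entry `0`, `-1`, `1` in a given column. -/
inductive Masks
  | mk (z n p : ℕ)

noncomputable def pick (v : SignType) (t : Masks) : ℕ :=
  Masks.rec (fun z n p => SignType.rec z n p v) t

/-- The masks `z`, `n`, `p`, cut to `S - 1` digits. -/
noncomputable def forceM (S z n p : ℕ) (k : Masks → Bool) : Bool :=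
  force (Nat.mod z (Nat.pow 2 (Nat.sub S 1))) fun z =>
  force (Nat.mod n (Nat.pow 2 (Nat.sub S 1))) fun n =>
  force (Nat.mod p (Nat.pow 2 (Nat.sub S 1))) fun p => k (.mk z n p)

/-- The masks of the candidates `L` for their first column. -/
noncomputable def masks (S : ℕ) (L : List Row) : (Masks → Bool) → Bool :=
  List.rec (fun k => k (.mk 0 0 0)) (fun r _ ih k => ih fun t => Masks.rec (fun z n p =>
    SignType.rec (forceM S (Nat.add (Nat.mul 2 z) 1) (Nat.mul 2 n) (Nat.mul 2 p) k)
      (forceM S (Nat.mul 2 z) (Nat.add (Nat.mul 2 n) 1) (Nat.mul 2 p) k)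
      (forceM S (Nat.mul 2 z) (Nat.mul 2 n) (Nat.add (Nat.mul 2 p) 1) k) (r.headD .zero)) t) L

/-- The masks of each of the candidate lists `ds` for its first column. -/
noncomputable def masksL (S : ℕ) (ds : List (List Row)) : (List Masks → Bool) → Bool :=
  List.rec (fun k => k []) (fun d _ ih k => masks S d fun t => ih fun l => k (t :: l)) ds

/-- The blocks of the candidates for the remaining rows that agree, by symmetry, with the row `r`,
below the digits of `a`. -/
noncomputable def maskOf (S : ℕ) (T : List Masks) : Row → ℕ → ℕ :=
  List.rec (fun _ a => a) (fun t _ ih r a =>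
    ih r.tail (Nat.add (Nat.mul a (Nat.pow 2 S)) (pick (r.headD .zero) t))) T

/-- The number `M` with `64` digits appended that depend on all digits of `M`. They have no meaning,
but the kernel finds numerals by a hash of their lowest `64` digits, so that these should differ
between different states of the search. The moduli are primes just below `2 ^ 64`. -/
noncomputable def salt (M : ℕ) : ℕ := Nat.add (Nat.mul M 18446744073709551616)
  (Nat.mod (Nat.lor (Nat.lor (Nat.mod M 18446744073709551557) (Nat.mod M 18446744073709551533))
    (Nat.mod M 18446744073709551521)) 18446744073709551616)

/-- A candidate with its index in the list of candidates. -/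
inductive Op
  | mk (i : ℕ) (r : Row)

/-- The mask of a candidate; its topmost block consists of the candidate alone. -/
noncomputable def opMask (S : ℕ) (T : List Masks) (o : Op) : ℕ :=
  Op.rec (fun i r => salt (maskOf S T r (Nat.mod (Nat.pow 2 i) (Nat.pow 2 (Nat.sub S 1))))) o

/-- The number of candidates and the numbers `f o` written into consecutive lanes. -/
noncomputable def table (W : ℕ) (f : Op → ℕ) (L : List Op) : (ℕ → ℕ → Bool) → Bool :=
  List.rec (fun k => k 0 0) (fun o _ ih k => ih fun n t => force (f o) fun M =>
    force (Nat.add M (Nat.mul (Nat.pow 2 W) t)) (k (Nat.succ n))) L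

/-- The level for the row of height `h`, with blocks of width `S`. The value is false if the number
of candidates exceeds what the reduction modulo `md` in `node` can gather. -/
noncomputable def level (S h : ℕ) (T : List Masks) (L : List Op) (k : Level → Bool) : Bool :=
  force (65 + S * (h + 1)) fun W => table W (opMask S T) L fun n t =>
  guard (Nat.ble (n + 2) W) <|
  force (ones W n) fun rep =>
  force (2 ^ 64 * ones S (h + 1)) fun blk =>
  force (2 ^ (64 + S * h) - 1) fun lo =>
  force (2 ^ (W - 1) - 1) fun md =>
  force ((2 ^ (S - 1) - 1) * blk * rep) fun C =>
  force (2 ^ (S - 1) * blk * rep) fun H =>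
  force ((2 ^ (W - 1) - 2 ^ (S - 1) * blk) * rep) fun K =>
  force (2 ^ (W - 1) * rep) fun top => k (.mk W lo md rep t C H K top (n + 1))

noncomputable def index (c : List Row) : ℕ → List Op :=
  List.rec (fun _ => []) (fun r _ ih i => Op.mk i r :: ih (Nat.succ i)) c

/-- The candidates distributed by their first entry, which is removed. -/
noncomputable def split (L : List Op) : (List Op → List Op → List Op → Bool) → Bool :=
  List.rec (fun k => k [] [] []) (fun o _ ih k => Op.rec (fun i r => ih fun a b c =>
    SignType.rec (k (.mk i r.tail :: a) b c) (k a (.mk i r.tail :: b) c)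
      (k a b (.mk i r.tail :: c)) (r.headD .zero)) o) L

noncomputable def dropR (k : ℕ) : Row → Row := Nat.rec (fun r => r) (fun _ ih r => ih r.tail) k

noncomputable def dropOp (k : ℕ) (L : List Op) : List Op :=
  L.map fun o => Op.rec (fun i r => Op.mk i (dropR k r)) o

/-- The nine levels for one row, by its entries in the last two columns. -/
inductive Tree
  | mk (a b c d e f g h i : Level)

/-- The tree for the row of height `h` with candidates `c`. After the entries in the last two
columns the next `k` are skipped: they belong to this row and to rows that are chosen before it. -/
noncomputable def tree (S h k : ℕ) (T : List Masks) (c : List Row) (K : Tree → Bool) : Bool :=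
  split (index c 0) fun A B C => split A fun a b c => split B fun d e f => split C fun g h' i =>
  level S h T (dropOp k a) fun a => level S h T (dropOp k b) fun b =>
  level S h T (dropOp k c) fun c => level S h T (dropOp k d) fun d =>
  level S h T (dropOp k e) fun e => level S h T (dropOp k f) fun f =>
  level S h T (dropOp k g) fun g => level S h T (dropOp k h') fun h' =>
  level S h T (dropOp k i) fun i =>
  K (.mk a b c d e f g h' i)

noncomputable def forceS (v : SignType) (k : SignType → Bool) : Bool :=
  SignType.rec (k .zero) (k .neg) (k .pos) v

noncomputable def forceR (l : Row) : (Row → Bool) → Bool :=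
  List.rec (fun k => k []) (fun v _ ih k => forceS v fun v => ih fun l => k (v :: l)) l

noncomputable def forceRs (l : List Row) : (List Row → Bool) → Bool :=
  List.rec (fun k => k []) (fun t _ ih k => forceR t fun t => ih fun l => k (t :: l)) l

noncomputable def forceRss (l : List (List Row)) : (List (List Row) → Bool) → Bool :=
  List.rec (fun k => k []) (fun t _ ih k => forceRs t fun t => ih fun l => k (t :: l)) l

noncomputable def tails (L : List (List Row)) : List (List Row) := L.map fun l => l.map List.tail

/-- The trees for the candidate lists `os`, ordered by descending height of the row; in `ds` the
candidates are cut off at the column of the first of these rows. -/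
noncomputable def trees (S : ℕ) (os : List (List Row)) :
    ℕ → List (List Row) → (List Tree → Bool) → Bool :=
  List.rec (fun _ _ K => K []) (fun o os ih k ds K =>
    masksL S ds.tail fun T => tree S os.length k T o fun t =>
      forceRss (tails ds.tail) fun ds => ih (k + 1) ds fun l => K (t :: l)) os

/-! #### The search -/

/-- The level that belongs to the entries `u`, `v` in the last two columns. -/
noncomputable def getLv (u v : SignType) (t : Tree) : Level :=
  Tree.rec (fun a b c d e f g h i =>
    SignType.rec (SignType.rec a b c v) (SignType.rec d e f v) (SignType.rec g h i v) u) t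

noncomputable def forceLv (l : Level) (k : Level → Bool) : Bool :=
  Level.rec (fun W lo md rep T C H K top fuel => k (.mk W lo md rep T C H K top fuel)) l

/-- The levels of the remaining rows, given the rows `r` and `s` of the two greatest heights. -/
noncomputable def select (ts : List Tree) : Row → Row → (List Level → Bool) → Bool :=
  List.rec (fun _ _ k => k []) (fun t _ ih r s k => ih r.tail s.tail fun l =>
    forceLv (getLv (r.headD .zero) (s.headD .zero) t) fun lv => k (lv :: l)) ts

noncomputable def eqS (u v : SignType) : Bool :=
  SignType.rec (SignType.rec true false false v) (SignType.rec false true false v)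
    (SignType.rec false false true v) u

/-- A candidate for one of the two rows chosen first: its entry `u` in the column of the other one,
its entries `r` in the columns of the remaining rows, and its mask `M`. -/
inductive Start
  | mk (u : SignType) (r : Row) (M : ℕ)

/-- The candidates `c` for one of the first two rows; `d` reads the entry shared with the other. -/
noncomputable def starts (S : ℕ) (T : List Masks) (d : Row → SignType) (c : List Row) :
    (List Start → Bool) → Bool :=
  List.rec (fun k => k []) (fun r _ ih k => force (salt (maskOf S T r.tail.tail 0)) fun M =>
    forceR r.tail.tail fun s => forceS (d r) fun u => ih fun l => k (.mk u s M :: l)) c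

/-- Whether the search fails for all choices of the first two rows. -/
noncomputable def pairs (ts : List Tree) (a b : List Start) : Bool :=
  List.rec true (fun p _ ih => Start.rec (fun u r M =>
    guard (List.rec true (fun q _ ih => Start.rec (fun v s N =>
      guard (Bool.rec true (select ts r s fun lv => force (Nat.land M N) (run lv)) (eqS u v)) ih)
        q) b) ih) p) a

/-- Whether each list of candidates fits into the `S - 1` digits available in a block. -/
noncomputable def small (S : ℕ) (cs : List (List Row)) : Bool :=
  List.rec true (fun c _ ih => guard (Nat.ble (c.length + 1) S) ih) cs

/-- Whether no symmetric matrix has its first rows in `f c0` and `c1` and the others in `cs`. -/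
noncomputable def search (S : ℕ) (f : List Row → List Row) (c0 c1 : List Row)
    (cs : List (List Row)) : Bool :=
  guard (small S cs) <|
  forceRss (tails cs) fun c1s => forceRss (tails c1s) fun c2s =>
  trees S cs 1 c2s fun ts =>
  masksL S cs fun T0 => masksL S c1s fun T1 =>
  starts S T0 (fun r => r.tail.headD .zero) (f c0) fun a =>
  starts S T1 (fun r => r.headD .zero) c1 fun b => pairs ts a b

/-- The rows of length `n` with `d` nonzero entries `v h` such that `∑ h, (v h + 1) * w h = t`. -/
noncomputable def rows (w : ℕ → ℕ) (n : ℕ) : ℕ → ℕ → List Row :=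
  Nat.rec (fun d t => Bool.rec [] [[]] (Nat.beq (Nat.add d t) 0)) (fun n ih d t =>
    (Bool.rec [] (List.map (.zero :: ·) (ih d (Nat.sub t (w n)))) (Nat.ble (w n) t)) ++
    Nat.rec [] (fun d _ => List.map (.neg :: ·) (ih d t) ++
      Bool.rec [] (List.map (.pos :: ·) (ih d (Nat.sub t (Nat.mul 2 (w n)))))
        (Nat.ble (Nat.mul 2 (w n)) t)) d) n

noncomputable def notPos (v : SignType) : Bool := SignType.rec true true false v

/-- The candidates for the rows of height below `n` in a matrix of size `N`, in descending order of
the height: the rows in `R`, or in `Z` for the height `0`, with a diagonal entry other than `1`. -/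
noncomputable def lists (R Z : List Row) (N n : ℕ) : List (List Row) :=
  Nat.rec [] (fun h ih => List.filter (fun r => notPos ((dropR (N - 1 - h) r).headD .zero))
    (Nat.rec Z (fun _ _ => R) h) :: ih) n

/-- Whether the search finds no symmetric matrix of size `N` without `1` on the diagonal, with row
`0` in `Z` and the other rows in `R`; only the rows selected by `f` are tried for the last one. -/
noncomputable def refute (S : ℕ) (f : List Row → List Row) (R Z : List Row) (N : ℕ) : Bool :=
  forceRs R fun R => forceRs Z fun Z => forceRss (lists R Z N N) fun cs =>
  List.rec false (fun c0 cs _ => List.rec false (fun c1 cs _ => search S f c0 c1 cs) cs) cs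

/-- The search for the order `2 * m`: all rows are orthogonal to the labels `1, 3, …, 2 * m - 1` and
have four nonzero entries. The sum over `v h + 1` instead of `v h` is `1 + 3 + ⋯ = m * m`. -/
noncomputable def refuteEven (S m : ℕ) (f : List Row → List Row) : Bool :=
  refute S f (rows (fun h => 2 * h + 1) m 4 (m * m)) (rows (fun h => 2 * h + 1) m 4 (m * m)) m

/-- The search for the order `2 * k + 1`, where row `0` belongs to the label `0`: it consists of two
ones and `k - 1` zeros, and the other rows are orthogonal to `0, 2, …, 2 * k`. -/
noncomputable def refuteOdd (S k : ℕ) : Bool :=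
  refute S id (rows (fun h => 2 * h) (k + 1) 4 (k * (k + 1))) (rows (fun _ => 1) (k + 1) 2 (k + 3))
    (k + 1)

end SymSearch

/-! ### Binary digits, lanes and blocks -/

namespace SymSearch

theorem force_eq (n : ℕ) (k : ℕ → Bool) : force n k = k n := by cases n <;> rfl

theorem guard_eq_true {b c : Bool} : guard b c = true ↔ b = true ∧ c = true := by
  cases b <;> cases c <;> decide

/-- The number formed by the `W` binary digits of `X` from position `o` on. -/
def field (W o X : ℕ) : ℕ := X / 2 ^ o % 2 ^ W

theorem testBit_field (W o X b : ℕ) :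
    (field W o X).testBit b = (decide (b < W) && X.testBit (o + b)) := by
  rw [field, Nat.testBit_mod_two_pow, Nat.testBit_div_two_pow, Nat.add_comm]

theorem field_field {W S b : ℕ} (o X : ℕ) (h : b + S ≤ W) :
    field S b (field W o X) = field S (o + b) X := by
  apply Nat.eq_of_testBit_eq
  intro i
  simp only [testBit_field]
  by_cases hi : i < S
  · have : b + i < W := by omega
    simp [hi, this, Nat.add_assoc]
  · simp [hi]

/-- If the fields of two numbers add up to at least half of `2 ^ S`, then the top digit of the
field is set in the sum. The strict upper bound leaves room for a carry from the digits below. -/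
theorem testBit_add_of_field {S o X Y : ℕ} (hS : 0 < S)
    (h₁ : 2 ^ (S - 1) ≤ field S o X + field S o Y)
    (h₂ : field S o X + field S o Y + 1 < 2 ^ S) : (X + Y).testBit (o + (S - 1)) = true := by
  have hb : (field S o (X + Y)).testBit (S - 1) = true := by
    have hc : ∃ c ≤ 1, field S o (X + Y) = field S o X + field S o Y + c := by
      unfold field at *
      have hd := Nat.add_div (a := X) (b := Y) (c := 2 ^ o) (by positivity)
      split_ifs at hd with hif
      · refine ⟨1, le_rfl, ?_⟩
        rw [hd, Nat.add_mod, Nat.add_mod (X / 2 ^ o) (Y / 2 ^ o)]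
        have h1 : 1 % 2 ^ S = 1 := Nat.mod_eq_of_lt (Nat.one_lt_two_pow (by omega))
        rw [h1, Nat.mod_eq_of_lt (a := X / 2 ^ o % 2 ^ S + Y / 2 ^ o % 2 ^ S) (by omega),
          Nat.mod_eq_of_lt (by omega)]
      · refine ⟨0, by omega, ?_⟩
        rw [hd, Nat.add_zero, Nat.add_mod, Nat.mod_eq_of_lt (by omega)]
        rfl
    obtain ⟨c, hc, he⟩ := hc
    apply Nat.testBit_of_two_pow_le_and_two_pow_add_one_gt
    · omega
    · rw [Nat.sub_add_cancel hS]; omega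
  rw [testBit_field, Bool.and_eq_true] at hb
  exact hb.2

/-- The entries of `l` written one after the other into lanes of `W` binary digits. -/
def pack (W : ℕ) : List ℕ → ℕ
  | [] => 0
  | a :: l => a + 2 ^ W * pack W l

theorem ones_zero (W : ℕ) : ones W 0 = 0 := rfl
theorem ones_succ (W n : ℕ) : ones W (n + 1) = 1 + 2 ^ W * ones W n := rfl

theorem mul_ones (W n c : ℕ) : c * ones W n = pack W (List.replicate n c) := by
  induction n with
  | zero => simp [ones_zero, pack]
  | succ n ih => rw [ones_succ, List.replicate_succ, pack, ← ih]; ring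

theorem pack_lt {W : ℕ} {l : List ℕ} (h : ∀ a ∈ l, a < 2 ^ W) : pack W l < 2 ^ (W * l.length) := by
  induction l with
  | nil => simp [pack]
  | cons a l ih =>
    have h1 := ih fun b hb => h b (List.mem_cons_of_mem _ hb)
    have h2 := h a List.mem_cons_self
    rw [pack, List.length_cons, Nat.mul_succ, pow_add]
    nlinarith [Nat.two_pow_pos W]

theorem field_pack {W : ℕ} {l : List ℕ} (h : ∀ a ∈ l, a < 2 ^ W) {i a : ℕ} (hi : l[i]? = some a) :
    field W (W * i) (pack W l) = a := by
  induction l generalizing i with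
  | nil => simp at hi
  | cons b l ih =>
    have h2 := h b List.mem_cons_self
    rw [field, pack]
    cases i with
    | zero =>
      simp at hi
      subst hi
      simp [Nat.mod_eq_of_lt h2]
    | succ i =>
      have := ih (fun b hb => h b (List.mem_cons_of_mem _ hb)) (by simpa using hi)
      rw [Nat.mul_succ, Nat.add_comm (W * i), pow_add, ← Nat.div_div_eq_div_mul,
        Nat.add_mul_div_left _ _ (Nat.two_pow_pos W), Nat.div_eq_of_lt h2, Nat.zero_add]
      exact this

theorem mul_ones_lt {W n c : ℕ} (h : c < 2 ^ W) : c * ones W n < 2 ^ (W * n) := by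
  rw [mul_ones]
  simpa using pack_lt (W := W) (l := List.replicate n c)
      (by intro a ha; rw [List.eq_of_mem_replicate ha]; exact h)

theorem field_mul_ones {W n c i : ℕ} (h : c < 2 ^ W) (hi : i < n) :
    field W (W * i) (c * ones W n) = c := by
  rw [mul_ones]
  apply field_pack
  · intro a ha; rw [List.eq_of_mem_replicate ha]; exact h
  · simp [hi]

/-- Clearing the lowest digit of `p` by `p &&& (p - 1)` removes a single power of two. -/
theorem and_sub_one {p : ℕ} (hp : p ≠ 0) : ∃ a, p - (p &&& (p - 1)) = 2 ^ a ∧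
    ∀ i, p.testBit i = true → i = a ∨ (p &&& (p - 1)).testBit i = true := by
  obtain ⟨a, m, ⟨b, rfl⟩, rfl⟩ := Nat.exists_eq_two_pow_mul_odd hp
  have h2 := Nat.two_pow_pos a
  have e1 : 2 ^ a * (2 * b + 1) - 1 = 2 ^ a * (2 * b) + (2 ^ a - 1) := by
    rw [Nat.mul_add, Nat.mul_one, Nat.add_sub_assoc h2]
  have hbit : ∀ i, (2 * b + 1).testBit i = (decide (i = 0) || (2 * b).testBit i) := by
    intro i
    cases i with
    | zero => simp
    | succ i => simp [Nat.testBit_succ]; congr 1; omega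
  have key : ∀ i, (2 ^ a * (2 * b + 1)).testBit i =
      (decide (i = a) || (2 ^ a * (2 * b)).testBit i) := by
    intro i
    rw [Nat.testBit_two_pow_mul, Nat.testBit_two_pow_mul, hbit]
    by_cases h : a ≤ i
    · have : (i - a = 0) ↔ (i = a) := by omega
      simp [h, this]
    · have : i ≠ a := by omega
      simp [h, this]
  have e2 : 2 ^ a * (2 * b + 1) &&& (2 ^ a * (2 * b + 1) - 1) = 2 ^ a * (2 * b) := by
    apply Nat.eq_of_testBit_eq
    intro i
    rw [Nat.testBit_and, key, e1, Nat.testBit_two_pow_mul_add _ (by omega), Nat.testBit_two_pow_mul]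
    by_cases h : i < a
    · have h3 : i ≠ a := by omega
      have h4 : ¬ a ≤ i := by omega
      simp [h3, h4]
    · have h4 : a ≤ i := by omega
      by_cases h3 : i = a
      · subst h3; simp
      · simp [h, h3, h4]
  refine ⟨a, ?_, fun i hi => ?_⟩
  · rw [e2, Nat.mul_add, Nat.mul_one, Nat.add_sub_cancel_left]
  · rw [e2]; rw [key] at hi; simpa using hi

theorem each_sound {v : ℕ → Bool} {fuel p i : ℕ} (h : each v fuel p = true)
    (hp : p.testBit i = true) :
    v (2 ^ i) = true := by
  induction fuel generalizing p with
  | zero => exact absurd h (by simp [each])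
  | succ n ih =>
    have hp0 : p ≠ 0 := by rintro rfl; simp at hp
    obtain ⟨a, ha, hb⟩ := and_sub_one hp0
    have h' : guard (v (p - (p &&& (p - 1)))) (Bool.rec (each v n (p &&& (p - 1))) true
      (Nat.beq (p &&& (p - 1)) 0)) = true := h
    rw [guard_eq_true, ha] at h'
    obtain ⟨h1, h2⟩ := h'
    rcases hb i hp with rfl | hq
    · exact h1
    · refine ih ?_ hq
      have : Nat.beq (p &&& (p - 1)) 0 = false := by
        cases h0 : Nat.beq (p &&& (p - 1)) 0 with
        | false => rfl
        | true => rw [Nat.eq_of_beq_eq_true h0] at hq; simp at hq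
      rw [this] at h2
      exact h2

/-- The top digits of the first lanes of `Z`, gathered into one number. -/
def gather (W : ℕ) : ℕ → ℕ → ℕ
  | 0, _ => 0
  | n + 1, Z => (Z.testBit (W - 1)).toNat + 2 * gather W n (Z / 2 ^ W)

theorem gather_lt (W n Z : ℕ) : gather W n Z < 2 ^ n := by
  induction n generalizing Z with
  | zero => simp [gather]
  | succ n ih =>
    have := ih (Z / 2 ^ W)
    have h2 := Bool.toNat_le (Z.testBit (W - 1))
    rw [gather, pow_succ]; omega

theorem testBit_gather {W n i : ℕ} (Z : ℕ) (hi : i < n) :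
    (gather W n Z).testBit i = Z.testBit (W * i + (W - 1)) := by
  induction n generalizing Z i with
  | zero => omega
  | succ n ih =>
    rw [gather]
    cases i with
    | zero => cases h : Z.testBit (W - 1) <;> simp [h]
    | succ i =>
      have e : ((Z.testBit (W - 1)).toNat + 2 * gather W n (Z / 2 ^ W)) / 2 =
          gather W n (Z / 2 ^ W) := by
        have h2 := Bool.toNat_le (Z.testBit (W - 1))
        omega
      rw [Nat.testBit_succ, e, ih _ (by omega), Nat.testBit_div_two_pow]
      congr 1; ring

/-- Since `2 ^ W` is `2` modulo `2 ^ (W - 1) - 1`, reduction gathers the top digits of the lanes. -/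
theorem and_top_mod {W n : ℕ} (Z : ℕ) (h : n + 2 ≤ W) :
    (Z &&& (2 ^ (W - 1) * ones W n)) % (2 ^ (W - 1) - 1) = gather W n Z := by
  have hmod : ∀ n Z, (Z &&& (2 ^ (W - 1) * ones W n)) ≡ gather W n Z [MOD 2 ^ (W - 1) - 1] := by
    have hW : 2 ^ W = 2 ^ (W - 1) * 2 := by rw [← pow_succ]; congr 1; omega
    have h1 : 2 ^ (W - 1) ≡ 1 [MOD 2 ^ (W - 1) - 1] := by
      have : 2 ^ (W - 1) = 1 + (2 ^ (W - 1) - 1) := by have := Nat.two_pow_pos (W - 1); omega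
      conv_lhs => rw [this]
      simp [Nat.ModEq]
    have h2 : 2 ^ W ≡ 2 [MOD 2 ^ (W - 1) - 1] := by
      rw [hW]; simpa using h1.mul_right 2
    intro n
    induction n with
    | zero => intro Z; simp [ones_zero, gather]; rfl
    | succ n ih =>
      intro Z
      have e : Z &&& (2 ^ (W - 1) * ones W (n + 1)) =
          2 ^ W * (Z / 2 ^ W &&& (2 ^ (W - 1) * ones W n)) +
            (Z.testBit (W - 1)).toNat * 2 ^ (W - 1) := by
        apply Nat.eq_of_testBit_eq
        intro i
        have hlt : (Z.testBit (W - 1)).toNat * 2 ^ (W - 1) < 2 ^ W := by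
          have h2 := Bool.toNat_le (Z.testBit (W - 1))
          have := Nat.two_pow_pos (W - 1)
          nlinarith
        have e1 : 2 ^ (W - 1) * ones W (n + 1) =
            2 ^ W * (2 ^ (W - 1) * ones W n) + 2 ^ (W - 1) := by
          rw [ones_succ]; ring
        rw [Nat.testBit_and, e1, Nat.testBit_two_pow_mul_add _
            (by rw [hW]; have := Nat.two_pow_pos (W - 1); omega),
          Nat.testBit_two_pow_mul_add _ hlt]
        by_cases hi : i < W
        · simp only [hi, if_true]
          rw [Nat.testBit_two_pow]
          by_cases hi2 : W - 1 = i
          · subst hi2; cases h : Z.testBit (W - 1) <;> simp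
          · cases h : Z.testBit (W - 1) <;> simp [hi2]
        · simp only [hi, if_false, Nat.testBit_and, Nat.testBit_div_two_pow]
          rw [Nat.sub_add_cancel (by omega)]
      rw [e, gather, Nat.add_comm]
      refine Nat.ModEq.add ?_ (Nat.ModEq.mul h2 (ih _))
      simpa using h1.mul_left (Z.testBit (W - 1)).toNat
  have h3 := hmod n Z
  rw [Nat.ModEq] at h3
  rw [h3, Nat.mod_eq_of_lt]
  have h4 := gather_lt W n Z
  have h5 : 2 ^ n ≤ 2 ^ (W - 2) := Nat.pow_le_pow_right (by norm_num) (by omega)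
  have h6 : 2 ^ (W - 1) = 2 * 2 ^ (W - 2) := by rw [← pow_succ']; congr 1; omega
  have := Nat.two_pow_pos (W - 2)
  omega

end SymSearch

/-! ### Soundness of a step of the search -/

namespace SymSearch

/-- The level for the masks `Ms` of the candidates for the row of height `h`. A lane has `64` digits
without meaning, then one block of `S` digits for each of the rows of height at most `h`, and one
further digit at the top. -/
noncomputable def levelOf (S h : ℕ) (Ms : List ℕ) : Level :=
  let W := 65 + S * (h + 1)
  let blk := 2 ^ 64 * ones S (h + 1)
  .mk W (2 ^ (64 + S * h) - 1) (2 ^ (W - 1) - 1) (ones W Ms.length) (pack W Ms)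
    ((2 ^ (S - 1) - 1) * blk * ones W Ms.length) (2 ^ (S - 1) * blk * ones W Ms.length)
    ((2 ^ (W - 1) - 2 ^ (S - 1) * blk) * ones W Ms.length) (2 ^ (W - 1) * ones W Ms.length)
    (Ms.length + 1)

/-- The candidates with the indices `t j`, for the rows of height `j < n`, are alive in `x`. -/
def Holds (S : ℕ) (t : ℕ → ℕ) (n x : ℕ) : Prop := ∀ j < n, x.testBit (64 + S * j + t j) = true

/-- The blocks of `x` do not use their top digits. -/
def TopFree (S n x : ℕ) : Prop := ∀ j < n, x.testBit (64 + S * j + (S - 1)) = false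

/-- In the level `lv` some mask keeps the candidates with the indices `t j` alive, and the layout of
the masks is as `node` needs it. -/
structure LevelOK (S : ℕ) (t : ℕ → ℕ) (h : ℕ) (lv : Level) : Prop where
  out : ∃ (Ms : List ℕ) (i M : ℕ), lv = levelOf S h Ms ∧ Ms.length + 2 ≤ 65 + S * (h + 1) ∧
    (∀ M ∈ Ms, M < 2 ^ (64 + S * (h + 1)) ∧ TopFree S (h + 1) M) ∧ Ms[i]? = some M ∧
    Holds S t (h + 1) M

theorem blk_lt {S n c : ℕ} (hc : c < 2 ^ S) : c * (2 ^ 64 * ones S n) < 2 ^ (64 + S * n) := by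
  have := mul_ones_lt (n := n) hc
  rw [pow_add]
  calc c * (2 ^ 64 * ones S n) = 2 ^ 64 * (c * ones S n) := by ring
    _ < _ := Nat.mul_lt_mul_of_pos_left this (by positivity)

theorem field_blk {S n c j : ℕ} (hc : c < 2 ^ S) (hj : j < n) :
    field S (64 + S * j) (c * (2 ^ 64 * ones S n)) = c := by
  have h := field_mul_ones hc hj
  unfold field at *
  rw [pow_add, ← Nat.div_div_eq_div_mul,
    show c * (2 ^ 64 * ones S n) = 2 ^ 64 * (c * ones S n) by ring,
    Nat.mul_div_cancel_left _ (by positivity)]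
  exact h

theorem testBit_blk {S n b : ℕ} (hS : 0 < S)
    (hb : (2 ^ (S - 1) * (2 ^ 64 * ones S n)).testBit b = true) :
    ∃ j < n, b = 64 + S * j + (S - 1) := by
  have hc : 2 ^ (S - 1) < 2 ^ S := Nat.pow_lt_pow_right (by norm_num) (by omega)
  have h64 : 64 ≤ b := by
    by_contra hlt
    rw [show 2 ^ (S - 1) * (2 ^ 64 * ones S n) = 2 ^ 64 * (2 ^ (S - 1) * ones S n) by ring,
      Nat.testBit_two_pow_mul] at hb
    simp [hlt] at hb
  have hlt := blk_lt (n := n) hc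
  have hbn : b < 64 + S * n := by
    by_contra hge
    rw [Nat.testBit_lt_two_pow (hlt.trans_le (Nat.pow_le_pow_right (by norm_num) (by omega)))] at hb
    simp at hb
  obtain ⟨d, rfl⟩ := Nat.exists_eq_add_of_le h64
  have hj : d / S < n := Nat.div_lt_of_lt_mul (by omega)
  have hd := Nat.div_add_mod d S
  have hr := Nat.mod_lt d hS
  refine ⟨d / S, hj, ?_⟩
  have hf := field_blk hc hj
  have hbit : (field S (64 + S * (d / S)) (2 ^ (S - 1) * (2 ^ 64 * ones S n))).testBit (d % S) =
      true := by
    rw [testBit_field, Nat.add_assoc, hd, hb]; simp [hr]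
  rw [hf, Nat.testBit_two_pow] at hbit
  have := of_decide_eq_true hbit
  omega

/-- If the candidates with the indices `t j` are alive in the state `x` and in the mask `M`, then
the step tries the choice of `M`, and they are alive in the state that follows it. -/
theorem node_sound {S h : ℕ} {t : ℕ → ℕ} {Ms : List ℕ} {i M x : ℕ} {go : ℕ → Bool} (hS : 1 < S)
    (hlen : Ms.length + 2 ≤ 65 + S * (h + 1))
    (hMs : ∀ M ∈ Ms, M < 2 ^ (64 + S * (h + 1)) ∧ TopFree S (h + 1) M)
    (hi : Ms[i]? = some M) (ht : ∀ j ≤ h, t j < S) (hM : Holds S t (h + 1) M)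
    (hx : x < 2 ^ (64 + S * (h + 1))) (hxt : Holds S t (h + 1) x)
    (H : Level.rec (motive := fun _ => Bool) (fun W lo md rep T C H K top fuel =>
      node W lo md rep T C H K top fuel go x) (levelOf S h Ms) = true) :
    ∃ y, y < 2 ^ (64 + S * h) ∧ Holds S t h y ∧ go y = true := by
  obtain ⟨W, hW⟩ : ∃ W, W = 65 + S * (h + 1) := ⟨_, rfl⟩
  have hW1 : 64 + S * (h + 1) = W - 1 := by omega
  have hWW : 2 ^ (W - 1) < 2 ^ W := Nat.pow_lt_pow_right (by norm_num) (by omega)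
  obtain ⟨blk, hblk⟩ : ∃ b, b = 2 ^ 64 * ones S (h + 1) := ⟨_, rfl⟩
  obtain ⟨n, hn⟩ : ∃ n, n = Ms.length := ⟨_, rfl⟩
  have hin : i < n := by rw [hn]; exact (List.getElem?_eq_some_iff.mp hi).1
  have hmem : M ∈ Ms := List.mem_of_getElem? hi
  set lo := 2 ^ (64 + S * h) - 1 with hlo
  set Y := (x * ones W n) &&& pack W Ms with hY
  set Z := (Y + (2 ^ (S - 1) - 1) * blk * ones W n) &&& (2 ^ (S - 1) * blk * ones W n) with hZ
  set X := Z + (2 ^ (W - 1) - 2 ^ (S - 1) * blk) * ones W n with hX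
  have H' : node W lo (2 ^ (W - 1) - 1) (ones W n) (pack W Ms) ((2 ^ (S - 1) - 1) * blk * ones W n)
      (2 ^ (S - 1) * blk * ones W n) ((2 ^ (W - 1) - 2 ^ (S - 1) * blk) * ones W n)
      (2 ^ (W - 1) * ones W n) (n + 1) go x = true := by
    rw [hW, hblk, hn]; exact H
  have hS2 : 2 ^ S = 2 * 2 ^ (S - 1) := by rw [← pow_succ']; congr 1; omega
  have hSp : 2 ≤ 2 ^ (S - 1) := by
    calc 2 = 2 ^ 1 := rfl
      _ ≤ _ := Nat.pow_le_pow_right (by norm_num) (by omega)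
  have hc1 : 2 ^ (S - 1) - 1 < 2 ^ S := by omega
  have hc2 : 2 ^ (S - 1) < 2 ^ S := by omega
  have hC1 : (2 ^ (S - 1) - 1) * blk < 2 ^ (W - 1) := by rw [← hW1, hblk]; exact blk_lt hc1
  have hC2 : 2 ^ (S - 1) * blk < 2 ^ (W - 1) := by rw [← hW1, hblk]; exact blk_lt hc2
  have hpackM : ∀ a ∈ Ms, a < 2 ^ W := fun a ha => by
    have := (hMs a ha).1; rw [hW1] at this; omega
  rw [hW1] at hx
  -- the lane of `M` in the product
  have hYl : ∀ b < W, Y.testBit (W * i + b) = (x.testBit b && M.testBit b) := by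
    intro b hb
    have e1 := testBit_field W (W * i) (x * ones W n) b
    have e2 := testBit_field W (W * i) (pack W Ms) b
    rw [field_mul_ones (hx.trans hWW) hin] at e1
    rw [field_pack hpackM hi] at e2
    rw [hY, Nat.testBit_and]
    simp [hb] at e1 e2
    rw [e1, e2]
  have hblockW : ∀ j ≤ h, 64 + S * j + S ≤ W - 1 := by
    intro j hj
    have : S * (j + 1) ≤ S * (h + 1) := Nat.mul_le_mul_left _ (by omega)
    rw [Nat.mul_succ] at this
    omega
  -- no block of this lane is empty, so each of them carries into its top digit
  have hYC : ∀ j ≤ h, (Y + (2 ^ (S - 1) - 1) * blk * ones W n).testBit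
      (W * i + (64 + S * j + (S - 1))) = true := by
    intro j hj
    have hjW := hblockW j hj
    have fC : field S (W * i + (64 + S * j)) ((2 ^ (S - 1) - 1) * blk * ones W n) =
        2 ^ (S - 1) - 1 := by
      rw [← field_field (W := W) (W * i) _ (by omega), field_mul_ones (by omega) hin, hblk,
          field_blk hc1 (by omega)]
    have b1 : (field S (W * i + (64 + S * j)) Y).testBit (t j) = true := by
      have h1 := ht j hj
      rw [testBit_field, Nat.add_assoc, hYl _ (by omega), hxt j (by omega), hM j (by omega)]
      simp [h1]
    have b2 : (field S (W * i + (64 + S * j)) Y).testBit (S - 1) = false := by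
      rw [testBit_field, Nat.add_assoc, hYl _ (by omega), (hMs M hmem).2 j (by omega)]
      simp
    have b3 : field S (W * i + (64 + S * j)) Y < 2 ^ S := Nat.mod_lt _ (by positivity)
    have b4 : 1 ≤ field S (W * i + (64 + S * j)) Y := by
      rw [Nat.one_le_iff_ne_zero]; intro h0; rw [h0] at b1; simp at b1
    have b5 : field S (W * i + (64 + S * j)) Y < 2 ^ (S - 1) := by
      by_contra hge
      rw [Nat.testBit_of_two_pow_le_and_two_pow_add_one_gt (by omega)
          (by rw [Nat.sub_add_cancel (by omega)]; omega)] at b2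
      simp at b2
    rw [← Nat.add_assoc]
    apply testBit_add_of_field (by omega)
    · rw [fC]; omega
    · rw [fC]; omega
  have hZl : field W (W * i) Z = 2 ^ (S - 1) * blk := by
    apply Nat.eq_of_testBit_eq
    intro b
    rw [testBit_field]
    by_cases hb : b < W
    · have e2 := testBit_field W (W * i) (2 ^ (S - 1) * blk * ones W n) b
      rw [field_mul_ones (by omega) hin] at e2
      simp only [hb, decide_true, Bool.true_and] at e2 ⊢
      rw [hZ, Nat.testBit_and, ← e2]
      cases hbb : (2 ^ (S - 1) * blk).testBit b with
      | false => simp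
      | true =>
        rw [hblk] at hbb
        obtain ⟨j, hj, rfl⟩ := testBit_blk (by omega) hbb
        rw [hYC j (by omega)]; rfl
    · rw [Nat.testBit_lt_two_pow (lt_of_lt_of_le hC2
          (Nat.pow_le_pow_right (by norm_num) (by omega)))]
      simp [hb]
  have hXl : X.testBit (W * i + (W - 1)) = true := by
    have fK : field W (W * i) ((2 ^ (W - 1) - 2 ^ (S - 1) * blk) * ones W n) =
        2 ^ (W - 1) - 2 ^ (S - 1) * blk := field_mul_ones (by omega) hin
    have h4 : 2 ^ W = 2 * 2 ^ (W - 1) := by rw [← pow_succ']; congr 1; omega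
    have h5 : 2 ≤ 2 ^ (W - 1) := by
      calc 2 = 2 ^ 1 := rfl
        _ ≤ _ := Nat.pow_le_pow_right (by norm_num) (by omega)
    apply testBit_add_of_field (by omega) <;> rw [hZl, fK] <;> omega
  have hp : ((X &&& (2 ^ (W - 1) * ones W n)) % (2 ^ (W - 1) - 1)).testBit i = true := by
    rw [and_top_mod _ (by omega), testBit_gather _ hin, hXl]
  obtain ⟨p, hpdef⟩ : ∃ p, p = (X &&& (2 ^ (W - 1) * ones W n)) % (2 ^ (W - 1) - 1) := ⟨_, rfl⟩
  rw [← hpdef] at hp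
  have H2 : (Bool.rec (each (visit (lane W lo (pack W Ms)) go x) (n + 1) p) true (Nat.beq p 0) :
      Bool) = true := by
    rw [hpdef]; exact H'
  have hp0 : Nat.beq p 0 = false := by
    cases h0 : Nat.beq p 0 with
    | false => rfl
    | true => rw [Nat.eq_of_beq_eq_true h0] at hp; simp at hp
  rw [hp0] at H2
  have H3 : go (x &&& lane W lo (pack W Ms) (2 ^ i)) = true := each_sound H2 hp
  have hlane : ∀ b, (lane W lo (pack W Ms) (2 ^ i)).testBit b =
      (decide (b < 64 + S * h) && M.testBit b) := by
    intro b
    have e : lane W lo (pack W Ms) (2 ^ i) = (pack W Ms &&& (lo * 2 ^ (W * i))) / 2 ^ (W * i) := by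
      have : (2 ^ i) ^ W = 2 ^ (W * i) := by rw [← pow_mul, Nat.mul_comm]
      rw [← this]; rfl
    rw [e, Nat.testBit_div_two_pow, Nat.testBit_and, Nat.mul_comm lo, Nat.testBit_two_pow_mul, hlo,
      Nat.add_sub_cancel, Nat.testBit_two_pow_sub_one]
    by_cases hb : b < 64 + S * h
    · have hbW := hblockW h le_rfl
      have e2 := testBit_field W (W * i) (pack W Ms) b
      rw [field_pack hpackM hi] at e2
      simp only [show b < W by omega, decide_true, Bool.true_and] at e2
      simp [hb, e2, Nat.add_comm b]
    · simp [hb]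
  refine ⟨_, ?_, ?_, H3⟩
  · apply Nat.lt_pow_two_of_testBit
    intro b hb
    rw [Nat.testBit_and, hlane]
    simp [Nat.not_lt.mpr hb]
  · intro j hj
    have hj2 : 64 + S * j + t j < 64 + S * h := by
      have h1 := ht j (by omega)
      have : S * (j + 1) ≤ S * h := Nat.mul_le_mul_left _ (by omega)
      rw [Nat.mul_succ] at this
      omega
    rw [Nat.testBit_and, hlane, hxt j (by omega), hM j (by omega)]
    simp [hj2]

/-- The levels for the rows of height below the length of the list. -/
def Levels (S : ℕ) (t : ℕ → ℕ) : List Level → Prop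
  | [] => True
  | lv :: ls => t ls.length < S ∧ LevelOK S t ls.length lv ∧ Levels S t ls

theorem Levels.lt {S : ℕ} {t : ℕ → ℕ} {ls : List Level} (h : Levels S t ls) :
    ∀ j < ls.length, t j < S := by
  induction ls with
  | nil => simp
  | cons lv ls ih =>
    intro j hj
    rw [List.length_cons] at hj
    rcases Nat.lt_succ_iff_lt_or_eq.mp hj with h1 | rfl
    · exact ih h.2.2 j h1
    · exact h.1

theorem run_sound {S : ℕ} {t : ℕ → ℕ} {ls : List Level} {x : ℕ} (hS : 1 < S) (h : Levels S t ls)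
    (hx : x < 2 ^ (64 + S * ls.length)) (hxt : Holds S t ls.length x) : run ls x = false := by
  induction ls generalizing x with
  | nil => rfl
  | cons lv ls ih =>
    by_contra hne
    have hrun : run (lv :: ls) x = true := by simpa using hne
    obtain ⟨Ms, i, M, rfl, hlen, hMs, hi, hM⟩ := h.2.1.out
    have := h.lt
    obtain ⟨y, hy, hyt, hgo⟩ := node_sound (go := run ls) hS hlen hMs hi
      (fun j hj => this j (Nat.lt_succ_of_le hj)) hM hx hxt hrun
    rw [ih h.2.2 hy hyt] at hgo
    exact absurd hgo (by simp)

end SymSearch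

/-! ### Soundness of the tables -/

namespace SymSearch

/-- The row `f (n - 1), …, f 0`. -/
def seg (f : ℕ → SignType) : ℕ → Row
  | 0 => []
  | n + 1 => f n :: seg f n

/-- The list of candidate lists `cs` has, for each row of height `j`, the entries of row `j` of `A`
in the columns of height below `m` as its candidate with index `t j`. -/
def Fits (A : ℕ → ℕ → SignType) (t : ℕ → ℕ) (m : ℕ) : List (List Row) → Prop
  | [] => True
  | L :: Ls => L[t Ls.length]? = some (seg (A Ls.length) m) ∧ Fits A t m Ls

theorem forceS_eq (v : SignType) (k : SignType → Bool) : forceS v k = k v := by cases v <;> rfl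

theorem forceR_eq (l : Row) (k : Row → Bool) : forceR l k = k l := by
  induction l generalizing k with
  | nil => rfl
  | cons v l ih => exact (forceS_eq v fun v => forceR l fun l => k (v :: l)).trans (ih _)

theorem forceRs_eq (l : List Row) (k : List Row → Bool) : forceRs l k = k l := by
  induction l generalizing k with
  | nil => rfl
  | cons v l ih => exact (forceR_eq v fun v => forceRs l fun l => k (v :: l)).trans (ih _)

theorem forceRss_eq (l : List (List Row)) (k : List (List Row) → Bool) : forceRss l k = k l := by
  induction l generalizing k with
  | nil => rfl
  | cons v l ih => exact (forceRs_eq v fun v => forceRss l fun l => k (v :: l)).trans (ih _)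

theorem length_tails (ls : List (List Row)) : (tails ls).length = ls.length := by simp [tails]

theorem Fits.tails {A : ℕ → ℕ → SignType} {t : ℕ → ℕ} {m : ℕ} {cs : List (List Row)}
    (h : Fits A t (m + 1) cs) : Fits A t m (tails cs) := by
  induction cs with
  | nil => trivial
  | cons c cs ih =>
    refine ⟨?_, ih h.2⟩
    change (c.map List.tail)[t (SymSearch.tails cs).length]? =
      some (seg (A (SymSearch.tails cs).length) m)
    rw [length_tails, List.getElem?_map, h.1]
    rfl

theorem Fits.tail {A : ℕ → ℕ → SignType} {t : ℕ → ℕ} {m : ℕ} {cs : List (List Row)}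
    (h : Fits A t m cs) : Fits A t m cs.tail := by
  cases cs with
  | nil => trivial
  | cons c cs => exact h.2

theorem masks_spec (S : ℕ) (L : List Row) : ∃ T, (∀ k, masks S L k = k T) ∧
    (∀ v, pick v T < 2 ^ (S - 1)) ∧
    ∀ i v r, L[i]? = some (v :: r) → i < S - 1 → (pick v T).testBit i = true := by
  induction L with
  | nil => exact ⟨.mk 0 0 0, fun _ => rfl, fun v => by cases v <;> simp [pick], by simp⟩
  | cons r L ih =>
    obtain ⟨⟨z, n, p⟩, h1, h2, h3⟩ := ih
    have hz : ∀ i r, L[i]? = some (.zero :: r) → i < S - 1 → z.testBit i = true :=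
      fun i r => h3 i .zero r
    have hn : ∀ i r, L[i]? = some (.neg :: r) → i < S - 1 → n.testBit i = true :=
      fun i r => h3 i .neg r
    have hp : ∀ i r, L[i]? = some (.pos :: r) → i < S - 1 → p.testBit i = true :=
      fun i r => h3 i .pos r
    have hb : ∀ a, a % 2 ^ (S - 1) < 2 ^ (S - 1) := fun a => Nat.mod_lt _ (by positivity)
    have hs : ∀ (a b i : ℕ), b ≤ 1 → i + 1 < S - 1 → a.testBit i = true →
        ((2 * a + b) % 2 ^ (S - 1)).testBit (i + 1) = true := by
      intro a b i hb hi ha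
      rw [Nat.testBit_mod_two_pow, Nat.testBit_succ, show (2 * a + b) / 2 = a by omega, ha]
      simp [hi]
    have h0 : ∀ a : ℕ, 0 < S - 1 → ((2 * a + 1) % 2 ^ (S - 1)).testBit 0 = true := by
      intro a ha
      rw [Nat.testBit_mod_two_pow]
      simp [ha]
    have e : ∀ k, masks S (r :: L) k = SignType.rec
      (forceM S (Nat.add (Nat.mul 2 z) 1) (Nat.mul 2 n) (Nat.mul 2 p) k)
      (forceM S (Nat.mul 2 z) (Nat.add (Nat.mul 2 n) 1) (Nat.mul 2 p) k)
      (forceM S (Nat.mul 2 z) (Nat.mul 2 n) (Nat.add (Nat.mul 2 p) 1) k) (r.headD .zero) :=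
        fun k => h1 _
    cases hv : r.headD .zero with
    | zero =>
      refine ⟨.mk ((2 * z + 1) % 2 ^ (S - 1)) ((2 * n) % 2 ^ (S - 1)) ((2 * p) % 2 ^ (S - 1)),
        ?_, ?_, ?_⟩
      · intro k; rw [e k, hv]; rfl
      · intro v; cases v <;> exact hb _
      · intro i v r' hi his
        cases i with
        | zero =>
          simp at hi; subst hi; simp at hv; subst hv
          exact h0 _ his
        | succ i =>
          have hi' : L[i]? = some (v :: r') := by simpa using hi
          cases v
          · exact hs _ 1 _ le_rfl his (hz _ _ hi' (by omega))
          · exact hs _ 0 _ (by omega) his (hn _ _ hi' (by omega))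
          · exact hs _ 0 _ (by omega) his (hp _ _ hi' (by omega))
    | neg =>
      refine ⟨.mk ((2 * z) % 2 ^ (S - 1)) ((2 * n + 1) % 2 ^ (S - 1)) ((2 * p) % 2 ^ (S - 1)),
        ?_, ?_, ?_⟩
      · intro k; rw [e k, hv]; rfl
      · intro v; cases v <;> exact hb _
      · intro i v r' hi his
        cases i with
        | zero =>
          simp at hi; subst hi; simp at hv; subst hv
          exact h0 _ his
        | succ i =>
          have hi' : L[i]? = some (v :: r') := by simpa using hi
          cases v
          · exact hs _ 0 _ (by omega) his (hz _ _ hi' (by omega))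
          · exact hs _ 1 _ le_rfl his (hn _ _ hi' (by omega))
          · exact hs _ 0 _ (by omega) his (hp _ _ hi' (by omega))
    | pos =>
      refine ⟨.mk ((2 * z) % 2 ^ (S - 1)) ((2 * n) % 2 ^ (S - 1)) ((2 * p + 1) % 2 ^ (S - 1)),
        ?_, ?_, ?_⟩
      · intro k; rw [e k, hv]; rfl
      · intro v; cases v <;> exact hb _
      · intro i v r' hi his
        cases i with
        | zero =>
          simp at hi; subst hi; simp at hv; subst hv
          exact h0 _ his
        | succ i =>
          have hi' : L[i]? = some (v :: r') := by simpa using hi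
          cases v
          · exact hs _ 0 _ (by omega) his (hz _ _ hi' (by omega))
          · exact hs _ 0 _ (by omega) his (hn _ _ hi' (by omega))
          · exact hs _ 1 _ le_rfl his (hp _ _ hi' (by omega))

/-- The masks `Ts` for one column with entries `f`: the candidate `t j` of the row of height `j` is
alive if the entry in that column is prescribed to be `f j`. -/
def MasksFit (S : ℕ) (t : ℕ → ℕ) (f : ℕ → SignType) : List Masks → Prop
  | [] => True
  | T :: Ts => (∀ v, pick v T < 2 ^ (S - 1)) ∧ (pick (f Ts.length) T).testBit (t Ts.length) = true ∧
      MasksFit S t f Ts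

theorem masksL_spec {S : ℕ} {A : ℕ → ℕ → SignType} {t : ℕ → ℕ} {m : ℕ} {ds : List (List Row)}
    (h : Fits A t (m + 1) ds) (ht : ∀ j < ds.length, t j < S - 1) :
    ∃ Ts, (∀ k, masksL S ds k = k Ts) ∧ Ts.length = ds.length ∧
      MasksFit S t (fun j => A j m) Ts := by
  induction ds with
  | nil => exact ⟨[], fun _ => rfl, rfl, trivial⟩
  | cons d ds ih =>
    obtain ⟨Ts, h1, h2, h3⟩ := ih h.2 fun j hj => ht j (by simp; omega)
    obtain ⟨T, g1, g2, g3⟩ := masks_spec S d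
    refine ⟨T :: Ts, fun k => (g1 _).trans (h1 _), by simp [h2], g2, ?_, h3⟩
    rw [h2]
    exact g3 _ _ _ h.1 (ht _ (by simp))

theorem maskOf_cons (S : ℕ) (T : Masks) (Ts : List Masks) (r : Row) (a : ℕ) :
    maskOf S (T :: Ts) r a = maskOf S Ts r.tail (a * 2 ^ S + pick (r.headD .zero) T) := rfl

theorem pick_lt_two_pow {S b : ℕ} (hS : 0 < S) (h : b < 2 ^ (S - 1)) : b < 2 ^ S :=
  h.trans (Nat.pow_lt_pow_right (by norm_num) (by omega))

theorem maskOf_div {S : ℕ} {t : ℕ → ℕ} {f : ℕ → SignType} {Ts : List Masks} (hS : 0 < S)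
    (h : MasksFit S t f Ts) (r : Row) (a : ℕ) : maskOf S Ts r a / 2 ^ (S * Ts.length) = a := by
  induction Ts generalizing r a with
  | nil => simp [maskOf]
  | cons T Ts ih =>
    have h1 := pick_lt_two_pow hS (h.1 (r.headD .zero))
    rw [maskOf_cons, List.length_cons, Nat.mul_succ, pow_add, ← Nat.div_div_eq_div_mul, ih h.2.2,
      Nat.add_comm, Nat.add_mul_div_right _ _ (by positivity), Nat.div_eq_of_lt h1, Nat.zero_add]

theorem testBit_maskOf {S : ℕ} {t : ℕ → ℕ} {f : ℕ → SignType} {Ts : List Masks} (hS : 0 < S)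
    (h : MasksFit S t f Ts) (r : Row) (a b : ℕ) :
    (maskOf S Ts r a).testBit (S * Ts.length + b) = a.testBit b := by
  conv_rhs => rw [← maskOf_div hS h r a, Nat.testBit_div_two_pow, Nat.add_comm]

theorem testBit_mul_add {S a p b : ℕ} (hp : p < 2 ^ S) (hb : b < S) :
    (a * 2 ^ S + p).testBit b = p.testBit b := by
  rw [Nat.mul_comm, Nat.testBit_two_pow_mul_add _ hp, if_pos hb]

theorem maskOf_topFree {S : ℕ} {t : ℕ → ℕ} {f : ℕ → SignType} {Ts : List Masks} (hS : 0 < S)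
    (h : MasksFit S t f Ts) (r : Row) (a : ℕ) :
    ∀ j < Ts.length, (maskOf S Ts r a).testBit (S * j + (S - 1)) = false := by
  induction Ts generalizing r a with
  | nil => simp
  | cons T Ts ih =>
    intro j hj
    rw [List.length_cons] at hj
    rw [maskOf_cons]
    rcases Nat.lt_succ_iff_lt_or_eq.mp hj with h1 | rfl
    · exact ih h.2.2 _ _ j h1
    · have h1 := h.1 (r.headD .zero)
      rw [testBit_maskOf hS h.2.2, testBit_mul_add (pick_lt_two_pow hS h1) (by omega),
        Nat.testBit_lt_two_pow h1]

theorem maskOf_holds {S : ℕ} {t : ℕ → ℕ} {f : ℕ → SignType} {Ts : List Masks} (hS : 0 < S)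
    (h : MasksFit S t f Ts) (ht : ∀ j < Ts.length, t j < S) (a : ℕ) :
    ∀ j < Ts.length, (maskOf S Ts (seg f Ts.length) a).testBit (S * j + t j) = true := by
  induction Ts generalizing a with
  | nil => simp
  | cons T Ts ih =>
    intro j hj
    rw [List.length_cons] at hj
    rw [maskOf_cons]
    rcases Nat.lt_succ_iff_lt_or_eq.mp hj with h1 | rfl
    · exact ih h.2.2 (fun j hj => ht j (by simp; omega)) _ j h1
    · have h1 := h.1 (f Ts.length)
      rw [testBit_maskOf hS h.2.2]
      change (a * 2 ^ S + pick (f Ts.length) T).testBit _ = true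
      rw [testBit_mul_add (pick_lt_two_pow hS h1) (ht _ (by simp))]
      exact h.2.1

theorem salt_eq (M : ℕ) : ∃ s < 2 ^ 64, salt M = 2 ^ 64 * M + s := by
  have h : ∀ a : ℕ, a % 18446744073709551616 < 2 ^ 64 := fun a => Nat.mod_lt _ (by norm_num)
  refine ⟨Nat.mod (Nat.lor (Nat.lor (Nat.mod M 18446744073709551557)
      (Nat.mod M 18446744073709551533))
    (Nat.mod M 18446744073709551521)) 18446744073709551616, h _, ?_⟩
  rw [show 2 ^ 64 * M = M * 18446744073709551616 by rw [Nat.mul_comm]; norm_num]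
  rfl

theorem testBit_salt (M i : ℕ) : (salt M).testBit (64 + i) = M.testBit i := by
  obtain ⟨s, hs, e⟩ := salt_eq M
  rw [e, Nat.testBit_two_pow_mul_add _ hs, if_neg (by omega), Nat.add_sub_cancel_left]

theorem salt_lt {M n : ℕ} (h : M < 2 ^ n) : salt M < 2 ^ (64 + n) := by
  obtain ⟨s, hs, e⟩ := salt_eq M
  rw [e, pow_add]
  have : 2 ^ 64 * (M + 1) ≤ 2 ^ 64 * 2 ^ n := Nat.mul_le_mul_left _ h
  omega

theorem table_eq (W : ℕ) (f : Op → ℕ) (L : List Op) (k : ℕ → ℕ → Bool) :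
    table W f L k = k (L.map f).length (pack W (L.map f)) := by
  induction L generalizing k with
  | nil => rfl
  | cons o L ih => exact ih _

theorem opMask_mk (S : ℕ) (T : List Masks) (i : ℕ) (r : Row) :
    opMask S T (.mk i r) = salt (maskOf S T r (2 ^ i % 2 ^ (S - 1))) := rfl

theorem level_eq (S h : ℕ) (T : List Masks) (L : List Op) (k : Level → Bool) :
    level S h T L k = guard (Nat.ble ((L.map (opMask S T)).length + 2) (65 + S * (h + 1)))
      (k (levelOf S h (L.map (opMask S T)))) :=
  table_eq _ _ _ _

theorem level_sound {S h : ℕ} {t : ℕ → ℕ} {f : ℕ → SignType} {T : List Masks} {L : List Op}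
    {k : Level → Bool} (hS : 0 < S) (hT : MasksFit S t f T) (hl : T.length = h)
    (ht : ∀ j ≤ h, t j < S - 1) (H : level S h T L k = true) :
    ∃ lv, k lv = true ∧ (Op.mk (t h) (seg f h) ∈ L → LevelOK S t h lv) := by
  rw [level_eq, guard_eq_true] at H
  refine ⟨_, H.2, fun hm => ?_⟩
  have hm2 := List.mem_map_of_mem (f := opMask S T) hm
  obtain ⟨i, hi⟩ := List.mem_iff_getElem?.mp hm2
  refine ⟨_, i, _, rfl, Nat.le_of_ble_eq_true H.1, ?_, hi, ?_⟩
  · intro M hM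
    obtain ⟨⟨j, r⟩, -, rfl⟩ := List.mem_map.mp hM
    have ha : 2 ^ j % 2 ^ (S - 1) < 2 ^ (S - 1) := Nat.mod_lt _ (by positivity)
    constructor
    · rw [opMask_mk]
      apply salt_lt
      have h1 := maskOf_div hS hT r (2 ^ j % 2 ^ (S - 1))
      rw [hl] at h1
      rw [Nat.mul_succ, pow_add, Nat.mul_comm, ← Nat.div_lt_iff_lt_mul (by positivity)]
      rw [h1]
      exact pick_lt_two_pow hS ha
    · intro q hq
      rw [Nat.add_assoc, opMask_mk, testBit_salt]
      rcases Nat.lt_succ_iff_lt_or_eq.mp hq with h1 | rfl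
      · exact maskOf_topFree hS hT _ _ q (by omega)
      · rw [← hl, testBit_maskOf hS hT, Nat.testBit_lt_two_pow ha]
  · intro q hq
    rw [Nat.add_assoc, opMask_mk, testBit_salt]
    rcases Nat.lt_succ_iff_lt_or_eq.mp hq with h1 | rfl
    · have := maskOf_holds hS hT (fun j hj => by have := ht j (by omega); omega)
          (2 ^ t h % 2 ^ (S - 1)) q (by omega)
      rwa [hl] at this
    · have h2 := testBit_maskOf hS hT (seg f q) (2 ^ t q % 2 ^ (S - 1)) (t q)
      rw [hl] at h2
      rw [h2, Nat.testBit_mod_two_pow, Nat.testBit_two_pow_self]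
      simpa using ht q le_rfl

theorem mem_index {L : List Row} {i : ℕ} {r : Row} (h : L[i]? = some r) (i₀ : ℕ) :
    Op.mk (i₀ + i) r ∈ index L i₀ := by
  induction L generalizing i i₀ with
  | nil => simp at h
  | cons a L ih =>
    change _ ∈ Op.mk i₀ a :: index L (i₀ + 1)
    cases i with
    | zero => simp at h; subst h; simp
    | succ i =>
      have := ih (by simpa using h) (i₀ + 1)
      rw [show i₀ + (i + 1) = i₀ + 1 + i by omega]
      exact List.mem_cons_of_mem _ this

/-- The member of a triple, indexed like `Tree`, that belongs to the sign `v`. -/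
def choose3 {α : Type} (v : SignType) (a b c : α) : α :=
  match v with
  | .zero => a
  | .neg => b
  | .pos => c

theorem split_spec (L : List Op) : ∃ a b c, (∀ k, split L k = k a b c) ∧
    ∀ i v r, Op.mk i (v :: r) ∈ L → Op.mk i r ∈ choose3 v a b c := by
  induction L with
  | nil => exact ⟨[], [], [], fun _ => rfl, by simp⟩
  | cons o L ih =>
    obtain ⟨a, b, c, h1, h2⟩ := ih
    obtain ⟨i, r⟩ := o
    have e : ∀ k, split (Op.mk i r :: L) k = SignType.rec (k (.mk i r.tail :: a) b c)
      (k a (.mk i r.tail :: b) c) (k a b (.mk i r.tail :: c)) (r.headD .zero) := fun k => h1 _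
    cases hv : r.headD .zero with
    | zero =>
      refine ⟨.mk i r.tail :: a, b, c, fun k => by rw [e, hv], fun j v s hm => ?_⟩
      rcases List.mem_cons.mp hm with h | h
      · obtain ⟨rfl, rfl⟩ := Op.mk.inj h
        simp at hv; subst hv; simp [choose3]
      · have := h2 j v s h
        cases v <;> simp [choose3] at this ⊢ <;> simp [this]
    | neg =>
      refine ⟨a, .mk i r.tail :: b, c, fun k => by rw [e, hv], fun j v s hm => ?_⟩
      rcases List.mem_cons.mp hm with h | h
      · obtain ⟨rfl, rfl⟩ := Op.mk.inj h
        simp at hv; subst hv; simp [choose3]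
      · have := h2 j v s h
        cases v <;> simp [choose3] at this ⊢ <;> simp [this]
    | pos =>
      refine ⟨a, b, .mk i r.tail :: c, fun k => by rw [e, hv], fun j v s hm => ?_⟩
      rcases List.mem_cons.mp hm with h | h
      · obtain ⟨rfl, rfl⟩ := Op.mk.inj h
        simp at hv; subst hv; simp [choose3]
      · have := h2 j v s h
        cases v <;> simp [choose3] at this ⊢ <;> simp [this]

theorem dropR_seg (f : ℕ → SignType) (k n : ℕ) : dropR k (seg f (n + k)) = seg f n := by
  induction k with
  | zero => rfl
  | succ k ih => exact ih

theorem mem_dropOp {f : ℕ → SignType} {i k n : ℕ} {L : List Op} (h : Op.mk i (seg f (n + k)) ∈ L) :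
    Op.mk i (seg f n) ∈ dropOp k L := by
  refine List.mem_map.mpr ⟨_, h, ?_⟩
  change Op.mk i (dropR k (seg f (n + k))) = _
  rw [dropR_seg]

theorem tree_sound {S h k : ℕ} {t : ℕ → ℕ} {f : ℕ → SignType} {T : List Masks} {L : List Row}
    {u v : SignType} {K : Tree → Bool} (hS : 0 < S) (hT : MasksFit S t f T) (hl : T.length = h)
    (ht : ∀ j ≤ h, t j < S - 1) (hc : L[t h]? = some (u :: v :: seg f (h + k)))
    (H : tree S h k T L K = true) :
    ∃ tr, K tr = true ∧ LevelOK S t h (getLv u v tr) := by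
  have h0 := mem_index hc 0
  rw [Nat.zero_add] at h0
  obtain ⟨A, B, C, e, h1⟩ := split_spec (index L 0)
  obtain ⟨a, b, c, ea, h2⟩ := split_spec A
  obtain ⟨d, e', f', eb, h3⟩ := split_spec B
  obtain ⟨g, h', i, ec, h4⟩ := split_spec C
  unfold tree at H
  rw [e, ea, eb, ec] at H
  obtain ⟨l1, H, k1⟩ := level_sound hS hT hl ht H
  obtain ⟨l2, H, k2⟩ := level_sound hS hT hl ht H
  obtain ⟨l3, H, k3⟩ := level_sound hS hT hl ht H
  obtain ⟨l4, H, k4⟩ := level_sound hS hT hl ht H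
  obtain ⟨l5, H, k5⟩ := level_sound hS hT hl ht H
  obtain ⟨l6, H, k6⟩ := level_sound hS hT hl ht H
  obtain ⟨l7, H, k7⟩ := level_sound hS hT hl ht H
  obtain ⟨l8, H, k8⟩ := level_sound hS hT hl ht H
  obtain ⟨l9, H, k9⟩ := level_sound hS hT hl ht H
  refine ⟨_, H, ?_⟩
  have h5 := h1 _ _ _ h0
  cases u
  · have h6 := h2 _ _ _ h5
    cases v
    · exact k1 (mem_dropOp h6)
    · exact k2 (mem_dropOp h6)
    · exact k3 (mem_dropOp h6)
  · have h6 := h3 _ _ _ h5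
    cases v
    · exact k4 (mem_dropOp h6)
    · exact k5 (mem_dropOp h6)
    · exact k6 (mem_dropOp h6)
  · have h6 := h4 _ _ _ h5
    cases v
    · exact k7 (mem_dropOp h6)
    · exact k8 (mem_dropOp h6)
    · exact k9 (mem_dropOp h6)

/-- For each height `j` the tree has a level table that serves the entries of row `j` of `A` in the
columns `p` and `q`. -/
def Trees (S : ℕ) (A : ℕ → ℕ → SignType) (t : ℕ → ℕ) (p q : ℕ) : List Tree → Prop
  | [] => True
  | tr :: ts => LevelOK S t ts.length (getLv (A ts.length p) (A ts.length q) tr) ∧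
    Trees S A t p q ts

theorem trees_sound {S k N : ℕ} {A : ℕ → ℕ → SignType} {t : ℕ → ℕ} {os ds : List (List Row)}
    {K : List Tree → Bool} (hS : 0 < S) (hA : ∀ i j, A i j = A j i) (hos : Fits A t (N + 2) os)
    (hds : Fits A t os.length ds) (hld : ds.length = os.length) (hN : os.length + k = N + 1)
    (ht : ∀ j < os.length, t j < S - 1) (H : trees S os k ds K = true) :
    ∃ ts, K ts = true ∧ ts.length = os.length ∧ Trees S A t (N + 1) N ts := by
  induction os generalizing k ds K with
  | nil => exact ⟨[], H, rfl, trivial⟩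
  | cons o os ih =>
    change masksL S ds.tail (fun T => tree S os.length k T o fun tr =>
      forceRss (tails ds.tail) fun ds => trees S os (k + 1) ds fun l => K (tr :: l)) = true at H
    rw [List.length_cons] at hld hN hds
    have hlt : ds.tail.length = os.length := by simp [hld]
    obtain ⟨T, h1, h2, h3⟩ := masksL_spec (S := S) hds.tail fun j hj => ht j (by simp; omega)
    rw [h1] at H
    have h4 : MasksFit S t (A os.length) T := by
      rwa [show A os.length = fun j => A j os.length from funext fun j => hA _ _]
    have ho : o[t os.length]? =
        some (A os.length (N + 1) :: A os.length N :: seg (A os.length) (os.length + k)) := by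
      rw [hos.1, show os.length + k = N by omega]
      rfl
    obtain ⟨tr, H, htr⟩ := tree_sound hS h4 (h2.trans hlt) (fun j hj => ht j (by simp; omega)) ho H
    rw [forceRss_eq] at H
    obtain ⟨ts, H, hl, hts⟩ := ih hos.2 hds.tail.tails (by rw [length_tails, hlt]) (by omega)
      (fun j hj => ht j (by simp; omega)) H
    exact ⟨_, H, by simp [hl], by rw [Trees, hl]; exact ⟨htr, hts⟩⟩
end SymSearch

/-! ### Soundness of the search -/

namespace SymSearch

theorem forceLv_eq (l : Level) (k : Level → Bool) : forceLv l k = k l := by cases l; rfl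

theorem select_spec {S p q : ℕ} {A : ℕ → ℕ → SignType} {t : ℕ → ℕ} {ts : List Tree}
    (hA : ∀ i j, A i j = A j i) (ht : ∀ j < ts.length, t j < S) (h : Trees S A t p q ts) :
    ∃ ls, ls.length = ts.length ∧ Levels S t ls ∧
      ∀ k, select ts (seg (A p) ts.length) (seg (A q) ts.length) k = k ls := by
  induction ts with
  | nil => exact ⟨[], rfl, trivial, fun _ => rfl⟩
  | cons tr ts ih =>
    obtain ⟨ls, h1, h2, h3⟩ := ih (fun j hj => ht j (by simp; omega)) h.2
    refine ⟨getLv (A ts.length p) (A ts.length q) tr :: ls, by simp [h1], ⟨?_, ?_, h2⟩, fun k => ?_⟩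
    · rw [h1]; exact ht _ (by simp)
    · rw [h1]; exact h.1
    · refine (h3 _).trans ?_
      rw [forceLv_eq, hA _ p, hA _ q]
      rfl

theorem starts_spec (S : ℕ) (T : List Masks) (d : Row → SignType) (c : List Row) :
    ∃ l, (∀ k, starts S T d c k = k l) ∧
      ∀ r ∈ c, Start.mk (d r) r.tail.tail (salt (maskOf S T r.tail.tail 0)) ∈ l := by
  induction c with
  | nil => exact ⟨[], fun _ => rfl, by simp⟩
  | cons r c ih =>
    obtain ⟨l, h1, h2⟩ := ih
    refine ⟨Start.mk (d r) r.tail.tail (salt (maskOf S T r.tail.tail 0)) :: l, fun k => ?_,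
        fun s hs => ?_⟩
    · change force (salt (maskOf S T r.tail.tail 0)) (fun M => forceR r.tail.tail fun s =>
        forceS (d r) fun u => starts S T d c fun l => k (.mk u s M :: l)) = _
      rw [force_eq, forceR_eq, forceS_eq, h1]
    · rcases List.mem_cons.mp hs with rfl | hs
      · exact List.mem_cons_self
      · exact List.mem_cons_of_mem _ (h2 s hs)

theorem eqS_self (u : SignType) : eqS u u = true := by cases u <;> rfl

theorem pairs_sound {ts : List Tree} {a b : List Start} {u : SignType} {r s : Row} {M N : ℕ}
    (ha : Start.mk u r M ∈ a) (hb : Start.mk u s N ∈ b) (H : pairs ts a b = true) :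
    select ts r s (fun lv => run lv (M &&& N)) = true := by
  induction a with
  | nil => simp at ha
  | cons p a ih =>
    obtain ⟨u', r', M'⟩ := p
    have H' := guard_eq_true.mp H
    rcases List.mem_cons.mp ha with h | h
    · obtain ⟨rfl, rfl, rfl⟩ := Start.mk.inj h
      have H2 := H'.1
      clear H H' ih ha h
      induction b with
      | nil => simp at hb
      | cons q b ih =>
        obtain ⟨v, s', N'⟩ := q
        have H3 := guard_eq_true.mp H2
        rcases List.mem_cons.mp hb with h | h
        · obtain ⟨rfl, rfl, rfl⟩ := Start.mk.inj h
          have H4 := H3.1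
          rw [eqS_self] at H4
          simp only [force_eq] at H4
          exact H4
        · exact ih h H3.2
    · exact ih h H'.2

theorem small_sound {S m : ℕ} {A : ℕ → ℕ → SignType} {t : ℕ → ℕ} {cs : List (List Row)}
    (h : Fits A t m cs) (H : small S cs = true) : ∀ j < cs.length, t j < S - 1 := by
  induction cs with
  | nil => simp
  | cons c cs ih =>
    intro j hj
    have H' := guard_eq_true.mp H
    rw [List.length_cons] at hj
    rcases Nat.lt_succ_iff_lt_or_eq.mp hj with h1 | rfl
    · exact ih h.2 H'.2 j h1
    · have h2 := (List.getElem?_eq_some_iff.mp h.1).1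
      have h3 := Nat.le_of_ble_eq_true H'.1
      omega

theorem search_sound {S : ℕ} {A : ℕ → ℕ → SignType} {t : ℕ → ℕ} {f : List Row → List Row}
    {c0 c1 : List Row} {cs : List (List Row)} (hS : 1 < S) (hA : ∀ i j, A i j = A j i)
    (h0 : seg (A (cs.length + 1)) (cs.length + 2) ∈ f c0)
    (h1 : seg (A cs.length) (cs.length + 2) ∈ c1)
    (hcs : Fits A t (cs.length + 2) cs) : search S f c0 c1 cs = false := by
  by_contra hne
  have H : search S f c0 c1 cs = true := by simpa using hne
  obtain ⟨H0, H⟩ := guard_eq_true.mp H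
  have ht := small_sound hcs H0
  rw [forceRss_eq, forceRss_eq] at H
  obtain ⟨ts, H, hl, hts⟩ := trees_sound (by omega) hA hcs hcs.tails.tails
    (by rw [length_tails, length_tails]) rfl ht H
  obtain ⟨T0, e0, l0, m0⟩ := masksL_spec hcs ht
  obtain ⟨T1, e1, l1, m1⟩ := masksL_spec hcs.tails (by rwa [length_tails])
  rw [length_tails] at l1
  rw [e0, e1] at H
  obtain ⟨a, ea, ha⟩ := starts_spec S T0 (fun r => r.tail.headD .zero) (f c0)
  obtain ⟨b, eb, hb⟩ := starts_spec S T1 (fun r => r.headD .zero) c1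
  rw [ea, eb] at H
  have ha := ha _ h0
  have hb := hb _ h1
  have hu : (seg (A cs.length) (cs.length + 2)).headD .zero =
      (seg (A (cs.length + 1)) (cs.length + 2)).tail.headD .zero := hA _ _
  rw [hu] at hb
  have H := pairs_sound ha hb H
  have htS : ∀ j < cs.length, t j < S := fun j hj => by have := ht j hj; omega
  obtain ⟨ls, hls, hlv, esel⟩ := select_spec hA (fun j hj => htS j (by omega)) hts
  rw [hl] at esel hls
  have H := (esel _).symm.trans H
  have hrow : ∀ {T : List Masks} {i : ℕ}, T.length = cs.length → MasksFit S t (fun j => A j i) T →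
      salt (maskOf S T (seg (A i) cs.length) 0) < 2 ^ (64 + S * cs.length) ∧
        Holds S t cs.length (salt (maskOf S T (seg (A i) cs.length) 0)) := by
    intro T i hT hm
    have hm' : MasksFit S t (A i) T := by
      rwa [show A i = fun j => A j i from funext fun j => hA _ _]
    constructor
    · apply salt_lt
      have := maskOf_div (by omega) hm' (seg (A i) cs.length) 0
      rw [hT] at this
      exact (Nat.div_eq_zero_iff_lt (by positivity)).mp this
    · intro j hj
      rw [Nat.add_assoc, testBit_salt]
      have := maskOf_holds (by omega) hm' (fun j hj => htS j (by omega)) 0 j (by omega)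
      rwa [hT] at this
  obtain ⟨b0, b1⟩ := hrow l0 m0
  obtain ⟨b2, b3⟩ := hrow l1 m1
  rw [run_sound hS hlv] at H
  · exact absurd H (by simp)
  · rw [hls]; exact Nat.and_le_left.trans_lt b0
  · rw [hls]
    intro j hj
    rw [Nat.testBit_and]
    exact (Bool.and_eq_true _ _).mpr ⟨b1 j hj, b3 j hj⟩

/-- The number of nonzero entries of `f` below `n`. -/
def count (f : ℕ → SignType) (n : ℕ) : ℕ := ∑ h ∈ Finset.range n, if f h = 0 then 0 else 1

/-- The entry `v`, increased by one. -/
def raise (v : SignType) : ℕ := match v with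
  | .zero => 1
  | .neg => 0
  | .pos => 2

theorem seg_mem_rows (w : ℕ → ℕ) (f : ℕ → SignType) (n : ℕ) :
    seg f n ∈ rows w n (count f n) (∑ h ∈ Finset.range n, raise (f h) * w h) := by
  induction n with
  | zero => exact List.mem_singleton.mpr rfl
  | succ n ih =>
    have e : ∀ d t, rows w (n + 1) d t =
      (Bool.rec [] (List.map (.zero :: ·) (rows w n d (Nat.sub t (w n)))) (Nat.ble (w n) t)) ++
      Nat.rec [] (fun d _ => List.map (.neg :: ·) (rows w n d t) ++
      Bool.rec [] (List.map (.pos :: ·) (rows w n d (Nat.sub t (Nat.mul 2 (w n)))))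
        (Nat.ble (Nat.mul 2 (w n)) t)) d := fun _ _ => rfl
    rw [e, count, Finset.sum_range_succ, Finset.sum_range_succ]
    rw [count] at ih
    generalize (∑ h ∈ Finset.range n, raise (f h) * w h) = s at *
    generalize (∑ h ∈ Finset.range n, if f h = 0 then 0 else 1) = d at *
    rw [List.mem_append, seg]
    cases hv : f n with
    | zero =>
      left
      have h1 : Nat.ble (w n) (s + raise .zero * w n) = true :=
          Nat.ble_eq_true_of_le (by simp [raise])
      have h2 : Nat.sub (s + raise .zero * w n) (w n) = s := by
        change s + 1 * w n - w n = s
        omega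
      rw [h1, h2]
      exact List.mem_map_of_mem ih
    | neg =>
      right
      have h2 : s + raise .neg * w n = s := by simp [raise]
      rw [h2]
      exact List.mem_append_left _ (List.mem_map_of_mem ih)
    | pos =>
      right
      have h1 : Nat.ble (Nat.mul 2 (w n)) (s + raise .pos * w n) = true :=
        Nat.ble_eq_true_of_le (Nat.le_add_left _ _)
      have h2 : Nat.sub (s + raise .pos * w n) (Nat.mul 2 (w n)) = s := Nat.add_sub_cancel _ _
      refine List.mem_append_right _ ?_
      change _ ∈ (Bool.rec [] (List.map (.pos :: ·) (rows w n d (Nat.sub _ (Nat.mul 2 (w n))))) _ :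
        List Row)
      rw [h1, h2]
      exact List.mem_map_of_mem ih

theorem lists_succ (R Z : List Row) (N h : ℕ) : lists R Z N (h + 1) =
    List.filter (fun r => notPos ((dropR (N - 1 - h) r).headD .zero)) (if h = 0 then Z else R) ::
      lists R Z N h := by
  cases h <;> rfl

theorem length_lists (R Z : List Row) (N n : ℕ) : (lists R Z N n).length = n := by
  induction n with
  | zero => rfl
  | succ n ih => rw [lists_succ, List.length_cons, ih]

theorem seg_mem_filter {A : ℕ → ℕ → SignType} {L : List Row} {N h : ℕ} (hh : h < N)
    (hd : A h h ≠ 1) (hL : seg (A h) N ∈ L) :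
    seg (A h) N ∈ L.filter fun r => notPos ((dropR (N - 1 - h) r).headD .zero) := by
  rw [List.mem_filter]
  refine ⟨hL, ?_⟩
  have := dropR_seg (A h) (N - 1 - h) (h + 1)
  rw [show h + 1 + (N - 1 - h) = N by omega] at this
  rw [this]
  change notPos (A h h) = true
  generalize A h h = v at hd
  cases v
  · rfl
  · rfl
  · exact absurd rfl hd

theorem exists_fits {A : ℕ → ℕ → SignType} {R Z : List Row} {N : ℕ} (n : ℕ) (hn : n ≤ N)
    (hd : ∀ h < N, A h h ≠ 1) (hR : ∀ h < N, 0 < h → seg (A h) N ∈ R) (hZ : seg (A 0) N ∈ Z) :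
    ∃ t, Fits A t N (lists R Z N n) := by
  have key : ∀ h, ∃ i : ℕ, h < N → (List.filter (fun r =>
      notPos ((dropR (N - 1 - h) r).headD .zero))
      (if h = 0 then Z else R))[i]? = some (seg (A h) N) := by
    intro h
    by_cases hh : h < N
    · obtain ⟨i, hi⟩ := List.mem_iff_getElem?.mp (seg_mem_filter hh (hd h hh)
        (show seg (A h) N ∈ if h = 0 then Z else R by
          split_ifs with h0
          · rw [h0]; exact hZ
          · exact hR h hh (Nat.pos_of_ne_zero h0)))
      exact ⟨i, fun _ => hi⟩
    · exact ⟨0, fun h => absurd h hh⟩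
  choose t ht using key
  refine ⟨t, ?_⟩
  induction n with
  | zero => trivial
  | succ n ih =>
    rw [lists_succ]
    refine ⟨?_, ih (by omega)⟩
    rw [length_lists]
    exact ht n (by omega)

/-- The search refutes all matrices with the required properties, if the parts `fs` into which it is
divided cover all candidates for the last row. -/
theorem refute_sound {S N : ℕ} {A : ℕ → ℕ → SignType} {R Z : List Row}
    {fs : List (List Row → List Row)}
    (hS : 1 < S) (hN : 2 ≤ N) (hA : ∀ i j, A i j = A j i)
    (hd : ∀ h < N, A h h ≠ 1) (hR : ∀ h < N, 0 < h → seg (A h) N ∈ R) (hZ : seg (A 0) N ∈ Z)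
    (hfs : ∀ l : List Row, ∀ r ∈ l, ∃ f ∈ fs, r ∈ f l)
    (H : ∀ f ∈ fs, refute S f R Z N = true) : False := by
  obtain ⟨n, rfl⟩ : ∃ n, N = n + 2 := ⟨N - 2, by omega⟩
  obtain ⟨t, ht⟩ := exists_fits n (by omega) hd hR hZ
  have e : ∀ f, refute S f R Z (n + 2) = search S f
      (List.filter (fun r => notPos ((dropR (n + 2 - 1 - (n + 1)) r).headD .zero)) R)
      (List.filter (fun r => notPos ((dropR (n + 2 - 1 - n) r).headD .zero))
        (if n = 0 then Z else R))
      (lists R Z (n + 2) n) := by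
    intro f
    rw [refute, forceRs_eq, forceRs_eq, forceRss_eq, lists_succ, lists_succ, if_neg (by omega)]
  obtain ⟨f, hf, hmem⟩ := hfs _ _ (seg_mem_filter (by omega) (hd (n + 1) (by omega))
      (hR (n + 1) (by omega) (by omega)))
  have H := H f hf
  rw [e, search_sound (t := t) hS hA] at H
  · exact absurd H (by simp)
  · rw [length_lists]; exact hmem
  · rw [length_lists]
    apply seg_mem_filter (by omega) (hd n (by omega))
    split_ifs with h0
    · rw [h0]; rw [h0] at hZ; exact hZ
    · exact hR n (by omega) (by omega)
  · rw [length_lists]; exact ht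
end SymSearch

/-! ### The matrices to be refuted -/

namespace SymSearch

theorem coe_raise (v : SignType) : (raise v : ℤ) = (v : ℤ) + 1 := by cases v <;> rfl

theorem sum_raise {f : ℕ → SignType} {w : ℕ → ℕ} {n : ℕ}
    (h : ∑ j ∈ Finset.range n, (f j : ℤ) * w j = 0) :
    ∑ j ∈ Finset.range n, raise (f j) * w j = ∑ j ∈ Finset.range n, w j := by
  zify
  simp only [coe_raise, add_mul, one_mul, Finset.sum_add_distrib, h, zero_add]

theorem sum_odd (m : ℕ) : ∑ j ∈ Finset.range m, (2 * j + 1) = m * m := by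
  induction m with
  | zero => rfl
  | succ m ih => rw [Finset.sum_range_succ, ih]; ring

theorem refuteEven_sound {S m : ℕ} {A : ℕ → ℕ → SignType} {fs : List (List Row → List Row)}
    (hS : 1 < S) (hm : 2 ≤ m) (hA : ∀ i j, A i j = A j i) (hd : ∀ i < m, A i i ≠ 1)
    (hsum : ∀ i < m, ∑ j ∈ Finset.range m, (A i j : ℤ) * (2 * j + 1 : ℕ) = 0)
    (hcard : ∀ i < m, count (A i) m = 4)
    (hfs : ∀ l : List Row, ∀ r ∈ l, ∃ f ∈ fs, r ∈ f l)
    (H : ∀ f ∈ fs, refuteEven S m f = true) : False := by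
  have hmem : ∀ i < m, seg (A i) m ∈ rows (fun h => 2 * h + 1) m 4 (m * m) := by
    intro i hi
    have h1 := seg_mem_rows (fun h => 2 * h + 1) (A i) m
    have h2 := sum_odd m
    rwa [hcard i hi, sum_raise (w := fun h => 2 * h + 1) (hsum i hi), h2] at h1
  exact refute_sound hS hm hA hd (fun h hh _ => hmem h hh) (hmem 0 (by omega)) hfs H

theorem refuteOdd_sound {S k : ℕ} {A : ℕ → ℕ → SignType}
    (hS : 1 < S) (hk : 1 ≤ k) (hA : ∀ i j, A i j = A j i) (hd : ∀ i < k + 1, A i i ≠ 1)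
    (hsum : ∀ i < k + 1, 0 < i → ∑ j ∈ Finset.range (k + 1), (A i j : ℤ) * (2 * j : ℕ) = 0)
    (hcard : ∀ i < k + 1, 0 < i → count (A i) (k + 1) = 4)
    (hcard0 : count (A 0) (k + 1) = 2) (hpos : ∀ j, A 0 j ≠ -1)
    (H : refuteOdd S k = true) : False := by
  refine refute_sound (fs := [id]) hS (N := k + 1) (by omega) hA hd (fun i hi h0 => ?_) ?_
    (fun l r hr => ⟨id, by simp, hr⟩) (by simpa [refuteOdd] using H)
  · have h1 := seg_mem_rows (fun h => 2 * h) (A i) (k + 1)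
    have h2 : ∑ j ∈ Finset.range (k + 1), (2 * j) = k * (k + 1) := by
      clear * -
      induction k with
      | zero => rfl
      | succ m ih => rw [Finset.sum_range_succ, ih]; ring
    rwa [hcard i hi h0, sum_raise (w := fun h => 2 * h) (hsum i hi h0), h2] at h1
  · have h1 := seg_mem_rows (fun _ => 1) (A 0) (k + 1)
    have h2 : ∑ j ∈ Finset.range (k + 1), raise (A 0 j) * 1 = k + 3 := by
      have : ∀ j, raise (A 0 j) * 1 = (if A 0 j = 0 then 0 else 1) + 1 := by
        intro j
        have := hpos j
        generalize A 0 j = v at this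
        cases v
        · rfl
        · exact absurd rfl this
        · rfl
      simp only [this, Finset.sum_add_distrib]
      rw [count] at hcard0
      rw [hcard0]
      simp
      omega
    rwa [hcard0, h2] at h1

end SymSearch

/-! ### Codes and their quotient matrices -/

/-- The graph on the labels of order `n` with neighborhoods `nb`, with the properties that a
self-reverse distance magic labeling of a tetravalent graph gives. -/
structure IsCode (n : ℕ) (nb : ℤ → Finset ℤ) : Prop where
  mem : ∀ {a b}, b ∈ nb a → a ∈ labelSet n
  symm : ∀ {a b}, b ∈ nb a → a ∈ nb b
  irrefl : ∀ a, a ∉ nb a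
  neg : ∀ {a b}, b ∈ nb a → -b ∈ nb (-a)
  card : ∀ {a}, a ∈ labelSet n → (nb a).card = 4
  sum : ∀ {a}, a ∈ labelSet n → ∑ b ∈ nb a, b = 0

/-- No label `a ≠ 0` is adjacent to both `b` and `-b`, for a `b ≠ 0`. -/
def NonDegenerate (nb : ℤ → Finset ℤ) : Prop :=
  ∀ a b, a ≠ 0 → b ≠ 0 → b ∈ nb a → -b ∉ nb a

/-- Any two labels are joined by a path. -/
def IsLinked (n : ℕ) (nb : ℤ → Finset ℤ) : Prop :=
  ∀ a ∈ labelSet n, ∀ b ∈ labelSet n, Relation.ReflTransGen (fun x y => y ∈ nb x) a b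

theorem sum_labels_even (m : ℕ) (g : ℤ → ℤ) :
    ∑ i ∈ Finset.range (2 * m), g (1 - (2 * m : ℕ) + 2 * i) =
      ∑ j ∈ Finset.range m, (g (2 * j + 1 : ℕ) + g (-(2 * j + 1 : ℕ))) := by
  induction m with
  | zero => simp
  | succ m ih =>
    rw [Finset.sum_range_succ, ← ih, show 2 * (m + 1) = 2 * m + 1 + 1 by ring,
        Finset.sum_range_succ,
      Finset.sum_range_succ']
    have e1 : ∀ i : ℕ, (1 - ((2 * m + 1 + 1 : ℕ) : ℤ) + 2 * ((i + 1 : ℕ) : ℤ)) =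
        1 - (2 * m : ℕ) + 2 * i := by
      intro i; push_cast; ring
    have e2 : (1 - ((2 * m + 1 + 1 : ℕ) : ℤ) + 2 * ((0 : ℕ) : ℤ)) =
        -(2 * m + 1 : ℕ) := by push_cast; ring
    have e3 : (1 - ((2 * m + 1 + 1 : ℕ) : ℤ) + 2 * ((2 * m + 1 : ℕ) : ℤ)) =
        (2 * m + 1 : ℕ) := by push_cast; ring
    rw [e2, e3]
    simp only [e1]
    ring

theorem sum_labels_odd (k : ℕ) (g : ℤ → ℤ) :
    ∑ i ∈ Finset.range (2 * k + 1), g (1 - (2 * k + 1 : ℕ) + 2 * i) =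
      g 0 + ∑ j ∈ Finset.range k, (g (2 * (j + 1) : ℕ) + g (-(2 * (j + 1) : ℕ))) := by
  induction k with
  | zero => simp
  | succ m ih =>
    rw [Finset.sum_range_succ _ m, ← add_assoc, ← ih,
      show 2 * (m + 1) + 1 = 2 * m + 1 + 1 + 1 by ring,
      Finset.sum_range_succ, Finset.sum_range_succ']
    have e1 : ∀ i : ℕ, (1 - ((2 * m + 1 + 1 + 1 : ℕ) : ℤ) + 2 * ((i + 1 : ℕ) : ℤ)) =
        1 - (2 * m + 1 : ℕ) + 2 * i := by
      intro i; push_cast; ring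
    have e2 : (1 - ((2 * m + 1 + 1 + 1 : ℕ) : ℤ) + 2 * ((0 : ℕ) : ℤ)) =
        -(2 * (m + 1) : ℕ) := by push_cast; ring
    have e3 : (1 - ((2 * m + 1 + 1 + 1 : ℕ) : ℤ) + 2 * ((2 * m + 1 + 1 : ℕ) : ℤ)) =
        (2 * (m + 1) : ℕ) := by push_cast; ring
    rw [e2, e3]
    simp only [e1]
    ring

theorem IsCode.mem' {n : ℕ} {nb : ℤ → Finset ℤ} (h : IsCode n nb) {a b : ℤ} (hb : b ∈ nb a) :
    b ∈ labelSet n := h.mem (h.symm hb)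

theorem IsCode.neg_iff {n : ℕ} {nb : ℤ → Finset ℤ} (h : IsCode n nb) {a b : ℤ} :
    -b ∈ nb (-a) ↔ b ∈ nb a :=
  ⟨fun hb => by simpa using h.neg hb, h.neg⟩

theorem IsCode.symm_iff {n : ℕ} {nb : ℤ → Finset ℤ} (h : IsCode n nb) {a b : ℤ} :
    b ∈ nb a ↔ a ∈ nb b := ⟨h.symm, h.symm⟩

theorem IsCode.sum_nb {n : ℕ} {nb : ℤ → Finset ℤ} (h : IsCode n nb) (a : ℤ) (g : ℤ → ℤ) :
    ∑ b ∈ nb a, g b = ∑ i ∈ Finset.range n,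
      if (1 - (n : ℤ) + 2 * i) ∈ nb a then g (1 - (n : ℤ) + 2 * i) else 0 := by
  have hinj : Set.InjOn (fun i : ℕ => 1 - (n : ℤ) + 2 * i) (Finset.range n : Set ℕ) := by
    intro i _ j _ hij
    simp at hij
    exact hij
  have hsub : nb a ⊆ (Finset.range n).image fun i : ℕ => 1 - (n : ℤ) + 2 * i := by
    intro b hb
    obtain ⟨i, hi, e⟩ := h.mem' hb
    exact Finset.mem_image.mpr ⟨i, Finset.mem_range.mpr hi, e.symm⟩
  rw [← Finset.sum_image (f := fun b => if b ∈ nb a then g b else 0) hinj, ← Finset.sum_filter]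
  congr 1
  ext b
  simp only [Finset.mem_filter]
  exact ⟨fun hb => ⟨hsub hb, hb⟩, fun hb => hb.2⟩

open Classical in
/-- The sign with which `x` occurs in `N`. -/
noncomputable def signIn (N : Finset ℤ) (x : ℤ) : SignType :=
  if x ∈ N then 1 else if -x ∈ N then -1 else 0

/-- The signed quotient of a code by negation, for the nonnegative labels `w i`. -/
noncomputable def quotientMatrix (nb : ℤ → Finset ℤ) (w : ℕ → ℤ) (i j : ℕ) : SignType :=
  signIn (nb (w i)) (w j)

theorem IsCode.quotientMatrix_symm {n : ℕ} {nb : ℤ → Finset ℤ} (h : IsCode n nb) (w : ℕ → ℤ)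
    (i j : ℕ) :
    quotientMatrix nb w i j = quotientMatrix nb w j i := by
  have h1 : (w j ∈ nb (w i)) ↔ (w i ∈ nb (w j)) := h.symm_iff
  have h2 : (-w j ∈ nb (w i)) ↔ (-w i ∈ nb (w j)) := by
    rw [h.symm_iff, ← h.neg_iff, neg_neg]
  simp only [quotientMatrix, signIn, h1, h2]

theorem IsCode.quotientMatrix_diag {n : ℕ} {nb : ℤ → Finset ℤ} (h : IsCode n nb)
    (w : ℕ → ℤ) (i : ℕ) :
    quotientMatrix nb w i i ≠ 1 := by
  unfold quotientMatrix signIn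
  rw [if_neg (h.irrefl _)]
  split_ifs <;> decide

/-- The neighbors `x` and `-x` contribute to a sum of labels as the sign does. -/
theorem signIn_mul {N : Finset ℤ} {x : ℤ} (h : x ∈ N → -x ∉ N) :
    (if x ∈ N then x else 0) + (if -x ∈ N then -x else 0) = (signIn N x : ℤ) * x := by
  unfold signIn
  by_cases h1 : x ∈ N
  · simp [h1, h h1]
  · by_cases h2 : -x ∈ N <;> simp [h1, h2]

theorem signIn_count {N : Finset ℤ} {x : ℤ} (h : x ∈ N → -x ∉ N) :
    (if x ∈ N then (1 : ℤ) else 0) + (if -x ∈ N then 1 else 0) =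
      ((if signIn N x = 0 then 0 else 1 : ℕ) : ℤ) := by
  unfold signIn
  by_cases h1 : x ∈ N
  · simp [h1, h h1]
  · by_cases h2 : -x ∈ N <;> simp [h1, h2]

theorem mem_labelSet_even {m j : ℕ} (h : j < m) : ((2 * j + 1 : ℕ) : ℤ) ∈ labelSet (2 * m) :=
  ⟨m + j, by omega, by push_cast; ring⟩

theorem mem_labelSet_odd {k j : ℕ} (h : j ≤ k) : ((2 * j : ℕ) : ℤ) ∈ labelSet (2 * k + 1) :=
  ⟨k + j, by omega, by push_cast; ring⟩

open SymSearch in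
theorem IsCode.quotient_even {m : ℕ} {nb : ℤ → Finset ℤ} (h : IsCode (2 * m) nb)
    (hd : NonDegenerate nb) {i : ℕ} (hi : i < m) :
    ∑ j ∈ Finset.range m, (quotientMatrix nb (fun j => ((2 * j + 1 : ℕ) : ℤ)) i j : ℤ) *
        (2 * j + 1 : ℕ) = 0 ∧
      count (quotientMatrix nb (fun j => ((2 * j + 1 : ℕ) : ℤ)) i) m = 4 := by
  have hsgn : ∀ j : ℕ, ((2 * j + 1 : ℕ) : ℤ) ∈ nb ((2 * i + 1 : ℕ) : ℤ) →
      -((2 * j + 1 : ℕ) : ℤ) ∉ nb ((2 * i + 1 : ℕ) : ℤ) :=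
    fun j => hd _ _ (by push_cast; omega) (by push_cast; omega)
  constructor
  · have h1 := h.sum (mem_labelSet_even hi)
    rw [h.sum_nb _ fun b => b, sum_labels_even m fun b =>
        if b ∈ nb ((2 * i + 1 : ℕ) : ℤ) then b else 0] at h1
    rw [← h1]
    exact Finset.sum_congr rfl fun j _ => (signIn_mul (hsgn j)).symm
  · have h1 := h.card (mem_labelSet_even hi)
    have h2 := h.sum_nb ((2 * i + 1 : ℕ) : ℤ) fun _ => 1
    rw [Finset.sum_const, h1, sum_labels_even m fun b =>
        if b ∈ nb ((2 * i + 1 : ℕ) : ℤ) then 1 else 0] at h2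
    simp only [mul_one, nsmul_eq_mul] at h2
    rw [← Nat.cast_inj (R := ℤ), count, Nat.cast_sum]
    refine Eq.trans ?_ h2.symm
    exact Finset.sum_congr rfl fun j _ => (signIn_count (hsgn j)).symm

open SymSearch in
/-- A search without result excludes nondegenerate codes of even order. -/
theorem IsCode.even_false {S m : ℕ} {nb : ℤ → Finset ℤ} {fs : List (List Row → List Row)}
    (h : IsCode (2 * m) nb) (hd : NonDegenerate nb) (hS : 1 < S) (hm : 2 ≤ m)
    (hfs : ∀ l : List Row, ∀ r ∈ l, ∃ f ∈ fs, r ∈ f l)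
    (H : ∀ f ∈ fs, refuteEven S m f = true) : False :=
  refuteEven_sound hS hm (h.quotientMatrix_symm fun j => ((2 * j + 1 : ℕ) : ℤ))
    (fun i _ => h.quotientMatrix_diag _ i) (fun _ hi => (h.quotient_even hd hi).1)
    (fun _ hi => (h.quotient_even hd hi).2) hfs H

open SymSearch in
/-- A search without result excludes nondegenerate codes of odd order. -/
theorem IsCode.odd_false {S k : ℕ} {nb : ℤ → Finset ℤ}
    (h : IsCode (2 * k + 1) nb) (hd : NonDegenerate nb) (hS : 1 < S) (hk : 1 ≤ k)
    (H : refuteOdd S k = true) : False := by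
  have hsgn : ∀ i j : ℕ, 0 < i → ((2 * (j + 1) : ℕ) : ℤ) ∈ nb ((2 * i : ℕ) : ℤ) →
      -((2 * (j + 1) : ℕ) : ℤ) ∉ nb ((2 * i : ℕ) : ℤ) :=
    fun i j hi => hd _ _ (by push_cast; omega) (by push_cast; omega)
  have hneg0 : ∀ b, -b ∈ nb 0 ↔ b ∈ nb 0 := fun b => by rw [← h.neg_iff (b := b), neg_zero]
  have hzero : ∀ N : Finset ℤ, ((if signIn N 0 = 0 then 0 else 1 : ℕ) : ℤ) =
      if (0 : ℤ) ∈ N then 1 else 0 := by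
    intro N
    unfold signIn
    by_cases h0 : (0 : ℤ) ∈ N <;> simp [h0]
  refine refuteOdd_sound hS hk (h.quotientMatrix_symm fun j => ((2 * j : ℕ) : ℤ))
    (fun i _ => h.quotientMatrix_diag _ i) (fun i hi hi0 => ?_) (fun i hi hi0 => ?_) ?_
      (fun j => ?_) H
  · have h1 := h.sum (mem_labelSet_odd (Nat.lt_succ_iff.mp hi))
    rw [h.sum_nb _ fun b => b, sum_labels_odd k fun b => if b ∈ nb ((2 * i : ℕ) : ℤ) then b else 0]
        at h1
    rw [← h1, Finset.sum_range_succ', add_comm]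
    congr 1
    · simp
    · exact Finset.sum_congr rfl fun j _ => (signIn_mul (hsgn i j hi0)).symm
  · have h1 := h.card (mem_labelSet_odd (Nat.lt_succ_iff.mp hi))
    have h2 := h.sum_nb ((2 * i : ℕ) : ℤ) fun _ => 1
    rw [Finset.sum_const, h1, sum_labels_odd k fun b => if b ∈ nb ((2 * i : ℕ) : ℤ) then 1 else 0]
        at h2
    simp only [mul_one, nsmul_eq_mul] at h2
    rw [← Nat.cast_inj (R := ℤ), count, Nat.cast_sum, Finset.sum_range_succ', add_comm]
    refine Eq.trans ?_ h2.symm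
    congr 1
    · exact hzero _
    · exact Finset.sum_congr rfl fun j _ => (signIn_count (hsgn i j hi0)).symm
  · have h1 := h.card (a := 0) (by simpa using mem_labelSet_odd (Nat.zero_le k))
    have h2 := h.sum_nb 0 fun _ => 1
    rw [Finset.sum_const, h1, sum_labels_odd k fun b => if b ∈ nb 0 then 1 else 0,
        if_neg (h.irrefl 0)] at h2
    simp only [mul_one, nsmul_eq_mul, hneg0, zero_add, ← two_mul, ← Finset.mul_sum] at h2
    have h3 : (count (quotientMatrix nb (fun j => ((2 * j : ℕ) : ℤ)) 0) (k + 1) : ℤ) =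
        ∑ j ∈ Finset.range k, if ((2 * (j + 1) : ℕ) : ℤ) ∈ nb 0 then 1 else 0 := by
      rw [count, Nat.cast_sum, Finset.sum_range_succ']
      have e0 : ((if quotientMatrix nb (fun j => ((2 * j : ℕ) : ℤ)) 0 0 = 0 then 0 else 1 : ℕ) :
          ℤ) = 0 := by
        refine (hzero _).trans ?_
        simp [h.irrefl 0]
      rw [e0, add_zero]
      refine Finset.sum_congr rfl fun j _ => ?_
      unfold quotientMatrix signIn
      simp only [mul_zero, Nat.cast_zero, hneg0]
      by_cases hj : ((2 * (j + 1) : ℕ) : ℤ) ∈ nb 0 <;> simp only [hj] <;> simp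
    rw [← Nat.cast_inj (R := ℤ), h3]
    push_cast at h2 ⊢
    omega
  · unfold quotientMatrix signIn
    simp only [mul_zero, Nat.cast_zero, hneg0]
    by_cases hj : ((2 * j : ℕ) : ℤ) ∈ nb 0 <;> simp only [hj] <;> decide

/-! ### Graphs whose vertices fall into pairs of twins -/

theorem IsWreathGraph.exists_twin {V : Type*} {G : SimpleGraph V} (h : IsWreathGraph G) (v : V) :
    ∃ w ≠ v, ∀ x, G.Adj v x ↔ G.Adj w x := by
  obtain ⟨m, -, ⟨e⟩⟩ := h
  refine ⟨e.symm ((e v).1, !(e v).2), fun hw => ?_, fun x => ?_⟩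
  · have h1 : ((e v).1, !(e v).2) = e v := by
      rw [← e.apply_symm_apply ((e v).1, !(e v).2), hw]
    have h2 : (!(e v).2) = (e v).2 := congrArg Prod.snd h1
    revert h2
    cases (e v).2 <;> decide
  · rw [← e.map_adj_iff, ← e.map_adj_iff (v := e.symm _), e.apply_symm_apply]
    rfl

section Twins

variable {V : Type*} {G : SimpleGraph V} {τ : V → V}

/-- An involution without fixed points that preserves the neighborhoods. -/
structure IsTwinning (G : SimpleGraph V) (τ : V → V) : Prop where
  invol : ∀ v, τ (τ v) = v
  ne : ∀ v, τ v ≠ v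
  adj : ∀ u v, G.Adj u v → G.Adj u (τ v)

namespace IsTwinning

/-- Two vertices are equal or twins. -/
def Rel (τ : V → V) (u v : V) : Prop := u = v ∨ u = τ v

theorem rel_symm (h : IsTwinning G τ) {u v : V} (huv : Rel τ u v) : Rel τ v u := by
  rcases huv with rfl | rfl
  · exact Or.inl rfl
  · exact Or.inr (h.invol v).symm

theorem rel_trans (h : IsTwinning G τ) {u v w : V} (huv : Rel τ u v) (hvw : Rel τ v w) :
    Rel τ u w := by
  rcases huv with rfl | rfl
  · exact hvw
  · rcases hvw with rfl | rfl
    · exact Or.inr rfl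
    · exact Or.inl (h.invol w)

theorem adj_of_rel (h : IsTwinning G τ) {u v w : V} (huv : G.Adj u v) (hr : Rel τ w v) :
    G.Adj u w := by
  rcases hr with rfl | rfl
  · exact huv
  · exact h.adj _ _ huv

theorem adj_of_rel_left (h : IsTwinning G τ) {u v w : V} (huv : G.Adj u v) (hr : Rel τ w u) :
    G.Adj w v :=
  (h.adj_of_rel huv.symm hr).symm

theorem not_rel (h : IsTwinning G τ) {u v : V} (huv : G.Adj u v) : ¬ Rel τ v u := fun hr =>
  G.irrefl (h.adj_of_rel huv (h.rel_symm hr))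

open Classical in
/-- The four neighbors of a vertex are two pairs of twins. -/
theorem rel_or_rel [Fintype V] (h : IsTwinning G τ) (hG : IsTetravalent G) {v a b x : V}
    (ha : G.Adj v a)
    (hb : G.Adj v b) (hab : ¬ Rel τ a b) (hx : G.Adj v x) : Rel τ x a ∨ Rel τ x b := by
  have hs : ({a, τ a, b, τ b} : Finset V) ⊆ G.neighborFinset v := by
    intro y hy
    simp only [Finset.mem_insert, Finset.mem_singleton] at hy
    rw [SimpleGraph.mem_neighborFinset]
    rcases hy with rfl | rfl | rfl | rfl
    · exact ha
    · exact h.adj _ _ ha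
    · exact hb
    · exact h.adj _ _ hb
  have h1 : a ≠ b := fun e => hab (Or.inl e)
  have h2 : a ≠ τ b := fun e => hab (Or.inr e)
  have h3 : τ a ≠ b := fun e => hab (Or.inr (by rw [← e, h.invol]))
  have h4 : τ a ≠ τ b := fun e => h1 (by rw [← h.invol a, e, h.invol])
  have hc : ({a, τ a, b, τ b} : Finset V).card = 4 := by
    have := h.ne a
    have := h.ne b
    rw [Finset.card_insert_of_notMem, Finset.card_insert_of_notMem, Finset.card_pair] <;> grind
  have he := Finset.eq_of_subset_of_card_le hs
    (by rw [hc, SimpleGraph.card_neighborFinset_eq_degree]; exact (hG v).le)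
  have hx' : x ∈ ({a, τ a, b, τ b} : Finset V) := by rw [he]; simpa using hx
  simp only [Finset.mem_insert, Finset.mem_singleton] at hx'
  unfold Rel
  tauto

open Classical in
theorem exists_other [Fintype V] (hG : IsTetravalent G) (τ : V → V) (u v : V) :
    ∃ w, G.Adj v w ∧ ¬ Rel τ w u := by
  by_contra hne
  push Not at hne
  have hs : G.neighborFinset v ⊆ {u, τ u} := by
    intro y hy
    rw [SimpleGraph.mem_neighborFinset] at hy
    rcases hne y hy with rfl | rfl <;> simp
  have := Finset.card_le_card hs
  rw [SimpleGraph.card_neighborFinset_eq_degree] at this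
  have h4 := hG v
  have := Finset.card_le_two (a := u) (b := τ u)
  omega

/-- A path in the quotient by the twins that never turns back. -/
theorem exists_path [Fintype V] [Nonempty V] (hG : IsTetravalent G) (τ : V → V) :
    ∃ p : ℕ → V, ∀ k, G.Adj (p k) (p (k + 1)) ∧ ¬ Rel τ (p (k + 2)) (p k) := by
  choose other h1 h2 using exists_other hG τ
  let v₀ : V := Classical.arbitrary V
  let s : ℕ → V × V := fun k => Nat.rec (v₀, other v₀ v₀) (fun _ q => (q.2, other q.1 q.2)) k
  have hs : ∀ k, G.Adj (s k).1 (s k).2 := by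
    intro k
    cases k with
    | zero => exact h1 v₀ v₀
    | succ k => exact h1 _ _
  exact ⟨fun k => (s k).1, fun k => ⟨hs k, h2 _ _⟩⟩

/-- A path that never turns back returns to a vertex for the first time at its start, since the
inner vertices of the path have no further neighbors. -/
theorem exists_cycle [Fintype V] [Nonempty V] (h : IsTwinning G τ) (hG : IsTetravalent G) :
    ∃ (m : ℕ) (p : ℕ → V), 3 ≤ m ∧ (∀ k, G.Adj (p k) (p (k + 1))) ∧ Rel τ (p m) (p 0) ∧
      ∀ i j, i < j → j < m → ¬ Rel τ (p j) (p i) := by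
  classical
  obtain ⟨p, hp⟩ := exists_path hG τ
  have hex : ∃ m, ∃ i < m, Rel τ (p m) (p i) := by
    obtain ⟨i, j, hij, he⟩ := Finite.exists_ne_map_eq_of_infinite p
    rcases lt_or_gt_of_ne hij with hlt | hlt
    · exact ⟨j, i, hlt, Or.inl he.symm⟩
    · exact ⟨i, j, hlt, Or.inl he⟩
  obtain ⟨i, him, hr⟩ := Nat.find_spec hex
  have hmin : ∀ i j, i < j → j < Nat.find hex → ¬ Rel τ (p j) (p i) :=
    fun i j hij hj hr => Nat.find_min hex hj ⟨i, hij, hr⟩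
  obtain ⟨m, hm⟩ : ∃ m, m = Nat.find hex := ⟨_, rfl⟩
  rw [← hm] at hr him hmin
  have h1 : ∀ k, ¬ Rel τ (p (k + 1)) (p k) := fun k => h.not_rel (hp k).1
  have hi : i = 0 := by
    by_contra hi0
    obtain ⟨j, rfl⟩ := Nat.exists_eq_succ_of_ne_zero hi0
    obtain ⟨n, rfl⟩ : ∃ n, m = n + 1 := ⟨m - 1, by omega⟩
    -- the predecessor of `p m` is a neighbor of `p i`
    have hadj : G.Adj (p (j + 1)) (p n) := (h.adj_of_rel (hp n).1 (h.rel_symm hr)).symm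
    rcases h.rel_or_rel hG (hp (j + 1)).1 (hp j).1.symm (hp j).2 hadj with h2 | h2
    · rcases Nat.lt_trichotomy n (j + 2) with h3 | h3 | h3
      · have : n = j + 1 := by omega
        subst this
        exact h1 _ hr
      · subst h3
        exact (hp (j + 1)).2 hr
      · exact hmin _ _ h3 (by omega) h2
    · exact hmin j n (by omega) (by omega) h2
  subst hi
  refine ⟨m, p, ?_, fun k => (hp k).1, hr, hmin⟩
  by_contra hlt
  obtain rfl | rfl : m = 1 ∨ m = 2 := by omega
  · exact h1 0 hr
  · exact (hp 0).2 hr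

/-- A connected tetravalent graph whose vertices fall into pairs of twins is a cycle of such
pairs. -/
theorem isWreathGraph [Fintype V] (h : IsTwinning G τ) (hG : IsTetravalent G) (hc : G.Connected) :
    IsWreathGraph G := by
  have := hc.nonempty
  obtain ⟨m, p, hm, hadj, hwrap, hinj⟩ := h.exists_cycle hG
  have : NeZero m := ⟨by omega⟩
  have : Fact (1 < m) := ⟨by omega⟩
  let q : ZMod m → V := fun i => p i.val
  have hqinj : ∀ i j, Rel τ (q i) (q j) → i = j := by
    intro i j hr
    rcases Nat.lt_trichotomy i.val j.val with h1 | h1 | h1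
    · exact absurd (h.rel_symm hr) (hinj _ _ h1 (ZMod.val_lt j))
    · exact ZMod.val_injective m h1
    · exact absurd hr (hinj _ _ h1 (ZMod.val_lt i))
  have hsucc : ∀ i, G.Adj (q i) (q (i + 1)) := by
    intro i
    have hi := ZMod.val_lt i
    refine h.adj_of_rel (hadj i.val) ?_
    rcases Nat.lt_or_ge (i.val + 1) m with h1 | h1
    · left
      change p _ = _
      rw [ZMod.val_add_of_lt] <;> rw [ZMod.val_one]
      exact h1
    · have h2 : i.val + 1 = m := by omega
      have h3 : i + 1 = 0 := by
        rw [← ZMod.natCast_zmod_val i]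
        have : ((i.val + 1 : ℕ) : ZMod m) = 0 := by rw [h2]; simp
        simpa using this
      rw [h2, h3]
      change Rel τ (p (0 : ZMod m).val) (p m)
      rw [ZMod.val_zero]
      exact h.rel_symm hwrap
  have hpred : ∀ i, G.Adj (q i) (q (i - 1)) := by
    intro i
    have := hsucc (i - 1)
    rw [sub_add_cancel] at this
    exact this.symm
  have h2 : (2 : ZMod m) ≠ 0 := by
    intro h0
    have h0' : ((2 : ℕ) : ZMod m) = 0 := by exact_mod_cast h0
    rw [ZMod.natCast_eq_zero_iff] at h0'
    have := Nat.le_of_dvd (by norm_num) h0'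
    omega
  have hnb : ∀ i x, G.Adj (q i) x → Rel τ x (q (i - 1)) ∨ Rel τ x (q (i + 1)) := by
    intro i x hx
    refine h.rel_or_rel hG (hpred i) (hsucc i) (fun hr => h2 ?_) hx
    have := hqinj _ _ hr
    linear_combination -this
  have hsurj : ∀ v, ∃ i, Rel τ v (q i) := by
    intro v
    obtain ⟨w⟩ := hc.preconnected (q 0) v
    have key : ∀ {a b : V}, G.Walk a b → (∃ i, Rel τ a (q i)) → ∃ i, Rel τ b (q i) := by
      intro a b w
      induction w with
      | nil => exact id
      | cons hab _ ih =>
        rintro ⟨i, hi⟩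
        rcases hnb i _ (h.adj_of_rel_left hab (h.rel_symm hi)) with h1 | h1
        · exact ih ⟨_, h1⟩
        · exact ih ⟨_, h1⟩
    exact key w ⟨0, Or.inl rfl⟩
  let φ : ZMod m × Bool → V := fun x => if x.2 then τ (q x.1) else q x.1
  have hφ : ∀ x, Rel τ (φ x) (q x.1) := by
    rintro ⟨i, b⟩
    cases b
    · exact Or.inl rfl
    · exact Or.inr rfl
  have hbij : Function.Bijective φ := by
    constructor
    · rintro ⟨i, b⟩ ⟨j, c⟩ hxy
      have h1 : Rel τ (q i) (q j) :=
        h.rel_trans (h.rel_symm (hφ (i, b))) (h.rel_trans (Or.inl hxy) (hφ (j, c)))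
      obtain rfl := hqinj _ _ h1
      have := h.ne (q i)
      cases b <;> cases c <;> simp [φ] at hxy ⊢
      · exact this hxy.symm
      · exact this hxy
    · intro v
      obtain ⟨i, rfl | rfl⟩ := hsurj v
      · exact ⟨(i, false), rfl⟩
      · exact ⟨(i, true), rfl⟩
  refine ⟨m, hm, ⟨RelIso.symm ⟨Equiv.ofBijective φ hbij, ?_⟩⟩⟩
  intro x y
  change G.Adj (φ x) (φ y) ↔ x.1 ≠ y.1 ∧ (y.1 = x.1 - 1 ∨ y.1 = x.1 + 1)
  have e : G.Adj (φ x) (φ y) ↔ G.Adj (q x.1) (q y.1) :=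
    ⟨fun hxy => h.adj_of_rel (h.adj_of_rel_left hxy (h.rel_symm (hφ x))) (h.rel_symm (hφ y)),
      fun hxy => h.adj_of_rel (h.adj_of_rel_left hxy (hφ x)) (hφ y)⟩
  rw [e]
  constructor
  · intro hxy
    refine ⟨fun he => ?_, ?_⟩
    · rw [he] at hxy; exact G.irrefl hxy
    · rcases hnb _ _ hxy with h1 | h1
      · exact Or.inl (hqinj _ _ h1)
      · exact Or.inr (hqinj _ _ h1)
  · rintro ⟨-, h1 | h1⟩
    · rw [h1]; exact hpred _
    · rw [h1]; exact hsucc _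

end IsTwinning

end Twins

/-! ### The orders 8 and 16 -/

namespace SymSearch

/-- A candidate for a row: the part of it that remains to be matched, and the whole row. -/
inductive Cand
  | mk (r s : Row)

/-- The tails of the candidates that start with `v`. -/
noncomputable def heads (v : SignType) (c : List Cand) : (List Cand → Bool) → Bool :=
  List.rec (fun k => k []) (fun p _ ih k => Cand.rec (fun r s =>
    List.rec (ih k) (fun u r _ => Bool.rec (ih k) (ih fun l => k (.mk r s :: l)) (eqS u v)) r) p) c

/-- The candidates for the remaining rows that agree, by symmetry, with the row `r`. The value is
true if a row has no such candidate. -/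
noncomputable def restrict (r : Row) : List (List Cand) → (List (List Cand) → Bool) → Bool :=
  List.rec (fun _ k => k []) (fun v _ ih cs k => List.rec (k []) (fun c cs _ =>
    heads v c fun c => List.rec true (fun _ _ _ => ih cs fun l => k (c :: l)) c) cs) r

/-- Whether all symmetric matrices whose rows are among the candidates satisfy `leaf`. -/
noncomputable def solve (leaf : List Row → Bool) (n : ℕ) : List (List Cand) → List Row → Bool :=
  Nat.rec (fun _ d => leaf d) (fun _ ih cs d => List.rec false (fun c cs _ =>
    List.rec true (fun p _ ih' => Cand.rec (fun r s =>
      guard (restrict r.tail cs fun cs => ih cs (s :: d)) ih') p) c) cs) n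

noncomputable def negS (v : SignType) : SignType := SignType.rec .zero .pos .neg v

noncomputable def eqR (r : Row) : Row → Bool :=
  List.rec (fun s => List.rec true (fun _ _ _ => false) s)
    (fun u _ ih s => List.rec false (fun v s _ => guard (eqS u v) (ih s)) s) r

/-- The list `l` without a row equal to `r`; the value is false if there is none. -/
noncomputable def extract (r : Row) (l : List Row) : (List Row → Bool) → Bool :=
  List.rec (fun _ => false) (fun s l ih k => Bool.rec (ih fun l => k (s :: l)) (k l) (eqR r s)) l

/-- Whether a list can be split into pairs of equal rows. -/
noncomputable def pairUp (n : ℕ) : List Row → Bool :=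
  Nat.rec (fun l => List.rec true (fun _ _ _ => false) l)
    (fun _ ih l => List.rec true (fun r l _ => extract r l ih) l) n

noncomputable def cands (L : List (List Row)) : List (List Cand) :=
  L.map fun l => l.map fun r => .mk r r

/-- Whether the rows in `d` and their negatives can be split into pairs of equal rows. -/
noncomputable def twinned (n : ℕ) (d : List Row) : Bool :=
  forceRs (d ++ d.map fun r => r.map negS) (pairUp n)

/-- Whether `twinned` holds for the rows of all matrices that nondegenerate codes of order `2 * m`
can have. -/
noncomputable def allTwinned (m : ℕ) : Bool :=
  forceRs (rows (fun h => 2 * h + 1) m 4 (m * m)) fun R =>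
    forceRss (lists R R m m) fun cs => solve (twinned m) m (cands cs) []

/-- The list `cs` holds, for the heights below `k` in descending order, the rows of `A` among the
candidates, cut off at column `n`. -/
def Offers (A : ℕ → ℕ → SignType) (m n : ℕ) : ℕ → List (List Cand) → Prop
  | 0, cs => cs = []
  | k + 1, cs => ∃ c cs', cs = c :: cs' ∧ .mk (seg (A k) n) (seg (A k) m) ∈ c ∧ Offers A m n k cs'

theorem eqS_eq (u v : SignType) : eqS u v = decide (u = v) := by cases u <;> cases v <;> rfl

theorem heads_spec (v : SignType) (c : List Cand) :
    ∃ c', (∀ k, heads v c k = k c') ∧ ∀ r s, .mk (v :: r) s ∈ c → .mk r s ∈ c' := by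
  induction c with
  | nil => exact ⟨[], fun _ => rfl, by simp⟩
  | cons p c ih =>
    obtain ⟨c', h1, h2⟩ := ih
    obtain ⟨r, s⟩ := p
    cases r with
    | nil =>
      refine ⟨c', fun k => h1 k, fun r' s' hr => ?_⟩
      rcases List.mem_cons.mp hr with h | h
      · cases h
      · exact h2 _ _ h
    | cons u r =>
      have e : ∀ k, heads v (.mk (u :: r) s :: c) k =
        (Bool.rec (heads v c k) (heads v c fun l => k (.mk r s :: l)) (eqS u v) : Bool) :=
          fun _ => rfl
      by_cases huv : u = v
      · subst huv
        refine ⟨.mk r s :: c', fun k => ?_, fun r' s' hr => ?_⟩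
        · rw [e, eqS_self]
          exact h1 _
        · rcases List.mem_cons.mp hr with h | h
          · cases h
            exact List.mem_cons_self
          · exact List.mem_cons_of_mem _ (h2 _ _ h)
      · refine ⟨c', fun k => ?_, fun r' s' hr => ?_⟩
        · rw [e, eqS_eq, decide_eq_false huv]
          exact h1 _
        · rcases List.mem_cons.mp hr with h | h
          · cases h
            exact absurd rfl huv
          · exact h2 _ _ h

theorem restrict_sound {A : ℕ → ℕ → SignType} (hA : ∀ i j, A i j = A j i) {m n k : ℕ}
    {cs : List (List Cand)} (h : Offers A m (n + 1) k cs) {K : List (List Cand) → Bool}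
    (H : restrict (seg (A n) k) cs K = true) : ∃ cs', Offers A m n k cs' ∧ K cs' = true := by
  induction k generalizing cs K with
  | zero => exact ⟨[], rfl, by cases h; exact H⟩
  | succ k ih =>
    obtain ⟨c, cs, rfl, hc, hcs⟩ := h
    obtain ⟨c', h1, h2⟩ := heads_spec (A n k) c
    have hc' := h2 (seg (A k) n) _ (by rw [hA n k]; exact hc)
    replace H : (heads (A n k) c fun c => (List.rec true (fun _ _ _ => restrict (seg (A n) k) cs
      fun l => K (c :: l)) c : Bool)) = true := H
    rw [h1] at H
    cases c' with
    | nil => simp at hc'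
    | cons p c' =>
      obtain ⟨cs', h3, h4⟩ := ih hcs H
      exact ⟨_, ⟨_, _, rfl, hc', h3⟩, h4⟩

theorem solve_sound {A : ℕ → ℕ → SignType} (hA : ∀ i j, A i j = A j i) {leaf : List Row → Bool}
    {m n : ℕ} {cs : List (List Cand)} (h : Offers A m n n cs) {d : List Row}
    (H : solve leaf n cs d = true) :
    leaf ((List.range n).map (fun i => seg (A i) m) ++ d) = true := by
  induction n generalizing cs d with
  | zero => exact H
  | succ n ih =>
    obtain ⟨c, cs, rfl, hc, hcs⟩ := h
    replace H : (List.rec true (fun p _ ih' => Cand.rec (fun r s => guard (restrict r.tail cs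
      fun cs => solve leaf n cs (s :: d)) ih') p) c : Bool) = true := H
    have key : restrict (seg (A n) n) cs (fun cs => solve leaf n cs (seg (A n) m :: d)) = true := by
      clear hcs
      induction c with
      | nil => simp at hc
      | cons p c ihc =>
        obtain ⟨r, s⟩ := p
        obtain ⟨H1, H2⟩ := guard_eq_true.mp H
        rcases List.mem_cons.mp hc with h | h
        · cases h
          exact H1
        · exact ihc h H2
    obtain ⟨cs', h1, h2⟩ := restrict_sound hA hcs key
    rw [List.range_succ, List.map_append, List.append_assoc]
    exact ih h1 h2

theorem eqR_iff {r s : Row} : eqR r s = true ↔ r = s := by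
  induction r generalizing s with
  | nil => cases s <;> simp [eqR]
  | cons u r ih =>
    cases s with
    | nil => exact ⟨fun h => absurd h Bool.false_ne_true, fun h => by simp at h⟩
    | cons v s =>
      have e : eqR (u :: r) (v :: s) = guard (eqS u v) (eqR r s) := rfl
      rw [e, guard_eq_true, eqS_eq, ih]
      simp

theorem extract_sound {ι : Type*} [DecidableEq ι] (f : ι → Row) (r : Row) {l : List ι}
    {k : List Row → Bool} (H : extract r (l.map f) k = true) :
    ∃ b ∈ l, f b = r ∧ k ((l.erase b).map f) = true := by
  induction l generalizing k with
  | nil => exact absurd H (by change ¬ (false = true); decide)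
  | cons a l ih =>
    replace H : (Bool.rec (extract r (l.map f) fun l => k (f a :: l)) (k (l.map f)) (eqR r (f a)) :
      Bool) = true := H
    cases he : eqR r (f a) with
    | true =>
      rw [he] at H
      exact ⟨a, by simp, (eqR_iff.mp he).symm, by simpa using H⟩
    | false =>
      rw [he] at H
      obtain ⟨b, h1, h2, h3⟩ := ih H
      have hab : a ≠ b := by
        rintro rfl
        rw [eqR_iff.mpr h2.symm] at he
        cases he
      refine ⟨b, List.mem_cons_of_mem _ h1, h2, ?_⟩
      rw [List.erase_cons_tail (by simpa using hab)]
      exact h3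

theorem pairUp_sound {ι : Type*} [DecidableEq ι] (f : ι → Row) (n : ℕ) {l : List ι} (hl : l.Nodup)
    (H : pairUp n (l.map f) = true) :
    ∃ τ : ι → ι, ∀ x ∈ l, τ x ∈ l ∧ τ x ≠ x ∧ τ (τ x) = x ∧ f (τ x) = f x := by
  induction n generalizing l with
  | zero =>
    cases l with
    | nil => exact ⟨id, by simp⟩
    | cons a l => exact absurd H (by change ¬ (false = true); decide)
  | succ n ih =>
    cases l with
    | nil => exact ⟨id, by simp⟩
    | cons a l =>
      obtain ⟨b, hb, hfb, H⟩ := extract_sound f (f a) (k := pairUp n) H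
      rw [List.nodup_cons] at hl
      obtain ⟨τ, hτ⟩ := ih (hl.2.erase b) H
      have hab : a ≠ b := fun e => hl.1 (e ▸ hb)
      have hmem : ∀ x, x ∈ l.erase b ↔ x ≠ b ∧ x ∈ l := fun x => hl.2.mem_erase_iff
      refine ⟨fun x => if x = a then b else if x = b then a else τ x, fun x hx => ?_⟩
      by_cases hxa : x = a
      · subst hxa
        simp [hb, hab.symm, hfb]
      by_cases hxb : x = b
      · subst hxb
        simp [hab, hab.symm, hfb]
      have hxl : x ∈ l := (List.mem_cons.mp hx).resolve_left hxa
      obtain ⟨h1, h2, h3, h4⟩ := hτ x ((hmem x).mpr ⟨hxb, hxl⟩)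
      have h5 := (hmem _).mp h1
      have h6 : τ x ≠ a := fun e => hl.1 (e ▸ h5.2)
      simp [hxa, hxb, h5.1, h6, h2, h3, h4, h5.2]

theorem negS_eq (v : SignType) : negS v = -v := by cases v <;> rfl

theorem map_negS_seg (f : ℕ → SignType) (m : ℕ) : (seg f m).map negS = seg (fun j => -f j) m := by
  induction m with
  | zero => rfl
  | succ m ih => simp only [seg, List.map_cons, ih, negS_eq]

theorem offers_cands {A : ℕ → ℕ → SignType} {t : ℕ → ℕ} {m : ℕ} {L : List (List Row)}
    (h : Fits A t m L) : Offers A m m L.length (cands L) := by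
  induction L with
  | nil => rfl
  | cons c L ih =>
    exact ⟨_, _, rfl, List.mem_map_of_mem (List.mem_of_getElem? h.1), ih h.2⟩

theorem seg_inj {f g : ℕ → SignType} {m : ℕ} (h : seg f m = seg g m) : ∀ j < m, f j = g j := by
  induction m with
  | zero => simp
  | succ m ih =>
    obtain ⟨h1, h2⟩ := List.cons.inj h
    intro j hj
    rcases Nat.lt_succ_iff_lt_or_eq.mp hj with h3 | rfl
    · exact ih h2 j h3
    · exact h1

theorem allTwinned_sound {m : ℕ} {A : ℕ → ℕ → SignType}
    (hm : 1 ≤ m) (hA : ∀ i j, A i j = A j i) (hd : ∀ i < m, A i i ≠ 1)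
    (hsum : ∀ i < m, ∑ j ∈ Finset.range m, (A i j : ℤ) * (2 * j + 1 : ℕ) = 0)
    (hcard : ∀ i < m, count (A i) m = 4) (H : allTwinned m = true) :
    pairUp m ((List.range m).map (fun i => seg (A i) m) ++
      (List.range m).map fun i => seg (fun j => -A i j) m) = true := by
  have hmem : ∀ i < m, seg (A i) m ∈ rows (fun h => 2 * h + 1) m 4 (m * m) := by
    intro i hi
    have h1 := seg_mem_rows (fun h => 2 * h + 1) (A i) m
    have h2 : ∑ j ∈ Finset.range m, (2 * j + 1) = m * m := sum_odd m
    rwa [hcard i hi, sum_raise (w := fun h => 2 * h + 1) (hsum i hi), h2] at h1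
  obtain ⟨t, ht⟩ := exists_fits m le_rfl hd (fun h hh _ => hmem h hh) (hmem 0 (by omega))
  have h1 := offers_cands ht
  rw [length_lists] at h1
  rw [allTwinned, forceRs_eq, forceRss_eq] at H
  have h2 := solve_sound hA h1 H
  rw [List.append_nil, twinned, forceRs_eq, List.map_map] at h2
  convert h2 using 4
  exact funext fun _ => (map_negS_seg _ _).symm
end SymSearch

open SymSearch

theorem signIn_neg {N N' : Finset ℤ} (hN : ∀ x, x ∈ N' ↔ -x ∈ N) {x : ℤ} (h : x ∈ N → -x ∉ N) :
    signIn N' x = -signIn N x := by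
  unfold signIn
  simp only [hN, neg_neg]
  by_cases h1 : x ∈ N
  · simp [h1, h h1]
  · by_cases h2 : -x ∈ N <;> simp [h1, h2]

theorem mem_iff_of_signIn_eq {N N' : Finset ℤ} {x : ℤ} (h : x ∈ N → -x ∉ N) (h' : x ∈ N' → -x ∉ N')
    (e : signIn N x = signIn N' x) : (x ∈ N ↔ x ∈ N') ∧ (-x ∈ N ↔ -x ∈ N') := by
  unfold signIn at e
  split_ifs at e <;> tauto

theorem mem_labelSet_two_mul {m : ℕ} {a : ℤ} :
    a ∈ labelSet (2 * m) ↔ ∃ j < m, a = (2 * j + 1 : ℕ) ∨ a = -(2 * j + 1 : ℕ) := by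
  constructor
  · rintro ⟨i, hi, rfl⟩
    rcases Nat.lt_or_ge i m with h | h
    · exact ⟨m - 1 - i, by omega, Or.inr (by omega)⟩
    · exact ⟨i - m, by omega, Or.inl (by omega)⟩
  · rintro ⟨j, hj, rfl | rfl⟩
    · exact ⟨m + j, by omega, by omega⟩
    · exact ⟨m - 1 - j, by omega, by omega⟩

/-- If the search finds the rows in pairs, then the labels of a nondegenerate code fall into pairs
with equal neighborhoods. -/
theorem IsCode.exists_twins {m : ℕ} {nb : ℤ → Finset ℤ} (h : IsCode (2 * m) nb)
    (hd : NonDegenerate nb) (hm : 1 ≤ m) (H : allTwinned m = true) :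
    ∃ τ : ℤ → ℤ, ∀ a ∈ labelSet (2 * m),
      τ a ∈ labelSet (2 * m) ∧ τ a ≠ a ∧ τ (τ a) = a ∧ nb (τ a) = nb a := by
  have h1 := allTwinned_sound hm (h.quotientMatrix_symm fun j => ((2 * j + 1 : ℕ) : ℤ))
    (fun i _ => h.quotientMatrix_diag _ i) (fun i hi => (h.quotient_even hd hi).1)
    (fun i hi => (h.quotient_even hd hi).2) H
  have hsgn : ∀ a ∈ labelSet (2 * m), ∀ j : ℕ, ((2 * j + 1 : ℕ) : ℤ) ∈ nb a →
      -((2 * j + 1 : ℕ) : ℤ) ∉ nb a := by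
    intro a ha j
    rw [mem_labelSet_two_mul] at ha
    obtain ⟨i, -, hi⟩ := ha
    exact hd _ _ (by omega) (by omega)
  let f : ℤ → Row := fun a => seg (fun j => signIn (nb a) ((2 * j + 1 : ℕ) : ℤ)) m
  let l : List ℤ := (List.range m).map (fun i => ((2 * i + 1 : ℕ) : ℤ)) ++
    (List.range m).map fun i => -((2 * i + 1 : ℕ) : ℤ)
  have hl : ∀ a, a ∈ l ↔ a ∈ labelSet (2 * m) := by
    intro a
    rw [mem_labelSet_two_mul]
    simp only [l, List.mem_append, List.mem_map, List.mem_range]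
    constructor
    · rintro (⟨i, hi, rfl⟩ | ⟨i, hi, rfl⟩)
      · exact ⟨i, hi, Or.inl rfl⟩
      · exact ⟨i, hi, Or.inr rfl⟩
    · rintro ⟨i, hi, rfl | rfl⟩
      · exact Or.inl ⟨i, hi, rfl⟩
      · exact Or.inr ⟨i, hi, rfl⟩
  have hnd : l.Nodup := by
    refine List.Nodup.append (List.nodup_range.map fun i j hij => ?_)
      (List.nodup_range.map fun i j hij => ?_) ?_
    · simpa using hij
    · simpa using hij
    · intro x hx hy
      obtain ⟨i, -, rfl⟩ := List.mem_map.mp hx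
      obtain ⟨j, -, hj⟩ := List.mem_map.mp hy
      omega
  have hmap : l.map f =
      (List.range m).map
        (fun i => seg (quotientMatrix nb (fun j => ((2 * j + 1 : ℕ) : ℤ)) i) m) ++
      (List.range m).map
        fun i => seg (fun j => -quotientMatrix nb (fun j => ((2 * j + 1 : ℕ) : ℤ)) i j) m := by
    rw [List.map_append, List.map_map, List.map_map]
    congr 1
    refine List.map_congr_left fun i hi => ?_
    refine congrArg (seg · m) (funext fun j => ?_)
    refine signIn_neg (fun x => ?_) (hsgn _ (mem_labelSet_even (List.mem_range.mp hi)) j)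
    rw [← h.neg_iff, neg_neg]
  rw [← hmap] at h1
  obtain ⟨τ, hτ⟩ := pairUp_sound f m hnd h1
  refine ⟨τ, fun a ha => ?_⟩
  obtain ⟨h2, h3, h4, h5⟩ := hτ a ((hl a).mpr ha)
  have h2' := (hl _).mp h2
  refine ⟨h2', h3, h4, ?_⟩
  have h6 : ∀ j < m, (((2 * j + 1 : ℕ) : ℤ) ∈ nb (τ a) ↔ ((2 * j + 1 : ℕ) : ℤ) ∈ nb a) ∧
      (-((2 * j + 1 : ℕ) : ℤ) ∈ nb (τ a) ↔ -((2 * j + 1 : ℕ) : ℤ) ∈ nb a) := fun j hj =>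
    mem_iff_of_signIn_eq (hsgn _ h2' j) (hsgn _ ha j) (seg_inj h5 j hj)
  have h7 : ∀ b ∈ labelSet (2 * m), (b ∈ nb (τ a) ↔ b ∈ nb a) := by
    intro b hb
    obtain ⟨j, hj, rfl | rfl⟩ := mem_labelSet_two_mul.mp hb
    · exact (h6 j hj).1
    · exact (h6 j hj).2
  ext b
  exact ⟨fun hb => (h7 b (h.mem' hb)).mp hb, fun hb => (h7 b (h.mem' hb)).mpr hb⟩

/-! ### From labeled graphs to codes -/

theorem IsDistanceMagicLabeling.injective {V : Type*} [Fintype V] {G : SimpleGraph V} {l : V → ℤ}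
    (h : IsDistanceMagicLabeling G l) : Function.Injective l := fun _ _ e =>
  h.bijOn.injOn (Set.mem_univ _) (Set.mem_univ _) e

theorem IsDistanceMagicLabeling.exists_eq {V : Type*} [Fintype V] {G : SimpleGraph V} {l : V → ℤ}
    (h : IsDistanceMagicLabeling G l) {a : ℤ} (ha : a ∈ labelSet (Fintype.card V)) :
    ∃ v, l v = a := by
  obtain ⟨v, -, hv⟩ := h.bijOn.surjOn ha
  exact ⟨v, hv⟩

theorem IsDistanceMagicLabeling.mem {V : Type*} [Fintype V] {G : SimpleGraph V} {l : V → ℤ}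
    (h : IsDistanceMagicLabeling G l) (v : V) : l v ∈ labelSet (Fintype.card V) :=
  h.bijOn.mapsTo (Set.mem_univ v)

theorem neg_mem_labelSet {n : ℕ} {a : ℤ} (h : a ∈ labelSet n) : -a ∈ labelSet n := by
  obtain ⟨i, hi, rfl⟩ := h
  exact ⟨n - 1 - i, by omega, by omega⟩

open Classical in
/-- The neighborhoods of a labeled graph, transported to the labels. -/
noncomputable def labelCode {V : Type*} [Fintype V] (G : SimpleGraph V) (l : V → ℤ) (a : ℤ) :
    Finset ℤ :=
  ({v | ∃ u, l u = a ∧ G.Adj u v} : Finset V).image l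

section

variable {V : Type*} [Fintype V] {G : SimpleGraph V} {l : V → ℤ}

theorem mem_labelCode {a b : ℤ} : b ∈ labelCode G l a ↔ ∃ u v, l u = a ∧ l v = b ∧ G.Adj u v := by
  simp only [labelCode, Finset.mem_image, Finset.mem_filter, Finset.mem_univ, true_and]
  constructor
  · rintro ⟨v, ⟨u, h1, h2⟩, h3⟩
    exact ⟨u, v, h1, h3, h2⟩
  · rintro ⟨u, v, h1, h3, h2⟩
    exact ⟨v, ⟨u, h1, h2⟩, h3⟩

theorem mem_labelCode_iff (h : Function.Injective l) (u v : V) :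
    l v ∈ labelCode G l (l u) ↔ G.Adj u v := by
  rw [mem_labelCode]
  constructor
  · rintro ⟨u', v', h1, h2, h3⟩
    rwa [← h h1, ← h h2]
  · exact fun h => ⟨u, v, rfl, rfl, h⟩

open Classical in
theorem labelCode_eq (h : Function.Injective l) (u : V) :
    labelCode G l (l u) = (G.neighborFinset u).image l := by
  ext b
  simp only [mem_labelCode, Finset.mem_image, SimpleGraph.mem_neighborFinset]
  constructor
  · rintro ⟨u', v, h1, h2, h3⟩
    exact ⟨v, h h1 ▸ h3, h2⟩
  · rintro ⟨v, h1, h2⟩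
    exact ⟨u, v, rfl, h2, h1⟩

theorem isCode_labelCode (hG : IsTetravalent G) (h : IsDistanceMagicLabeling G l)
    (hs : IsSelfReverse G l) : IsCode (Fintype.card V) (labelCode G l) where
  mem := by
    intro a b hb
    obtain ⟨u, v, rfl, -, -⟩ := mem_labelCode.mp hb
    exact h.mem u
  symm := by
    intro a b hb
    obtain ⟨u, v, h1, h2, h3⟩ := mem_labelCode.mp hb
    exact mem_labelCode.mpr ⟨v, u, h2, h1, h3.symm⟩
  irrefl := by
    intro a ha
    obtain ⟨u, v, h1, h2, h3⟩ := mem_labelCode.mp ha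
    exact h3.ne (h.injective (h1.trans h2.symm))
  neg := by
    intro a b hb
    obtain ⟨u, v, rfl, rfl, h3⟩ := mem_labelCode.mp hb
    obtain ⟨u', hu⟩ := h.exists_eq (neg_mem_labelSet (h.mem u))
    obtain ⟨v', hv⟩ := h.exists_eq (neg_mem_labelSet (h.mem v))
    refine mem_labelCode.mpr ⟨u', v', hu, hv, (hs u v u' v' ?_ ?_).mp h3⟩
    · rw [IsPaired, hu, add_neg_cancel]
    · rw [IsPaired, hv, add_neg_cancel]
  card := by
    classical
    intro a ha
    obtain ⟨u, rfl⟩ := h.exists_eq ha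
    rw [labelCode_eq h.injective, Finset.card_image_of_injective _ h.injective,
      SimpleGraph.card_neighborFinset_eq_degree]
    convert hG u
  sum := by
    classical
    intro a ha
    obtain ⟨u, rfl⟩ := h.exists_eq ha
    rw [labelCode_eq h.injective, Finset.sum_image h.injective.injOn]
    convert h.sum_neighbors u

theorem isLinked_labelCode (hc : G.Connected) (h : IsDistanceMagicLabeling G l) :
    IsLinked (Fintype.card V) (labelCode G l) := by
  intro a ha b hb
  obtain ⟨u, rfl⟩ := h.exists_eq ha
  obtain ⟨v, rfl⟩ := h.exists_eq hb
  obtain ⟨w⟩ := hc.preconnected u v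
  clear ha hb
  induction w with
  | nil => exact .refl
  | cons hab _ ih => exact .head ((mem_labelCode_iff h.injective _ _).mpr hab) ih

theorem nonDegenerate_labelCode (h : IsDistanceMagicLabeling G l)
    (hd : ¬ IsDegenerateLabeling G l) : NonDegenerate (labelCode G l) := by
  intro a b ha hb h1 h2
  obtain ⟨u, v, rfl, rfl, h3⟩ := mem_labelCode.mp h1
  obtain ⟨u', hu⟩ := h.exists_eq (neg_mem_labelSet (h.mem u))
  obtain ⟨v', hv⟩ := h.exists_eq (neg_mem_labelSet (h.mem v))
  rw [← hv, mem_labelCode_iff h.injective] at h2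
  refine hd ⟨u, u', v, v', ?_, ?_, ?_, ?_, h3, h2⟩
  · rw [IsPaired, hu, add_neg_cancel]
  · rw [IsPaired, hv, add_neg_cancel]
  · rintro rfl; omega
  · rintro rfl; omega

/-- If the neighborhoods in a code coincide in pairs, then the graph is a wreath graph. -/
theorem isWreathGraph_of_twins (hG : IsTetravalent G) (hc : G.Connected)
    (h : IsDistanceMagicLabeling G l) (τ : ℤ → ℤ)
    (hτ : ∀ a ∈ labelSet (Fintype.card V), τ a ∈ labelSet (Fintype.card V) ∧ τ a ≠ a ∧ τ (τ a) = a ∧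
      labelCode G l (τ a) = labelCode G l a) : IsWreathGraph G := by
  have hex : ∀ v, ∃ w, l w = τ (l v) := fun v => h.exists_eq (hτ _ (h.mem v)).1
  choose σ hσ using hex
  have ht : IsTwinning G σ := by
    refine ⟨fun v => h.injective ?_, fun v hv => ?_, fun u v huv => ?_⟩
    · rw [hσ, hσ, (hτ _ (h.mem v)).2.2.1]
    · have := hσ v
      rw [hv] at this
      exact (hτ _ (h.mem v)).2.1 this.symm
    · rw [SimpleGraph.adj_comm, ← mem_labelCode_iff h.injective] at huv ⊢
      rwa [hσ, (hτ _ (h.mem v)).2.2.2]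
  exact ht.isWreathGraph hG hc

end

/-! ### Degenerate codes -/

/-- If `a` is adjacent to `b` and `-b`, then its other two neighbors are opposite as well, because
the labels of its neighbors sum to zero; they differ, so they are not zero. -/
theorem IsCode.degenerate_spread {n : ℕ} {nb : ℤ → Finset ℤ} (h : IsCode n nb) {a b : ℤ}
    (hb : b ≠ 0) (h1 : b ∈ nb a) (h2 : -b ∈ nb a) :
    0 ∉ nb a ∧ ∀ x ∈ nb a, -x ∈ nb a := by
  have hs : ({b, -b} : Finset ℤ) ⊆ nb a := by
    intro x hx
    rcases Finset.mem_insert.mp hx with rfl | hx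
    · exact h1
    · rwa [Finset.mem_singleton.mp hx]
  have hbb : b ≠ -b := by omega
  have hcard := Finset.card_sdiff_add_card_eq_card hs
  have hsum := Finset.sum_sdiff hs (f := fun x => x)
  rw [Finset.card_pair hbb, h.card (h.mem h1)] at hcard
  rw [Finset.sum_pair hbb, h.sum (h.mem h1)] at hsum
  obtain ⟨c, d, hcd, e⟩ := Finset.card_eq_two.mp (show (nb a \ {b, -b}).card = 2 by omega)
  rw [e, Finset.sum_pair hcd] at hsum
  have hmem : ∀ x, x ∈ nb a ↔ x = b ∨ x = -b ∨ x = c ∨ x = d := by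
    intro x
    rw [← Finset.sdiff_union_of_subset hs, e]
    simp only [Finset.mem_union, Finset.mem_insert, Finset.mem_singleton]
    tauto
  constructor
  · rw [hmem]; omega
  · intro x; rw [hmem, hmem]; omega

/-- If some label is adjacent to two opposite labels, then every neighborhood is closed under
negation, because this spreads along edges. -/
theorem IsCode.neg_mem_of_degenerate {n : ℕ} {nb : ℤ → Finset ℤ} (h : IsCode n nb)
    (hl : IsLinked n nb) (hd : ¬ NonDegenerate nb) :
    ∀ a ∈ labelSet n, a ≠ 0 ∧ ∀ x ∈ nb a, -x ∈ nb a := by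
  simp only [NonDegenerate, not_forall, not_not] at hd
  obtain ⟨a₀, b₀, ha₀, hb₀, h1, h2⟩ := hd
  intro a ha
  have key : a ≠ 0 ∧ 0 ∉ nb a ∧ ∀ x ∈ nb a, -x ∈ nb a := by
    have hp := hl a₀ (h.mem h1) a ha
    clear ha
    induction hp with
    | refl => exact ⟨ha₀, h.degenerate_spread hb₀ h1 h2⟩
    | tail _ hx ih =>
      obtain ⟨h3, h4, h5⟩ := ih
      refine ⟨fun e => h4 (e ▸ hx), h.degenerate_spread h3 (h.symm hx) ?_⟩
      rw [← h.neg_iff, neg_neg]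
      exact h.symm (h5 _ hx)
  exact ⟨key.1, key.2.2⟩

theorem IsCode.nonDegenerate_of_odd {k : ℕ} {nb : ℤ → Finset ℤ} (h : IsCode (2 * k + 1) nb)
    (hl : IsLinked (2 * k + 1) nb) : NonDegenerate nb := by
  by_contra hd
  exact (h.neg_mem_of_degenerate hl hd 0 ⟨k, by omega, by push_cast; ring⟩).1 rfl

theorem IsCode.neg_twins {n : ℕ} {nb : ℤ → Finset ℤ} (h : IsCode n nb)
    (hl : IsLinked n nb) (hd : ¬ NonDegenerate nb) :
    ∀ a ∈ labelSet n, -a ∈ labelSet n ∧ -a ≠ a ∧ - -a = a ∧ nb (-a) = nb a := by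
  intro a ha
  obtain ⟨h0, h1⟩ := h.neg_mem_of_degenerate hl hd a ha
  refine ⟨neg_mem_labelSet ha, by omega, neg_neg a, ?_⟩
  ext x
  rw [← h.neg_iff, neg_neg]
  exact ⟨fun hx => by simpa using h1 _ hx, h1 x⟩

/-! ### From codes to labeled graphs -/

/-- The graph of a code, on the vertices `0, …, n - 1` with the labels `1 - n + 2 * i`. -/
def codeGraph {n : ℕ} {nb : ℤ → Finset ℤ} (h : IsCode n nb) : SimpleGraph (Fin n) where
  Adj u v := 1 - (n : ℤ) + 2 * (v : ℕ) ∈ nb (1 - (n : ℤ) + 2 * (u : ℕ))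
  symm := ⟨fun _ _ => h.symm⟩
  loopless := ⟨fun _ => h.irrefl _⟩

/-- The label `1 - n + 2 * i` of the vertex `i`. -/
def stdLabel (n : ℕ) (u : Fin n) : ℤ := 1 - (n : ℤ) + 2 * (u : ℕ)

section

variable {n : ℕ} {nb : ℤ → Finset ℤ}

theorem IsCode.adj_iff (h : IsCode n nb) (u v : Fin n) :
    (codeGraph h).Adj u v ↔ stdLabel n v ∈ nb (stdLabel n u) := Iff.rfl

theorem stdLabel_mem (u : Fin n) : stdLabel n u ∈ labelSet n := ⟨u, u.2, rfl⟩

theorem stdLabel_injective (n : ℕ) : Function.Injective (stdLabel n) := by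
  intro u v e
  unfold stdLabel at e
  exact Fin.ext (by omega)

theorem exists_stdLabel {a : ℤ} (ha : a ∈ labelSet n) : ∃ u, stdLabel n u = a := by
  obtain ⟨i, hi, rfl⟩ := ha
  exact ⟨⟨i, hi⟩, rfl⟩

open Classical in
theorem IsCode.image_neighborFinset (h : IsCode n nb) (u : Fin n) :
    ((codeGraph h).neighborFinset u).image (stdLabel n) = nb (stdLabel n u) := by
  ext b
  simp only [Finset.mem_image, SimpleGraph.mem_neighborFinset, h.adj_iff]
  constructor
  · rintro ⟨v, hv, rfl⟩
    exact hv
  · intro hb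
    obtain ⟨v, rfl⟩ := exists_stdLabel (h.mem' hb)
    exact ⟨v, hb, rfl⟩

theorem IsCode.isTetravalent (h : IsCode n nb) : IsTetravalent (codeGraph h) := by
  intro u
  classical
  have h1 := h.card (stdLabel_mem u)
  rw [← h.image_neighborFinset, Finset.card_image_of_injective _ (stdLabel_injective n),
    SimpleGraph.card_neighborFinset_eq_degree] at h1
  convert h1

theorem IsCode.isDistanceMagicLabeling (h : IsCode n nb) :
    IsDistanceMagicLabeling (codeGraph h) (stdLabel n) where
  bijOn := by
    rw [Fintype.card_fin]
    refine ⟨fun u _ => stdLabel_mem u, (stdLabel_injective n).injOn, fun a ha => ?_⟩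
    obtain ⟨u, hu⟩ := exists_stdLabel ha
    exact ⟨u, Set.mem_univ _, hu⟩
  sum_neighbors := by
    intro u
    classical
    have h1 := h.sum (stdLabel_mem u)
    rw [← h.image_neighborFinset, Finset.sum_image (stdLabel_injective n).injOn] at h1
    convert h1

theorem IsCode.isSelfReverse (h : IsCode n nb) : IsSelfReverse (codeGraph h) (stdLabel n) := by
  intro u v u' v' hu hv
  unfold IsPaired at hu hv
  rw [h.adj_iff, h.adj_iff, show stdLabel n u' = -stdLabel n u by omega,
    show stdLabel n v' = -stdLabel n v by omega, h.neg_iff]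

theorem IsCode.connected (h : IsCode n nb) (hn : 0 < n) (hl : IsLinked n nb) :
    (codeGraph h).Connected := by
  have : Nonempty (Fin n) := ⟨⟨0, hn⟩⟩
  refine ⟨fun u v => ?_⟩
  have hp := hl _ (stdLabel_mem u) _ (stdLabel_mem v)
  obtain ⟨b, hb⟩ : ∃ b, b = stdLabel n v := ⟨_, rfl⟩
  rw [← hb] at hp
  induction hp generalizing v with
  | refl => rw [stdLabel_injective n hb]
  | tail _ hx ih =>
    obtain ⟨w, hw⟩ := exists_stdLabel (h.mem hx)
    refine (ih w hw.symm).trans (SimpleGraph.Adj.reachable ?_)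
    rwa [h.adj_iff, hw, ← hb]

theorem IsCode.not_isDegenerateLabeling (h : IsCode n nb) (hd : NonDegenerate nb) :
    ¬ IsDegenerateLabeling (codeGraph h) (stdLabel n) := by
  rintro ⟨u, u', v, v', hu, hv, hu', hv', h1, h2⟩
  unfold IsPaired at hu hv
  rw [h.adj_iff] at h1 h2
  have h3 : stdLabel n u ≠ stdLabel n u' := fun e => hu' (stdLabel_injective n e)
  have h4 : stdLabel n v ≠ stdLabel n v' := fun e => hv' (stdLabel_injective n e)
  refine hd _ _ ?_ ?_ h1 ?_
  · omega
  · omega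
  · rwa [show -stdLabel n v = stdLabel n v' by omega]

/-- A label that shares its neighborhood with no other label prevents a wreath graph. -/
theorem IsCode.not_isWreathGraph (h : IsCode n nb) {z : ℤ} (hz : z ∈ labelSet n)
    (hz' : ∀ w ∈ labelSet n, nb w = nb z → w = z) : ¬ IsWreathGraph (codeGraph h) := by
  intro hw
  obtain ⟨u, rfl⟩ := exists_stdLabel hz
  obtain ⟨v, hvu, hv⟩ := hw.exists_twin u
  refine hvu (stdLabel_injective n (hz' _ (stdLabel_mem v) ?_))
  ext b
  constructor
  · intro hb
    obtain ⟨x, rfl⟩ := exists_stdLabel (h.mem' hb)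
    exact (hv x).mpr hb
  · intro hb
    obtain ⟨x, rfl⟩ := exists_stdLabel (h.mem' hb)
    exact (hv x).mp hb

end

/-! ### Lengthening a code by eight labels -/

theorem mem_labelSet_iff {n : ℕ} {a : ℤ} :
    a ∈ labelSet n ↔ -(n : ℤ) < a ∧ a < n ∧ (a + n) % 2 = 1 := by
  constructor
  · rintro ⟨i, hi, rfl⟩
    omega
  · rintro ⟨h1, h2, h3⟩
    exact ⟨((a + n - 1) / 2).toNat, by omega, by omega⟩

/-- A nondegenerate connected code with a label `z` without twins and with a special pair `X`, `Y`
of labels of sum `2`, both adjacent to both of `-X`, `-Y`. -/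
structure IsGluable (n : ℕ) (nb : ℤ → Finset ℤ) (X Y z : ℤ) : Prop extends IsCode n nb where
  nonDegenerate : NonDegenerate nb
  linked : IsLinked n nb
  add_eq : X + Y = 2
  ne : X ≠ Y
  mem_X : X ∈ labelSet n
  mem_Y : Y ∈ labelSet n
  adj_XX : -X ∈ nb X
  adj_XY : -Y ∈ nb X
  adj_YY : -Y ∈ nb Y
  mem_z : z ∈ labelSet n
  z_ne_X : z ≠ X
  z_ne_Y : z ≠ Y
  z_ne_neg_X : z ≠ -X
  z_ne_neg_Y : z ≠ -Y
  twinless : ∀ w ∈ labelSet n, nb w = nb z → w = z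

namespace Glue

/-- The block of `p` and `q` contains `x`. -/
abbrev Blk (p q x : ℤ) : Prop := x = p ∨ x = q

/-- The neighbors that `a` loses. -/
def cut (X Y a : ℤ) : Finset ℤ :=
  if Blk X Y a then {-X, -Y} else if Blk X Y (-a) then {X, Y} else ∅

/-- The neighbors that `a` gains. -/
def extra (X Y U W P Q a : ℤ) : Finset ℤ :=
  if Blk X Y a then {-U, -W} else if Blk X Y (-a) then {U, W}
  else if Blk U W a then {-X, -Y, P, Q} else if Blk U W (-a) then {X, Y, -P, -Q}
  else if Blk P Q a then {U, W, -P, -Q} else if Blk P Q (-a) then {-U, -W, P, Q} else ∅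

/-- The new edges, up to reversal and negation. -/
def Half (X Y U W P Q a b : ℤ) : Prop :=
  (Blk X Y a ∧ Blk U W (-b)) ∨ (Blk U W a ∧ Blk P Q b) ∨ (Blk P Q a ∧ Blk P Q (-b))

theorem mem_cut {X Y a b : ℤ} (h : X + Y = 2) (hX : X ≠ 0) (hY : Y ≠ 0) : b ∈ cut X Y a ↔
    (Blk X Y a ∧ Blk X Y (-b)) ∨ (Blk X Y (-a) ∧ Blk X Y b) := by
  have h1 : ¬ (Blk X Y a ∧ Blk X Y (-a)) := by omega
  have h2 : (b = -X ∨ b = -Y) ↔ Blk X Y (-b) := by omega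
  unfold cut
  split_ifs <;> simp only [Finset.mem_insert, Finset.mem_singleton, Finset.notMem_empty, h2] <;>
    tauto

theorem mem_extra {X Y U W P Q N a b : ℤ} (h : X + Y = 2) (hX : X ≠ 0) (hY : Y ≠ 0)
    (hU : U = N + 2) (hW : W = -N) (hP : P = N + 6) (hQ : Q = -(N + 4))
    (hX2 : X < N) (hY2 : Y < N) :
    b ∈ extra X Y U W P Q a ↔ Half X Y U W P Q a b ∨ Half X Y U W P Q b a ∨
      Half X Y U W P Q (-a) (-b) ∨ Half X Y U W P Q (-b) (-a) := by
  have h1 : ∀ p q, (b = -p ∨ b = -q) ↔ Blk p q (-b) := by omega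
  have h2 : ∀ p q, (b = p ∨ b = q) ↔ Blk p q b := fun _ _ => Iff.rfl
  have e1 : ¬ (Blk X Y a ∧ Blk X Y (-a)) := by omega
  have e2 : ¬ (Blk U W a ∧ Blk U W (-a)) := by omega
  have e3 : ¬ (Blk P Q a ∧ Blk P Q (-a)) := by omega
  have e4 : Blk X Y a → ¬ Blk U W a ∧ ¬ Blk U W (-a) ∧ ¬ Blk P Q a ∧ ¬ Blk P Q (-a) := by omega
  have e5 : Blk X Y (-a) → ¬ Blk U W a ∧ ¬ Blk U W (-a) ∧ ¬ Blk P Q a ∧ ¬ Blk P Q (-a) := by omega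
  have e6 : Blk U W a → ¬ Blk P Q a ∧ ¬ Blk P Q (-a) := by omega
  have e7 : Blk U W (-a) → ¬ Blk P Q a ∧ ¬ Blk P Q (-a) := by omega
  unfold extra Half
  simp only [neg_neg]
  split_ifs <;> simp only [Finset.mem_insert, Finset.mem_singleton, Finset.notMem_empty] <;>
    rw [← h1, ← h1, ← h1] <;> unfold Blk at * <;> grind

/-- The code of order `n + 8` obtained from a code of order `n` by replacing the edges between the
special pair and its negative by a chain of four new pairs, with complete bipartite graphs between
consecutive pairs: `{X, Y}`, `{-U, -W}`, `{-P, -Q}`, `{P, Q}`, `{U, W}`, `{-X, -Y}`, for the labels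
`U = n + 3`, `W = -(n + 1)`, `P = n + 7`, `Q = -(n + 5)`. As `X + Y`, `U + W`, `P + Q` are all `2`,
the sums over the neighborhoods do not change or are zero. -/
def glue (n : ℕ) (nb : ℤ → Finset ℤ) (X Y a : ℤ) : Finset ℤ :=
  nb a \ cut X Y a ∪ extra X Y (n + 3) (-(n + 1)) (n + 7) (-(n + 5)) a

/-- Replacing two elements of a set of integers by two others. -/
theorem card_sum_swap {N : Finset ℤ} {p q r s : ℤ} (hpq : p ≠ q) (hp : p ∈ N) (hq : q ∈ N)
    (hrs : r ≠ s) (hr : r ∉ N) (hs : s ∉ N) :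
    (N \ {p, q} ∪ {r, s}).card = N.card ∧
      ∑ x ∈ N \ {p, q} ∪ {r, s}, x + (p + q) = ∑ x ∈ N, x + (r + s) := by
  have hsub : ({p, q} : Finset ℤ) ⊆ N := by
    intro x hx
    rcases Finset.mem_insert.mp hx with rfl | hx
    · exact hp
    · rwa [Finset.mem_singleton.mp hx]
  have hdisj : Disjoint (N \ {p, q}) {r, s} := by
    rw [Finset.disjoint_left]
    intro x hx hx'
    have := (Finset.mem_sdiff.mp hx).1
    rcases Finset.mem_insert.mp hx' with rfl | hx'
    · exact hr this
    · rw [Finset.mem_singleton.mp hx'] at this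
      exact hs this
  have h1 := Finset.card_sdiff_add_card_eq_card hsub
  have h2 := Finset.sum_sdiff hsub (f := fun x => x)
  rw [Finset.card_pair hpq] at h1
  rw [Finset.sum_pair hpq] at h2
  rw [Finset.card_union_of_disjoint hdisj, Finset.sum_union hdisj, Finset.card_pair hrs,
    Finset.sum_pair hrs]
  omega

theorem card_sum_four {p q r s : ℤ} (h1 : p ≠ q) (h2 : p ≠ r) (h3 : p ≠ s) (h4 : q ≠ r) (h5 : q ≠ s)
    (h6 : r ≠ s) : ({p, q, r, s} : Finset ℤ).card = 4 ∧
      ∑ x ∈ ({p, q, r, s} : Finset ℤ), x = p + q + r + s := by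
  rw [Finset.card_insert_of_notMem, Finset.card_insert_of_notMem, Finset.card_pair h6,
    Finset.sum_insert, Finset.sum_insert, Finset.sum_pair h6]
  · refine ⟨rfl, by ring⟩
  all_goals simp only [Finset.mem_insert, Finset.mem_singleton]; tauto

end Glue

open Glue

namespace IsGluable

variable {n : ℕ} {nb : ℤ → Finset ℤ} {X Y z : ℤ}

theorem ne_zero (h : IsGluable n nb X Y z) : X ≠ 0 ∧ Y ≠ 0 := by
  constructor
  · rintro rfl
    exact h.irrefl _ (by simpa using h.adj_XX)
  · rintro rfl
    exact h.irrefl _ (by simpa using h.adj_YY)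

/-- Adjacency in the longer code. -/
theorem mem_glue (h : IsGluable n nb X Y z) {a b : ℤ} : b ∈ glue n nb X Y a ↔
    (b ∈ nb a ∧ ¬((Blk X Y a ∧ Blk X Y (-b)) ∨ (Blk X Y (-a) ∧ Blk X Y b))) ∨
      (Half X Y (n + 3) (-(n + 1)) (n + 7) (-(n + 5)) a b ∨
        Half X Y (n + 3) (-(n + 1)) (n + 7) (-(n + 5)) b a ∨
        Half X Y (n + 3) (-(n + 1)) (n + 7) (-(n + 5)) (-a) (-b) ∨
        Half X Y (n + 3) (-(n + 1)) (n + 7) (-(n + 5)) (-b) (-a)) := by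
  obtain ⟨h1, h2⟩ := h.ne_zero
  obtain ⟨-, h4, -⟩ := mem_labelSet_iff.mp h.mem_X
  obtain ⟨-, h6, -⟩ := mem_labelSet_iff.mp h.mem_Y
  rw [glue, Finset.mem_union, Finset.mem_sdiff, mem_cut h.add_eq h1 h2,
    mem_extra (N := (n : ℤ) + 1) h.add_eq h1 h2 (by ring) rfl (by ring) (by ring) (by omega)
      (by omega)]

/-- The endpoints of a new edge are labels, and one of them is new. -/
theorem half_bounds (h : IsGluable n nb X Y z) {a b : ℤ}
    (H : Half X Y (n + 3) (-(n + 1)) (n + 7) (-(n + 5)) a b) :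
    a ∈ labelSet (n + 8) ∧ b ∈ labelSet (n + 8) ∧ a ≠ b ∧ (b < -(n : ℤ) ∨ (n : ℤ) < b) := by
  have h1 := mem_labelSet_iff.mp h.mem_X
  have h2 := mem_labelSet_iff.mp h.mem_Y
  rw [mem_labelSet_iff, mem_labelSet_iff]
  unfold Half Blk at H
  push_cast
  omega

theorem mem_succ {a : ℤ} (h : a ∈ labelSet n) : a ∈ labelSet (n + 8) := by
  rw [mem_labelSet_iff] at h ⊢
  push_cast
  omega

theorem eq_new {a : ℤ} (h : a ∈ labelSet (n + 8)) (h' : a ∉ labelSet n) :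
    (Blk (n + 3) (-(n + 1)) a ∨ Blk (n + 3) (-(n + 1)) (-a)) ∨
      Blk (n + 7) (-(n + 5)) a ∨ Blk (n + 7) (-(n + 5)) (-a) := by
  rw [mem_labelSet_iff] at h h'
  push_cast at h
  unfold Blk
  omega

theorem adj_special (h : IsGluable n nb X Y z) {a b : ℤ} (ha : Blk X Y a) (hb : Blk X Y (-b)) :
    b ∈ nb a := by
  have h1 : X ∈ nb (-Y) := h.symm h.adj_XY
  have h2 : -X ∈ nb Y := by simpa using h.neg h1
  have e : ∀ {x : ℤ}, -b = x → b = -x := fun e => by omega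
  obtain rfl | rfl := ha <;> obtain hb | hb := hb <;> rw [e hb]
  exacts [h.adj_XX, h.adj_XY, h2, h.adj_YY]

theorem card_sum_glue (h : IsGluable n nb X Y z) {a : ℤ} (ha : a ∈ labelSet (n + 8)) :
    (glue n nb X Y a).card = 4 ∧ ∑ b ∈ glue n nb X Y a, b = 0 := by
  have h1 := mem_labelSet_iff.mp h.mem_X
  have h2 := mem_labelSet_iff.mp h.mem_Y
  have h3 := h.add_eq
  have h4 := h.ne
  obtain ⟨h5, h6⟩ := h.ne_zero
  by_cases hn : a ∈ labelSet n
  · have hb := mem_labelSet_iff.mp hn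
    have hnot : ∀ b, ((n : ℤ) < b ∨ b < -(n : ℤ)) → b ∉ nb a := by
      intro b hb hb'
      have := mem_labelSet_iff.mp (h.mem' hb')
      omega
    have e1 := h.card hn
    have e2 := h.sum hn
    by_cases c1 : Blk X Y a
    · have e3 := card_sum_swap (N := nb a) (p := -X) (q := -Y) (r := -((n : ℤ) + 3))
          (s := - -((n : ℤ) + 1))
        (by omega) (h.adj_special c1 (Or.inl (neg_neg X)))
        (h.adj_special c1 (Or.inr (neg_neg Y))) (by omega)
        (hnot _ (by omega)) (hnot _ (by omega))
      rw [glue, cut, extra, if_pos c1, if_pos c1]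
      omega
    by_cases c2 : Blk X Y (-a)
    · have e3 := card_sum_swap (N := nb a) (p := X) (q := Y) (r := (n : ℤ) + 3)
          (s := -((n : ℤ) + 1))
        (by omega) (h.symm (h.adj_special (Or.inl rfl) c2)) (h.symm (h.adj_special (Or.inr rfl) c2))
          (by omega)
        (hnot _ (by omega)) (hnot _ (by omega))
      rw [glue, cut, extra, if_neg c1, if_neg c1, if_pos c2, if_pos c2]
      omega
    rw [glue, cut, extra, if_neg c1, if_neg c1, if_neg c2, if_neg c2, if_neg, if_neg, if_neg,
        if_neg]
    · rw [Finset.sdiff_empty, Finset.union_empty]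
      exact ⟨e1, e2⟩
    all_goals unfold Blk; omega
  · have e0 : nb a = ∅ := Finset.eq_empty_of_forall_notMem fun b hb => hn (h.mem hb)
    have e1 : ¬ Blk X Y a := by rintro (rfl | rfl); exacts [hn h.mem_X, hn h.mem_Y]
    have e2 : ¬ Blk X Y (-a) := by
      rintro (e | e)
      · exact hn (by simpa [← e] using neg_mem_labelSet h.mem_X)
      · exact hn (by simpa [← e] using neg_mem_labelSet h.mem_Y)
    rw [glue, e0, Finset.empty_sdiff, Finset.empty_union, extra, if_neg e1, if_neg e2]
    have e3 := eq_new ha hn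
    split_ifs
    · have := card_sum_four (p := -X) (q := -Y) (r := (n : ℤ) + 7) (s := -((n : ℤ) + 5))
      omega
    · have := card_sum_four (p := X) (q := Y) (r := -((n : ℤ) + 7)) (s := - -((n : ℤ) + 5))
      omega
    · have := card_sum_four (p := (n : ℤ) + 3) (q := -((n : ℤ) + 1)) (r := -((n : ℤ) + 7))
          (s := - -((n : ℤ) + 5))
      omega
    · have := card_sum_four (p := -((n : ℤ) + 3)) (q := - -((n : ℤ) + 1)) (r := (n : ℤ) + 7)
          (s := -((n : ℤ) + 5))
      omega
    · tauto

theorem isCode_glue (h : IsGluable n nb X Y z) : IsCode (n + 8) (glue n nb X Y) where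
  mem := by
    intro a b hb
    rcases h.mem_glue.mp hb with ⟨hb, -⟩ | hb | hb | hb | hb
    · exact mem_succ (h.mem hb)
    · exact (h.half_bounds hb).1
    · exact (h.half_bounds hb).2.1
    · simpa using neg_mem_labelSet (h.half_bounds hb).1
    · simpa using neg_mem_labelSet (h.half_bounds hb).2.1
  symm := by
    intro a b hb
    rw [h.mem_glue] at hb ⊢
    rw [h.toIsCode.symm_iff]
    tauto
  irrefl := by
    intro a ha
    rcases h.mem_glue.mp ha with ⟨hb, -⟩ | hb | hb | hb | hb
    · exact h.irrefl a hb
    all_goals exact (h.half_bounds hb).2.2.1 rfl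
  neg := by
    intro a b hb
    rw [h.mem_glue] at hb ⊢
    rw [h.toIsCode.neg_iff, neg_neg, neg_neg]
    tauto
  card := fun ha => (h.card_sum_glue ha).1
  sum := fun ha => (h.card_sum_glue ha).2

theorem nonDegenerate_glue (h : IsGluable n nb X Y z) : NonDegenerate (glue n nb X Y) := by
  intro a b ha hb h1 h2
  have h3 := mem_labelSet_iff.mp h.mem_X
  have h4 := mem_labelSet_iff.mp h.mem_Y
  have h5 := h.add_eq
  have hold : ∀ x, x ∈ nb a → -(n : ℤ) < x ∧ x < n ∧ -(n : ℤ) < a ∧ a < n := by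
    intro x hx
    have := mem_labelSet_iff.mp (h.mem hx)
    have := mem_labelSet_iff.mp (h.mem' hx)
    omega
  rw [h.mem_glue] at h1 h2
  rcases h1 with ⟨h1, -⟩ | h1
  · rcases h2 with ⟨h2, -⟩ | h2
    · exact h.nonDegenerate a b ha hb h1 h2
    · have := hold _ h1
      unfold Half Blk at h2
      omega
  · rcases h2 with ⟨h2, -⟩ | h2
    · have := hold _ h2
      unfold Half Blk at h1
      omega
    · unfold Half Blk at h1 h2
      omega

theorem linked_glue (h : IsGluable n nb X Y z) : IsLinked (n + 8) (glue n nb X Y) := by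
  have : Std.Symm fun x y => y ∈ glue n nb X Y x := ⟨fun _ _ => h.isCode_glue.symm⟩
  have hsymm : ∀ {a b}, Relation.ReflTransGen (fun x y => y ∈ glue n nb X Y x) a b →
      Relation.ReflTransGen (fun x y => y ∈ glue n nb X Y x) b a := fun hab => symm hab
  obtain ⟨R, hR⟩ : ∃ R : ℤ → Prop, ∀ a, R a ↔
    Relation.ReflTransGen (fun x y => y ∈ glue n nb X Y x) X a := ⟨_, fun _ => Iff.rfl⟩
  have hstep : ∀ {a b}, R a → b ∈ glue n nb X Y a → R b := by
    intro a b ha hb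
    rw [hR] at ha ⊢
    exact ha.tail hb
  have hX : R X := (hR X).mpr .refl
  have hnew : ∀ {a b}, R a → (Half X Y (n + 3) (-(n + 1)) (n + 7) (-(n + 5)) a b ∨
        Half X Y (n + 3) (-(n + 1)) (n + 7) (-(n + 5)) b a ∨
        Half X Y (n + 3) (-(n + 1)) (n + 7) (-(n + 5)) (-a) (-b) ∨
        Half X Y (n + 3) (-(n + 1)) (n + 7) (-(n + 5)) (-b) (-a)) → R b :=
    fun ha hab => hstep ha (h.mem_glue.mpr (Or.inr hab))
  -- the chain of new blocks leads from `X` to all new labels and to `Y`, `-X`, `-Y`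
  have h1 : ∀ a, Blk (n + 3) (-(n + 1)) (-a) → R a := fun a ha =>
    hnew hX (Or.inl (Or.inl ⟨Or.inl rfl, ha⟩))
  have h2 : ∀ a, Blk X Y a → R a := fun a ha =>
    hnew (h1 (-(n + 3)) (Or.inl (neg_neg _))) (Or.inr (Or.inl (Or.inl ⟨ha, Or.inl (neg_neg _)⟩)))
  have h3 : ∀ a, Blk (n + 7) (-(n + 5)) (-a) → R a := fun a ha =>
    hnew (h1 (-(n + 3)) (Or.inl (neg_neg _)))
      (Or.inr (Or.inr (Or.inl (Or.inr (Or.inl ⟨Or.inl (neg_neg _), ha⟩)))))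
  have h4 : ∀ a, Blk (n + 7) (-(n + 5)) a → R a := fun a ha =>
    hnew (h3 (-(n + 7)) (Or.inl (neg_neg _)))
      (Or.inr (Or.inl (Or.inr (Or.inr ⟨ha, Or.inl (neg_neg _)⟩))))
  have h5 : ∀ a, Blk (n + 3) (-(n + 1)) a → R a := fun a ha =>
    hnew (h4 (n + 7) (Or.inl rfl)) (Or.inr (Or.inl (Or.inr (Or.inl ⟨ha, Or.inl rfl⟩))))
  have h6 : ∀ a, Blk X Y (-a) → R a := fun a ha =>
    hnew (h5 (n + 3) (Or.inl rfl)) (Or.inr (Or.inr (Or.inr (Or.inl ⟨ha, Or.inl (neg_neg _)⟩))))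
  have hall : ∀ a ∈ labelSet (n + 8), R a := by
    intro a ha
    by_cases hn : a ∈ labelSet n
    · have hp := h.linked X h.mem_X a hn
      clear ha hn
      induction hp with
      | refl => exact hX
      | @tail b c _ hbc ih =>
        by_cases hcut : (Blk X Y b ∧ Blk X Y (-c)) ∨ (Blk X Y (-b) ∧ Blk X Y c)
        · rcases hcut with hcut | hcut
          · exact h6 c hcut.2
          · exact h2 c hcut.2
        · exact hstep ih (h.mem_glue.mpr (Or.inl ⟨hbc, hcut⟩))
    · rcases eq_new ha hn with (hw | hw) | hw | hw
      · exact h5 a hw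
      · exact h1 a hw
      · exact h4 a hw
      · exact h3 a hw
  intro a ha b hb
  exact (hsymm ((hR a).mp (hall a ha))).trans ((hR b).mp (hall b hb))

theorem twinless_glue (h : IsGluable n nb X Y z) :
    ∀ w ∈ labelSet (n + 8), glue n nb X Y w = glue n nb X Y z → w = z := by
  have hz := mem_labelSet_iff.mp h.mem_z
  have hz0 : ¬ Blk X Y z ∧ ¬ Blk X Y (-z) := by
    have := h.z_ne_X
    have := h.z_ne_Y
    have := h.z_ne_neg_X
    have := h.z_ne_neg_Y
    unfold Blk
    omega
  -- unlike the neighborhood of `z`, those of the special and of the new labels contain new labels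
  have hfar : ∀ x ∈ glue n nb X Y z, x ∈ labelSet n := by
    intro x hx
    rcases h.mem_glue.mp hx with ⟨hx, -⟩ | hx
    · exact h.mem' hx
    · unfold Half at hx
      exfalso
      rcases hx with hx | hx | hx | hx <;> unfold Blk at * <;> omega
  have hnone : ∀ w x, glue n nb X Y w = glue n nb X Y z → ((n : ℤ) < x ∨ x < -n) →
      ¬ (Half X Y (n + 3) (-(n + 1)) (n + 7) (-(n + 5)) w x ∨
        Half X Y (n + 3) (-(n + 1)) (n + 7) (-(n + 5)) x w ∨
        Half X Y (n + 3) (-(n + 1)) (n + 7) (-(n + 5)) (-w) (-x) ∨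
        Half X Y (n + 3) (-(n + 1)) (n + 7) (-(n + 5)) (-x) (-w)) := by
    intro w x hw hx hadj
    have h1 := hfar x (hw ▸ h.mem_glue.mpr (Or.inr hadj))
    rw [mem_labelSet_iff] at h1
    omega
  have hsame : ∀ w ∈ labelSet n, ¬ Blk X Y w → ¬ Blk X Y (-w) → glue n nb X Y w = nb w := by
    intro w hw h1 h2
    rw [mem_labelSet_iff] at hw
    rw [glue, cut, extra, if_neg h1, if_neg h1, if_neg h2, if_neg h2, if_neg, if_neg, if_neg,
      if_neg, Finset.sdiff_empty, Finset.union_empty]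
    all_goals unfold Blk; omega
  intro w hw he
  by_cases hn : w ∈ labelSet n
  · by_cases h1 : Blk X Y w
    · exact absurd (Or.inl (Or.inl ⟨h1, Or.inl (neg_neg _)⟩)) (hnone w (-(n + 3)) he (by omega))
    · by_cases h2 : Blk X Y (-w)
      · exact absurd (Or.inr (Or.inr (Or.inl (Or.inl ⟨h2, Or.inl (neg_neg _)⟩))))
          (hnone w (n + 3) he (by omega))
      · rw [hsame w hn h1 h2, hsame z h.mem_z hz0.1 hz0.2] at he
        exact h.twinless w hn he
  · exfalso
    rcases eq_new hw hn with (hw | hw) | hw | hw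
    · exact hnone w (n + 7) he (by omega) (Or.inl (Or.inr (Or.inl ⟨hw, Or.inl rfl⟩)))
    · exact hnone w (-(n + 7)) he (by omega)
        (Or.inr (Or.inr (Or.inl (Or.inr (Or.inl ⟨hw, Or.inl (neg_neg _)⟩)))))
    · exact hnone w (n + 3) he (by omega) (Or.inr (Or.inl (Or.inr (Or.inl ⟨Or.inl rfl, hw⟩))))
    · exact hnone w (-(n + 3)) he (by omega)
        (Or.inr (Or.inr (Or.inr (Or.inr (Or.inl ⟨Or.inl (neg_neg _), hw⟩)))))

/-- The longer code can be lengthened again, with the special pair `P`, `Q`. -/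
theorem step (h : IsGluable n nb X Y z) :
    IsGluable (n + 8) (glue n nb X Y) (n + 7) (-(n + 5)) z where
  toIsCode := h.isCode_glue
  nonDegenerate := h.nonDegenerate_glue
  linked := h.linked_glue
  add_eq := by ring
  ne := by omega
  mem_X := mem_labelSet_iff.mpr (by omega)
  mem_Y := mem_labelSet_iff.mpr (by omega)
  adj_XX := h.mem_glue.mpr (Or.inr (Or.inl (Or.inr (Or.inr ⟨Or.inl rfl, Or.inl (neg_neg _)⟩))))
  adj_XY := h.mem_glue.mpr (Or.inr (Or.inl (Or.inr (Or.inr ⟨Or.inl rfl, Or.inr (neg_neg _)⟩))))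
  adj_YY := h.mem_glue.mpr (Or.inr (Or.inl (Or.inr (Or.inr ⟨Or.inr rfl, Or.inr (neg_neg _)⟩))))
  mem_z := mem_succ h.mem_z
  z_ne_X := by have := mem_labelSet_iff.mp h.mem_z; omega
  z_ne_Y := by have := mem_labelSet_iff.mp h.mem_z; omega
  z_ne_neg_X := by have := mem_labelSet_iff.mp h.mem_z; omega
  z_ne_neg_Y := by have := mem_labelSet_iff.mp h.mem_z; omega
  twinless := h.twinless_glue

end IsGluable

/-! ### Tables of codes -/

/-- The label `a` of order `n` has the neighbors listed in the `⌊|a| / 2⌋`-th entry of the table,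
all negated if `a` is negative. -/
def tableRow (n : ℕ) (T : List (List ℤ)) (a : ℤ) : List ℤ :=
  if a.natAbs < n ∧ (a + n) % 2 = 1 then
    if 0 ≤ a then T.getD (a.natAbs / 2) [] else (T.getD (a.natAbs / 2) []).map fun b => -b
  else []

/-- The neighborhoods given by a table. -/
def tableCode (n : ℕ) (T : List (List ℤ)) (a : ℤ) : Finset ℤ := (tableRow n T a).toFinset

/-- The labels of order `n` as a list. -/
def labelList (n : ℕ) : List ℤ := (List.range n).map fun i : ℕ => 1 - (n : ℤ) + 2 * (i : ℤ)

/-- The labels within distance `k` of `a`. -/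
def within (n : ℕ) (T : List (List ℤ)) (a : ℤ) : ℕ → List ℤ
  | 0 => [a]
  | k + 1 => within n T a k ++ (labelList n).filter fun b =>
      !(within n T a k).elem b && (tableRow n T b).any fun c => (within n T a k).elem c

/-- A decidable form of `IsCode` for a table. -/
def IsTable (n : ℕ) (T : List (List ℤ)) : Prop :=
  ∀ a ∈ labelList n, (tableRow n T a).Nodup ∧ (tableRow n T a).length = 4 ∧
    (tableRow n T a).sum = 0 ∧
    a ∉ tableRow n T a ∧ ∀ b ∈ tableRow n T a, b ∈ labelList n ∧ a ∈ tableRow n T b ∧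
      -b ∈ tableRow n T (-a)

theorem mem_labelList {n : ℕ} {a : ℤ} : a ∈ labelList n ↔ a ∈ labelSet n := by
  simp only [labelList, List.mem_map, List.mem_range]
  exact exists_congr fun i => and_congr_right fun _ => eq_comm

theorem mem_tableCode {n : ℕ} {T : List (List ℤ)} {a b : ℤ} :
    b ∈ tableCode n T a ↔ b ∈ tableRow n T a := List.mem_toFinset

theorem mem_of_tableRow {n : ℕ} {T : List (List ℤ)} {a b : ℤ} (h : b ∈ tableRow n T a) :
    a ∈ labelList n := by
  unfold tableRow at h
  split_ifs at h with h1
  · rw [mem_labelList, mem_labelSet_iff]; omega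
  · rw [mem_labelList, mem_labelSet_iff]; omega
  · simp at h

theorem IsTable.isCode {n : ℕ} {T : List (List ℤ)} (h : IsTable n T) :
    IsCode n (tableCode n T) where
  mem hb := mem_labelList.mp (mem_of_tableRow (mem_tableCode.mp hb))
  symm := by
    intro a b hb
    rw [mem_tableCode] at hb ⊢
    exact ((h a (mem_of_tableRow hb)).2.2.2.2 b hb).2.1
  irrefl := by
    intro a ha
    rw [mem_tableCode] at ha
    exact (h a (mem_of_tableRow ha)).2.2.2.1 ha
  neg := by
    intro a b hb
    rw [mem_tableCode] at hb ⊢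
    exact ((h a (mem_of_tableRow hb)).2.2.2.2 b hb).2.2
  card := by
    intro a ha
    obtain ⟨h1, h2, -⟩ := h a (mem_labelList.mpr ha)
    rw [tableCode, List.toFinset_card_of_nodup h1, h2]
  sum := by
    intro a ha
    obtain ⟨h1, -, h3, -⟩ := h a (mem_labelList.mpr ha)
    rw [tableCode, List.sum_toFinset _ h1, List.map_id', h3]

theorem isLinked_of_within {n : ℕ} {T : List (List ℤ)} (hT : IsTable n T) {a : ℤ} (k : ℕ)
    (h : ∀ b ∈ labelList n, b ∈ within n T a k) : IsLinked n (tableCode n T) := by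
  have : Std.Symm fun x y => y ∈ tableCode n T x := ⟨fun _ _ => hT.isCode.symm⟩
  have key : ∀ k, ∀ b ∈ within n T a k,
      Relation.ReflTransGen (fun x y => y ∈ tableCode n T x) a b := by
    intro k
    induction k with
    | zero =>
      intro b hb
      rw [List.mem_singleton.mp hb]
    | succ k ih =>
      intro b hb
      rcases List.mem_append.mp hb with hb | hb
      · exact ih b hb
      · obtain ⟨-, hb⟩ := List.mem_filter.mp hb
        obtain ⟨c, hc, hc'⟩ := List.any_eq_true.mp (Bool.and_eq_true_iff.mp hb).2
        exact (ih c (List.elem_iff.mp hc')).tail (hT.isCode.symm (mem_tableCode.mpr hc))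
  intro b hb c hc
  exact (symm (key k b (h b (mem_labelList.mpr hb)))).trans (key k c (h c (mem_labelList.mpr hc)))

theorem nonDegenerate_of_table {n : ℕ} {T : List (List ℤ)}
    (h : ∀ a ∈ labelList n, ∀ b ∈ tableRow n T a, a = 0 ∨ b = 0 ∨ -b ∉ tableRow n T a) :
    NonDegenerate (tableCode n T) := by
  intro a b ha hb h1 h2
  rw [mem_tableCode] at h1 h2
  rcases h a (mem_of_tableRow h1) b h1 with h3 | h3 | h3
  exacts [ha h3, hb h3, h3 h2]

/-- A decidable form of `IsGluable` for a table, where a connection takes at most four steps. -/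
def IsGluableTable (n : ℕ) (T : List (List ℤ)) (X Y z : ℤ) : Prop :=
  IsTable n T ∧ (∀ b ∈ labelList n, b ∈ within n T X 4) ∧
    (∀ a ∈ labelList n, ∀ b ∈ tableRow n T a, a = 0 ∨ b = 0 ∨ -b ∉ tableRow n T a) ∧
    (X + Y = 2 ∧ X ≠ Y ∧ X ∈ labelList n ∧ Y ∈ labelList n ∧ -X ∈ tableRow n T X ∧
      -Y ∈ tableRow n T X ∧ -Y ∈ tableRow n T Y) ∧
    (z ∈ labelList n ∧ z ≠ X ∧ z ≠ Y ∧ z ≠ -X ∧ z ≠ -Y) ∧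
    ∀ w ∈ labelList n, w = z ∨ ∃ x ∈ tableRow n T z, x ∉ tableRow n T w

instance (n : ℕ) (T : List (List ℤ)) : Decidable (IsTable n T) := by unfold IsTable; infer_instance

instance (n : ℕ) (T : List (List ℤ)) (X Y z : ℤ) : Decidable (IsGluableTable n T X Y z) := by
  unfold IsGluableTable; infer_instance

theorem IsGluableTable.isGluable {n : ℕ} {T : List (List ℤ)} {X Y z : ℤ}
    (h : IsGluableTable n T X Y z) : IsGluable n (tableCode n T) X Y z := by
  obtain ⟨h1, h2, h3, ⟨h4, h5, h6, h7, h8, h9, h10⟩, ⟨h11, h12, h13, h14, h15⟩, h16⟩ := h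
  refine ⟨h1.isCode, nonDegenerate_of_table h3, isLinked_of_within h1 4 h2, h4, h5,
    mem_labelList.mp h6, mem_labelList.mp h7, mem_tableCode.mpr h8, mem_tableCode.mpr h9,
    mem_tableCode.mpr h10, mem_labelList.mp h11, h12, h13, h14, h15, fun w hw he => ?_⟩
  refine (h16 w (mem_labelList.mpr hw)).resolve_right ?_
  rintro ⟨x, hx, hx'⟩
  rw [← mem_tableCode, ← he, mem_tableCode] at hx
  exact hx' hx

theorem isGluableTable_18 : IsGluableTable 18
    [[-1, -5, -9, 15], [-5, 7, 15, -17], [-1, -3, -13, 17], [3, -7, -9, 13], [-1, -7, -9, 17],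
     [-11, 13, 15, -17], [-5, 7, 11, -13], [1, 3, 11, -15], [-3, 5, 9, -11]]
    13 (-11) 1 := by decide +kernel

theorem isGluableTable_20 : IsGluableTable 20
    [[-5, 7, 15, -17], [-3, 7, 9, -13], [-1, -5, -9, 15], [1, 3, 13, -17], [3, -5, -9, 11],
     [9, -11, -17, 19], [-3, 7, 15, -19], [1, 5, 13, -19], [-1, -7, -11, 19], [11, -13, -15, 17]]
    11 (-9) 1 := by decide +kernel

theorem isGluableTable_21 : IsGluableTable 21
    [[6, -6, 14, -14], [-2, 8, 14, -20], [-4, -6, -8, 18], [-4, -6, 10, 0], [2, -4, -18, 20],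
     [6, -10, -16, 20], [-12, 14, 16, -18], [2, 12, -14, 0], [-10, 12, 18, -20], [4, -8, -12, 16],
     [-2, 8, 10, -16]]
    14 (-12) 2 := by decide +kernel

theorem isGluableTable_23 : IsGluableTable 23
    [[2, -2, 14, -14], [-6, -12, 18, 0], [6, -12, -14, 20], [-2, 4, 16, -18], [-8, 10, 20, -22],
     [8, -10, -18, 20], [-2, -4, -16, 22], [-4, -14, 18, 0], [6, -12, -16, 22], [2, -6, -10, 14],
     [4, 8, 10, -22], [-8, 12, 16, -20]]
    10 (-8) 2 := by decide +kernel

theorem isGluableTable_24 : IsGluableTable 24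
    [[-1, 3, 5, -7], [1, -3, -21, 23], [1, -9, -11, 19], [-1, 9, 11, -19], [-5, 7, 21, -23],
     [-5, 7, 21, -23], [-13, 15, 17, -19], [13, -15, -17, 19], [13, -15, -21, 23],
     [5, -7, -13, 15], [-3, 9, 11, -17], [3, -9, -11, 17]]
    3 (-1) 17 := by decide +kernel

theorem isGluableTable_25 : IsGluableTable 25
    [[12, -12, 24, -24], [-2, 4, 10, -12], [2, -4, -6, 8], [-4, -8, -10, 22], [4, -6, -22, 24],
     [2, -6, -20, 24], [-2, -12, 14, 0], [12, -14, -18, 20], [-16, 18, 20, -22],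
     [-14, 16, 22, -24], [-10, 14, 16, -20], [6, -8, -16, 18], [8, 10, -18, 0]]
    14 (-12) 2 := by decide +kernel

theorem isGluableTable_27 : IsGluableTable 27
    [[6, -6, 14, -14], [-2, -8, -14, 24], [-4, -8, -12, 24], [-6, -16, 22, 0], [-2, -4, -20, 26],
     [-14, 16, 20, -22], [-4, 14, 16, -26], [-2, -10, 12, 0], [-6, 10, 12, -16],
     [-18, 20, 24, -26], [-8, 10, 18, -20], [6, -10, -22, 26], [2, 4, 18, -24], [8, -12, -18, 22]]
    20 (-18) 2 := by decide +kernel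

theorem isGluableTable_30 : IsGluableTable 30
    [[-7, 15, 19, -27], [7, -11, -19, 23], [-5, 7, 25, -27], [-1, 3, 5, -7], [-11, 15, 21, -25],
     [-3, -9, -11, 23], [17, -19, -21, 23], [1, 9, 19, -29], [13, -17, -25, 29], [1, -3, -13, 15],
     [9, -13, -21, 25], [3, 11, 13, -27], [5, -9, -17, 21], [-1, -5, -23, 29], [-15, 17, 27, -29]]
    7 (-5) 1 := by decide +kernel

/-- Lengthening by eight reaches each of these orders from one of the tables. -/
theorem exists_isGluable {n : ℕ} (h : 23 ≤ n ∨ n = 18 ∨ n = 20 ∨ n = 21) :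
    ∃ nb X Y z, IsGluable n nb X Y z := by
  induction n using Nat.strong_induction_on with
  | _ n ih =>
    by_cases h1 : n ∈ [18, 20, 21, 23, 24, 25, 27, 30]
    · simp only [List.mem_cons, List.not_mem_nil, or_false] at h1
      rcases h1 with rfl | rfl | rfl | rfl | rfl | rfl | rfl | rfl
      exacts [⟨_, _, _, _, isGluableTable_18.isGluable⟩, ⟨_, _, _, _, isGluableTable_20.isGluable⟩,
        ⟨_, _, _, _, isGluableTable_21.isGluable⟩, ⟨_, _, _, _, isGluableTable_23.isGluable⟩,
        ⟨_, _, _, _, isGluableTable_24.isGluable⟩, ⟨_, _, _, _, isGluableTable_25.isGluable⟩,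
        ⟨_, _, _, _, isGluableTable_27.isGluable⟩, ⟨_, _, _, _, isGluableTable_30.isGluable⟩]
    · simp only [List.mem_cons, List.not_mem_nil, or_false, not_or] at h1
      obtain ⟨k, rfl⟩ : ∃ k, n = k + 8 := ⟨n - 8, by omega⟩
      obtain ⟨nb, X, Y, z, hk⟩ := ih k (by omega) (by omega)
      exact ⟨_, _, _, _, hk.step⟩

/-- A decidable form of a connected code for a table, where a connection takes at most eight
steps. -/
def IsLinkedTable (n : ℕ) (T : List (List ℤ)) : Prop :=
  IsTable n T ∧ ∀ b ∈ labelList n, b ∈ within n T (1 - n) 8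

instance (n : ℕ) (T : List (List ℤ)) : Decidable (IsLinkedTable n T) := by
  unfold IsLinkedTable; infer_instance

/-- The wreath graph `W(m)` with opposite labels for twins. -/
def wreathTable (m : ℕ) : List (List ℤ) :=
  (List.range m).map fun i : ℕ => [2 * ((i + 1) % m : ℕ) + 1, -(2 * ((i + 1) % m : ℕ) + 1),
    2 * ((i + m - 1) % m : ℕ) + 1, -(2 * ((i + m - 1) % m : ℕ) + 1)]

theorem isLinkedTable_wreathTable : ∀ m ∈ [3, 4, 5, 6, 7, 8, 11],
    IsLinkedTable (2 * m) (wreathTable m) := by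
  decide +kernel

theorem exists_code_small {n : ℕ} (h : Even n) (h6 : 6 ≤ n)
    (hn : ¬(23 ≤ n ∨ n = 18 ∨ n = 20 ∨ n = 21)) :
    ∃ nb, IsCode n nb ∧ IsLinked n nb := by
  obtain ⟨m, rfl⟩ := h
  rw [← two_mul] at *
  obtain ⟨h1, h2⟩ := isLinkedTable_wreathTable m (by simp; omega)
  exact ⟨_, h1.isCode, isLinked_of_within h1 8 h2⟩

/-- A nondegenerate labeling of the complete bipartite graph with parts of size four. -/
def table8 : List (List ℤ) := [[-1, 3, 5, -7], [1, -3, -5, 7], [1, -3, -5, 7], [-1, 3, 5, -7]]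

/-- A nondegenerate labeling of a wreath graph. -/
def table16 : List (List ℤ) :=
  [[-3, 5, 11, -13], [-1, 7, 9, -15], [1, -5, -9, 13], [3, -7, -11, 15], [3, -5, -11, 13],
    [1, -7, -9, 15], [-1, 5, 9, -13], [-3, 7, 11, -15]]

theorem exists_nonDegenerate_small {n : ℕ} (h : n = 8 ∨ n = 16) :
    ∃ nb, IsCode n nb ∧ IsLinked n nb ∧ NonDegenerate nb := by
  have key : ∀ T, IsLinkedTable n T ∧ (∀ a ∈ labelList n, ∀ b ∈ tableRow n T a,
      a = 0 ∨ b = 0 ∨ -b ∉ tableRow n T a) → ∃ nb, IsCode n nb ∧ IsLinked n nb ∧ NonDegenerate nb :=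
    fun T ⟨⟨h1, h2⟩, h3⟩ => ⟨_, h1.isCode, isLinked_of_within h1 8 h2, nonDegenerate_of_table h3⟩
  rcases h with rfl | rfl
  · exact key table8 (by decide +kernel)
  · exact key table16 (by decide +kernel)

/-! ### The excluded orders -/

open SymSearch

theorem refuteOdd_le_six : refuteOdd 64 2 = true ∧ refuteOdd 64 3 = true ∧ refuteOdd 64 4 = true ∧
    refuteOdd 64 5 = true ∧ refuteOdd 64 6 = true := by decide +kernel

theorem refuteOdd_seven : refuteOdd 100 7 = true := by decide +kernel

theorem refuteOdd_eight : refuteOdd 128 8 = true := by decide +kernel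

theorem refuteOdd_nine : refuteOdd 192 9 = true := by decide +kernel

theorem refuteEven_le_seven : refuteEven 64 3 id = true ∧ refuteEven 64 5 id = true ∧
    refuteEven 64 6 id = true ∧ refuteEven 64 7 id = true := by decide +kernel

set_option maxHeartbeats 0 in
/-- The candidates for the last row are divided into four parts to limit the memory that each
evaluation needs. -/
theorem refuteEven_eleven : refuteEven 160 11 (List.take 40) = true ∧
    refuteEven 160 11 (fun l => (l.drop 40).take 40) = true ∧
    refuteEven 160 11 (fun l => (l.drop 80).take 40) = true ∧
    refuteEven 160 11 (List.drop 120) = true :=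
  ⟨by decide +kernel, by decide +kernel, by decide +kernel, by decide +kernel⟩

theorem allTwinned_four : allTwinned 4 = true := by decide +kernel

theorem allTwinned_eight : allTwinned 8 = true := by decide +kernel

theorem odd_code_false {n : ℕ} {nb : ℤ → Finset ℤ} (h : IsCode n nb) (hl : IsLinked n nb)
    (hn : Odd n) (h5 : 5 ≤ n) (h21 : n < 21) : False := by
  obtain ⟨k, rfl⟩ := hn
  have hd := h.nonDegenerate_of_odd hl
  have h1 : 2 ≤ k := by omega
  have h2 : k ≤ 9 := by omega
  obtain ⟨r2, r3, r4, r5, r6⟩ := refuteOdd_le_six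
  interval_cases k
  · exact h.odd_false hd (by norm_num) (by norm_num) r2
  · exact h.odd_false hd (by norm_num) (by norm_num) r3
  · exact h.odd_false hd (by norm_num) (by norm_num) r4
  · exact h.odd_false hd (by norm_num) (by norm_num) r5
  · exact h.odd_false hd (by norm_num) (by norm_num) r6
  · exact h.odd_false hd (by norm_num) (by norm_num) refuteOdd_seven
  · exact h.odd_false hd (by norm_num) (by norm_num) refuteOdd_eight
  · exact h.odd_false hd (by norm_num) (by norm_num) refuteOdd_nine

theorem even_code_false {m : ℕ} {nb : ℤ → Finset ℤ} (h : IsCode (2 * m) nb) (hd : NonDegenerate nb)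
    (hm : m = 3 ∨ m = 5 ∨ m = 6 ∨ m = 7 ∨ m = 11) : False := by
  obtain ⟨r3, r5, r6, r7⟩ := refuteEven_le_seven
  have hid : ∀ l : List Row, ∀ r ∈ l, ∃ f ∈ [(id : List Row → List Row)], r ∈ f l :=
    fun l r hr => ⟨id, List.mem_singleton.mpr rfl, hr⟩
  rcases hm with rfl | rfl | rfl | rfl | rfl
  · exact h.even_false (S := 64) hd (by norm_num) (by norm_num) hid (by simpa using r3)
  · exact h.even_false (S := 64) hd (by norm_num) (by norm_num) hid (by simpa using r5)
  · exact h.even_false (S := 64) hd (by norm_num) (by norm_num) hid (by simpa using r6)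
  · exact h.even_false (S := 64) hd (by norm_num) (by norm_num) hid (by simpa using r7)
  · obtain ⟨q1, q2, q3, q4⟩ := refuteEven_eleven
    refine h.even_false (S := 160) (fs := [List.take 40, fun l => (l.drop 40).take 40,
      fun l => (l.drop 80).take 40, List.drop 120]) hd (by norm_num) (by norm_num)
        (fun l r hr => ?_) ?_
    · have h1 : l = l.take 40 ++ ((l.drop 40).take 40 ++ ((l.drop 80).take 40 ++ l.drop 120)) := by
        have e1 := List.take_append_drop 40 (l.drop 80)
        have e2 := List.take_append_drop 40 (l.drop 40)
        rw [List.drop_drop] at e1 e2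
        rw [e1, e2, List.take_append_drop]
      rw [h1] at hr
      simp only [List.mem_append] at hr
      simp only [List.mem_cons, List.not_mem_nil, or_false, exists_eq_or_imp, exists_eq_left]
      exact hr
    · intro f hf
      simp only [List.mem_cons, List.not_mem_nil, or_false] at hf
      rcases hf with rfl | rfl | rfl | rfl
      exacts [q1, q2, q3, q4]

section

variable {n : ℕ} {G : SimpleGraph (Fin n)} {l : Fin n → ℤ}

theorem odd_order_false (hc : G.Connected) (hG : IsTetravalent G) (h : IsDistanceMagicLabeling G l)
    (hs : IsSelfReverse G l) (hn : Odd n) (h5 : 5 ≤ n) (h21 : n < 21) : False := by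
  have h1 := isCode_labelCode hG h hs
  have h2 := isLinked_labelCode hc h
  rw [Fintype.card_fin] at h1 h2
  exact odd_code_false h1 h2 hn h5 h21

/-- For a degenerate labeling opposite labels belong to twins, and for orders `8` and `16` a
nondegenerate labeling has twins as well; the other orders have no nondegenerate labeling. -/
theorem isWreathGraph_of_even (hc : G.Connected) (hG : IsTetravalent G)
    (h : IsDistanceMagicLabeling G l) (hs : IsSelfReverse G l)
    (hn : n ∈ [6, 8, 10, 12, 14, 16, 22]) : IsWreathGraph G := by
  have h1 := isCode_labelCode hG h hs
  have h2 := isLinked_labelCode hc h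
  by_cases hd : NonDegenerate (labelCode G l)
  · simp only [List.mem_cons, List.not_mem_nil, or_false] at hn
    by_cases h8 : n = 8 ∨ n = 16
    · have : ∃ m, 1 ≤ m ∧ n = 2 * m ∧ allTwinned m = true := by
        rcases h8 with rfl | rfl
        exacts [⟨4, by norm_num, rfl, allTwinned_four⟩, ⟨8, by norm_num, rfl, allTwinned_eight⟩]
      obtain ⟨m, hm, rfl, ht⟩ := this
      rw [Fintype.card_fin] at h1
      obtain ⟨τ, hτ⟩ := h1.exists_twins hd hm ht
      exact isWreathGraph_of_twins hG hc h τ (by rwa [Fintype.card_fin])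
    · obtain ⟨m, rfl⟩ : ∃ m, n = 2 * m := ⟨n / 2, by omega⟩
      rw [Fintype.card_fin] at h1
      exact (even_code_false h1 hd (by omega)).elim
  · exact isWreathGraph_of_twins hG hc h (fun a => -a) (h1.neg_twins h2 hd)

theorem even_order_false (hG : IsTetravalent G) (h : IsDistanceMagicLabeling G l)
    (hs : IsSelfReverse G l) (hd : ¬ IsDegenerateLabeling G l) (hn : n ∈ [6, 10, 12, 14, 22]) :
    False := by
  have h1 := isCode_labelCode hG h hs
  simp only [List.mem_cons, List.not_mem_nil, or_false] at hn
  obtain ⟨m, rfl⟩ : ∃ m, n = 2 * m := ⟨n / 2, by omega⟩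
  rw [Fintype.card_fin] at h1
  exact even_code_false h1 (nonDegenerate_labelCode h hd) (by omega)

end

/-! ### The orders that occur -/

theorem theorem6p1 (n : ℕ) (hn : 5 ≤ n) :
    ((∃ G : SimpleGraph (Fin n), G.Connected ∧ IsTetravalent G ∧
        ∃ l : Fin n → ℤ, IsDistanceMagicLabeling G l ∧ IsSelfReverse G l) ↔
      (Even n ∧ 6 ≤ n) ∨ (Odd n ∧ 21 ≤ n)) ∧
    ((∃ G : SimpleGraph (Fin n), G.Connected ∧ IsTetravalent G ∧
        ∃ l : Fin n → ℤ, IsDistanceMagicLabeling G l ∧ IsSelfReverse G l ∧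
          ¬ IsDegenerateLabeling G l) ↔
      23 ≤ n ∨ n ∈ ({8, 16, 18, 20, 21} : Set ℕ)) ∧
    ((∃ G : SimpleGraph (Fin n), G.Connected ∧ IsTetravalent G ∧ ¬ IsWreathGraph G ∧
        ∃ l : Fin n → ℤ, IsDistanceMagicLabeling G l ∧ IsSelfReverse G l) ↔
      18 ≤ n ∧ n ∉ ({19, 22} : Set ℕ)) := by
  simp only [Set.mem_insert_iff, Set.mem_singleton_iff, not_or]
  have hpar := Nat.even_or_odd n
  refine ⟨⟨?_, ?_⟩, ⟨?_, ?_⟩, ?_, ?_⟩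
  · rintro ⟨G, hc, hG, l, h, hs⟩
    rcases hpar with he | ho
    · obtain ⟨m, rfl⟩ := he
      exact Or.inl ⟨⟨m, rfl⟩, by omega⟩
    · refine Or.inr ⟨ho, ?_⟩
      by_contra hlt
      exact odd_order_false hc hG h hs ho hn (by omega)
  · intro h
    have key : ∃ nb, IsCode n nb ∧ IsLinked n nb := by
      by_cases hgl : 23 ≤ n ∨ n = 18 ∨ n = 20 ∨ n = 21
      · obtain ⟨nb, X, Y, z, hg⟩ := exists_isGluable hgl
        exact ⟨nb, hg.toIsCode, hg.linked⟩
      · rcases h with ⟨he, h6⟩ | ⟨⟨k, rfl⟩, h21⟩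
        · exact exists_code_small he h6 hgl
        · omega
    obtain ⟨nb, h1, h2⟩ := key
    exact ⟨codeGraph h1, h1.connected (by omega) h2, h1.isTetravalent, stdLabel n,
      h1.isDistanceMagicLabeling, h1.isSelfReverse⟩
  · rintro ⟨G, hc, hG, l, h, hs, hd⟩
    by_contra hlt
    rcases hpar with he | ho
    · refine even_order_false hG h hs hd ?_
      obtain ⟨m, rfl⟩ := he
      simp only [List.mem_cons, List.not_mem_nil, or_false]
      omega
    · refine odd_order_false hc hG h hs ho hn ?_
      obtain ⟨m, rfl⟩ := ho
      omega
  · intro h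
    have key : ∃ nb, IsCode n nb ∧ IsLinked n nb ∧ NonDegenerate nb := by
      by_cases hgl : 23 ≤ n ∨ n = 18 ∨ n = 20 ∨ n = 21
      · obtain ⟨nb, X, Y, z, hg⟩ := exists_isGluable hgl
        exact ⟨nb, hg.toIsCode, hg.linked, hg.nonDegenerate⟩
      · exact exists_nonDegenerate_small (by omega)
    obtain ⟨nb, h1, h2, h3⟩ := key
    exact ⟨codeGraph h1, h1.connected (by omega) h2, h1.isTetravalent, stdLabel n,
      h1.isDistanceMagicLabeling, h1.isSelfReverse, h1.not_isDegenerateLabeling h3⟩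
  · rintro ⟨G, hc, hG, hw, l, h, hs⟩
    by_contra hlt
    rcases hpar with he | ho
    · refine hw (isWreathGraph_of_even hc hG h hs ?_)
      obtain ⟨m, rfl⟩ := he
      simp only [List.mem_cons, List.not_mem_nil, or_false]
      omega
    · refine odd_order_false hc hG h hs ho hn ?_
      obtain ⟨m, rfl⟩ := ho
      omega
  · rintro ⟨h18, h19, h22⟩
    obtain ⟨nb, X, Y, z, h⟩ := exists_isGluable (n := n) (by omega)
    exact ⟨codeGraph h.toIsCode, h.toIsCode.connected (by omega) h.linked, h.toIsCode.isTetravalent,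
      h.toIsCode.not_isWreathGraph h.mem_z h.twinless, stdLabel n,
      h.toIsCode.isDistanceMagicLabeling, h.toIsCode.isSelfReverse⟩
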